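/- **Setting.** Let $k$ be a field and let $\mathcal U$ be Lauda's 2-category categorifying quantum $\mathfrak{sl}_2$. Its objects are the weights $n\in\mathbb Z$. The 1-morphisms are formal finite direct sums of $\mathcal E_{\underline\varepsilon}\mathbf 1_n\{t\}$, where $\underline\varepsilon$ is a word in $\mathcal E,\mathcal F$ ($\mathcal E$ raises the weight by $2$, $\mathcal F$ lowers it by $2$) and $t\in\mathbb Z$. The 2-morphisms $\mathcal E_{\underline\varepsilon}\mathbf 1_n\{t\}\to\mathcal E_{\underline\varepsilon'}\mathbf 1_n\{t'\}$ are the $k$-linear combinations of degree $t-t'$ of string diagrams generated by dots (degree $2$), crossings of equally oriented strands (degree $-2$), and cups and caps: the clockwise ones $\eta:\mathbf 1_n\to\mathcal{EF}\mathbf 1_n$, $\epsilon:\mathcal{EF}\mathbf 1_n\to\mathbf 1_n$ of degree $1-n$ and the counter-clockwise ones $\eta':\mathbf 1_n\to\mathcal{FE}\mathbf 1_n$, $\epsilon':\mathcal{FE}\mathbf 1_n\to\mathbf 1_n$ of degree $1+n$. The relations are: planar isotopy (the cups and caps are biadjunctions between $\mathcal E$ and $\mathcal F$, and dots and crossings are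 cyclic); the nilHecke relations for upward strands (the square of the crossing is $0$, the braid relation, and, with diagrams read from bottom to top, (dot on the lower left strand) $-$ (dot on the upper right strand) $=$ (dot on the upper left strand) $-$ (dot on the lower right strand) $=\mathrm{Id}$); a bubble of negative degree is $0$ and a bubble of degree $0$ is $1$; the curl relations and the decompositions of the identities of $\mathcal{EF}\mathbf 1_n$, $\mathcal{FE}\mathbf 1_n$ below. Write $c_j$, resp. $\bar c_j$, for the clockwise, resp. counter-clockwise, bubble of degree $2j$ in a region of weight $n$ (it carries $n-1+j$, resp. $-n-1+j$, dots). When that number is negative the bubble is *fake* and defined by $\big(\sum_{j\ge0}\bar c_jt^j\big)\big(\sum_{j\ge0}c_jt^j\big)=1$. Put $c_j=\bar c_j=0$ for $j<0$. Let $x_E,x_F$ denote a dot on the $\mathcal E$-strand, resp. the $\mathcal F$-strand, of $\mathcal{EF}$ or $\mathcal{FE}$; let $X:\mathcal{EF}\mathbf 1_n\to\mathcal{FE}\mathbf 1_n$ and $Y:\mathcal{FE}\mathbf 1_n\to\mathcal{EF}\mathbf 1_n$ be the sideways crossings, and let $\eta_a$, $\epsilon_a$, $\eta'_a$, $\epsilon'_a$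 be the cups and caps with $a$ dots. Sums are over non-negative integers, and bubbles lie in the outer region, of weight $n$. The curl relations are: the right curl on $\mathcal E\mathbf 1_n$ is $-\sum_{a+b=-n}$ ($a$ dots on the strand, $c_b$ to its right), the left curl on an upward strand with weight $n$ at its left is $\sum_{a+b=n}$ ($\bar c_b$ to its left, $a$ dots on the strand), and the rotated versions. The decompositions are $$\mathrm{Id}_{\mathcal{EF}\mathbf 1_n}=-YX+\sum_{a+b+c=n-1}\eta_a\,\bar c_b\,\epsilon_c,\qquad \mathrm{Id}_{\mathcal{FE}\mathbf 1_n}=-XY+\sum_{a+b+c=-n-1}\eta'_a\,c_b\,\epsilon'_c .$$ **Symmetries.** $\omega$ inverts the orientation of the strands (so $\mathcal E\leftrightarrow\mathcal F$), negates the weights and multiplies each crossing by $-1$. $\sigma$ reflects diagrams across the vertical axis, negates the weights and multiplies each crossing by $-1$; it reverses the order of 1-morphisms. $\psi$ reflects diagrams across the horizontal axis and inverts orientation; it is contravariant on 2-morphisms and changes $\{t\}$ into $\{-t\}$. These extend to complexes, with $\psi(X)^i=\psi(X^{-i})$. Here $\sigma^2=\mathrm{Id}$ and $\omega\sigma=\sigma\omega$,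 $\psi\sigma=\sigma\psi$, $\psi\omega=\omega\psi$; these equalities are used as identifications below. Let $\mathcal G=\{1,\psi,\omega,\sigma,\psi\omega,\psi\sigma,\omega\sigma,\psi\omega\sigma\}$ and $\mathcal G_1=\{1,\psi,\omega\sigma,\psi\omega\sigma\}$. **The complexes.** $\mathcal C\mathbf 1_n$ is the complex in degrees $-1,0,1$ $$\mathcal{EF}\mathbf 1_n\{2\}\oplus\mathbf 1_n\{1-n\}\xrightarrow{\begin{pmatrix}x_E&\eta\\x_F&\eta\end{pmatrix}}\mathcal{EF}\mathbf 1_n\oplus\mathcal{EF}\mathbf 1_n\xrightarrow{\begin{pmatrix}-x_F&x_E\\\epsilon&-\epsilon\end{pmatrix}}\mathcal{EF}\mathbf 1_n\{-2\}\oplus\mathbf 1_n\{n-1\},$$ and $\mathcal C'\mathbf 1_n$ is $$\mathcal{FE}\mathbf 1_n\{2\}\oplus\mathbf 1_n\{1+n\}\xrightarrow{\begin{pmatrix}x_E&\eta'\\x_F&\eta'\end{pmatrix}}\mathcal{FE}\mathbf 1_n\oplus\mathcal{FE}\mathbf 1_n\xrightarrow{\begin{pmatrix}-x_F&x_E\\\epsilon'&-\epsilon'\end{pmatrix}}\mathcal{FE}\mathbf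 1_n\{-2\}\oplus\mathbf 1_n\{-n-1\}.$$ **Proposition.** Define, by their matrices in the degrees $-1,0,1$ (acting on columns; the summands of $g(\mathcal C\mathbf 1_{\pm n})$ are always listed with the $\mathcal{EF}$- or $\mathcal{FE}$-term before the $\mathbf 1_n$-term, and in degree $0$ in the order inherited from $\mathcal C$), * $\varrho^\psi:\mathcal C\mathbf 1_n\to\psi(\mathcal C\mathbf 1_n)$ by $\begin{pmatrix}-1&0\\0&1\end{pmatrix},\begin{pmatrix}0&1\\-1&0\end{pmatrix},\begin{pmatrix}1&0\\0&-1\end{pmatrix}$ and $\hat\varrho^\psi:\psi(\mathcal C\mathbf 1_n)\to\mathcal C\mathbf 1_n$ by $\begin{pmatrix}-1&0\\0&1\end{pmatrix},\begin{pmatrix}0&-1\\1&0\end{pmatrix},\begin{pmatrix}1&0\\0&-1\end{pmatrix}$; * $\varrho^{\sigma\omega}:\mathcal C\mathbf 1_n\to\sigma\omega(\mathcal C\mathbf 1_n)$ and $\hat\varrho^{\sigma\omega}:\sigma\omega(\mathcal C\mathbf 1_n)\to\mathcal C\mathbf 1_n$, both by $\begin{pmatrix}1&0\\0&1\end{pmatrix},\begin{pmatrix}0&1\\1&0\end{pmatrix},\begin{pmatrix}-1&0\\0&-1\end{pmatrix}$;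 * $\varrho^\sigma:\mathcal C\mathbf 1_n\to\sigma(\mathcal C\mathbf 1_{-n})$ by $$\begin{pmatrix}X&-\sum_{a+b=-n-1}\eta'_a c_b\\-\epsilon&-c_{-n}\end{pmatrix},\quad\begin{pmatrix}X&0\\0&X\end{pmatrix},\quad\begin{pmatrix}X&-\eta'\\-\sum_{a+b=n-1}\bar c_b\,\epsilon_a&\bar c_n\end{pmatrix};$$ * $\hat\varrho^\sigma:\sigma(\mathcal C\mathbf 1_{-n})\to\mathcal C\mathbf 1_n$ by $$\begin{pmatrix}-Y&-\sum_{a+b=n-1}\eta_a\bar c_b\\-\epsilon'&-\bar c_n\end{pmatrix},\quad\begin{pmatrix}-Y&0\\0&-Y\end{pmatrix},\quad\begin{pmatrix}-Y&-\eta\\-\sum_{a+b=-n-1}c_b\,\epsilon'_a&c_{-n}\end{pmatrix};$$ * $\varrho^\omega=\sigma(\varrho^{\sigma\omega})\circ\varrho^\sigma:\mathcal C\mathbf 1_n\to\omega(\mathcal C\mathbf 1_{-n})$ and $\hat\varrho^\omega=\hat\varrho^\sigma\circ\sigma(\hat\varrho^{\sigma\omega})$. Then for all $n\in\mathbb Z$: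 (a) All of these are chain maps. $\varrho^\psi,\hat\varrho^\psi$ are mutually inverse, and so are $\varrho^{\sigma\omega},\hat\varrho^{\sigma\omega}$. $\hat\varrho^\sigma\varrho^\sigma-\mathrm{Id}=dh+hd$ and $\varrho^\sigma\hat\varrho^\sigma-\mathrm{Id}=dh'+h'd$ for homotopies $h$ on $\mathcal C\mathbf 1_n$ and $h'$ on $\sigma(\mathcal C\mathbf 1_{-n})$ with $$h^0=\begin{pmatrix}-\sum_{a+b+c=n-2}\eta_a\bar c_b\epsilon_c&0\\-\sum_{a+b=n-1}\bar c_b\epsilon_a&0\end{pmatrix},\qquad h^1=\begin{pmatrix}0&0\\-\sum_{a+b+c=n-2}\eta_a\bar c_b\epsilon_c&\sum_{a+b=n-1}\eta_a\bar c_b\end{pmatrix},$$ $$h'^0=\begin{pmatrix}-\sum_{a+b+c=-n-2}\eta'_ac_b\epsilon'_c&0\\-\sum_{a+b=-n-1}c_b\epsilon'_a&0\end{pmatrix},\qquad h'^1=\begin{pmatrix}0&0\\-\sum_{a+b+c=-n-2}\eta'_ac_b\epsilon'_c&\sum_{a+b=-n-1}\eta'_ac_b\end{pmatrix}.$$ $\varrho^\omega$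 is a homotopy equivalence with homotopy inverse $\hat\varrho^\omega$. Consequently $\mathcal C\mathbf 1_n\cong g(\mathcal C\mathbf 1_n)$ for $g\in\mathcal G_1$ and $\mathcal C\mathbf 1_n\simeq g'(\mathcal C\mathbf 1_{-n})$ for $g'\in\mathcal G\setminus\mathcal G_1$. Moreover, in the cube with the following edges * from $\mathcal C\mathbf 1_n$: $\varrho^\psi$, $\varrho^{\sigma\omega}$, $\varrho^\sigma$, $\varrho^\omega$; * $\sigma(\varrho^{\sigma\omega}):\sigma(\mathcal C\mathbf 1_{-n})\to\omega(\mathcal C\mathbf 1_{-n})$, $\ \sigma(\varrho^\psi):\sigma(\mathcal C\mathbf 1_{-n})\to\sigma\psi(\mathcal C\mathbf 1_{-n})$, $\ \omega(\hat\varrho^\sigma):\sigma\omega(\mathcal C\mathbf 1_n)\to\omega(\mathcal C\mathbf 1_{-n})$, $\ \sigma\omega(\varrho^\psi):\sigma\omega(\mathcal C\mathbf 1_n)\to\sigma\omega\psi(\mathcal C\mathbf 1_n)$, $\ \omega(\varrho^\psi):\omega(\mathcal C\mathbf 1_{-n})\to\omega\psi(\mathcal C\mathbf 1_{-n})$; *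 from $\psi(\mathcal C\mathbf 1_n)$: $\psi(\hat\varrho^{\sigma\omega})$ to $\sigma\omega\psi(\mathcal C\mathbf 1_n)$, $\psi(\hat\varrho^\sigma)$ to $\sigma\psi(\mathcal C\mathbf 1_{-n})$, $\psi(\hat\varrho^\omega)$ to $\omega\psi(\mathcal C\mathbf 1_{-n})$; * $\psi\sigma(\hat\varrho^{\sigma\omega}):\sigma\psi(\mathcal C\mathbf 1_{-n})\to\omega\psi(\mathcal C\mathbf 1_{-n})$, $\ \psi\omega(\varrho^\sigma):\sigma\omega\psi(\mathcal C\mathbf 1_n)\to\omega\psi(\mathcal C\mathbf 1_{-n})$ the edges $\varrho^\psi$, $\varrho^{\sigma\omega}$, $\sigma(\varrho^{\sigma\omega})$, $\sigma(\varrho^\psi)$, $\omega(\varrho^\psi)$, $\sigma\omega(\varrho^\psi)$, $\psi(\hat\varrho^{\sigma\omega})$, $\psi\sigma(\hat\varrho^{\sigma\omega})$ are chain isomorphisms, and the other six are homotopy equivalences. (b) The triangles commute: $$\varrho^\omega=\sigma(\varrho^{\sigma\omega})\varrho^\sigma=\omega(\hat\varrho^\sigma)\varrho^{\sigma\omega},\qquad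 \psi(\hat\varrho^\omega)=\psi\sigma(\hat\varrho^{\sigma\omega})\psi(\hat\varrho^\sigma)=\psi\omega(\varrho^\sigma)\psi(\hat\varrho^{\sigma\omega}),$$ and the remaining four squares anticommute: $$\psi(\hat\varrho^{\sigma\omega})\varrho^\psi=-\sigma\omega(\varrho^\psi)\varrho^{\sigma\omega},\qquad \sigma(\varrho^\psi)\varrho^\sigma=-\psi(\hat\varrho^\sigma)\varrho^\psi,$$ $$\psi\sigma(\hat\varrho^{\sigma\omega})\sigma(\varrho^\psi)=-\omega(\varrho^\psi)\sigma(\varrho^{\sigma\omega}),\qquad \psi\omega(\varrho^\sigma)\sigma\omega(\varrho^\psi)=-\omega(\varrho^\psi)\omega(\hat\varrho^\sigma).$$ (c) $\mathcal C\mathbf 1_n$ and $\mathcal C'\mathbf 1_n$ are homotopy equivalent. -/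

import Mathlib

open CategoryTheory

universe u

namespace CatSL2

/-! ## Diagrams

A 1-morphism of the 2-category `U` starting at the weight `n` is a word in the letters `E`, `F`,
read from left to right as in `E_{ε₁} ⋯ E_{εₘ} 1_n`; the region at the far right of a diagram is
labelled `n`. -/

/-- The two generating 1-morphisms: `E` is drawn as an upward strand, `F` as a downward strand. -/
inductive Strand : Type
  | E
  | F

namespace Strand

/-- Reverse the orientation of a strand. -/
@[reducible] def flip : Strand → Strand
  | E => F
  | F => E

/-- The sign `ε` of a strand: `+1` for `E` and `-1` for `F`. -/
def sgn : Strand → ℤ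
  | E => 1
  | F => -1

@[simp] theorem flip_E : flip E = F := rfl
@[simp] theorem flip_F : flip F = E := rfl
@[simp] theorem sgn_E : sgn E = 1 := rfl
@[simp] theorem sgn_F : sgn F = -1 := rfl
@[simp] theorem flip_flip (s : Strand) : s.flip.flip = s := by cases s <;> rfl
@[simp] theorem sgn_flip (s : Strand) : s.flip.sgn = -s.sgn := by cases s <;> rfl

end Strand

open Strand

/-- Signed sequences. -/
abbrev Word : Type := List Strand

/-- The weight of the region to the left of the word `a` if the region to its right has
weight `n`. -/
def wt (n : ℤ) : Word → ℤ
  | [] => n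
  | s :: R => wt n R + 2 * s.sgn

@[simp] theorem wt_nil (n : ℤ) : wt n [] = n := rfl
@[simp] theorem wt_cons (n : ℤ) (s : Strand) (R : Word) :
    wt n (s :: R) = wt n R + 2 * s.sgn := rfl

/-- Formal `k`-linear combinations of diagrams with bottom `a` and top `b`.

A diagram is built from the generators `dot`, `cross`, `cup`, `cap`, each of which is placed to the
left of an identity diagram on a word `R`, by adding identity strands on the left (`strand`) and by
vertical composition (`comp f g` is the diagram with `f` at the bottom and `g` on top of it).

* `dot s R` is a dot on a strand `s`;
* `cross s R` is the crossing of two strands with the same orientation `s`;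
* `cup s R` creates the two strands `s`, `s.flip` (from left to right);
* `cap s R` closes the two strands `s`, `s.flip`.

So `cup E`, `cap E` are the clockwise and `cup F`, `cap F` the counter-clockwise ones. -/
inductive Diag (k : Type u) : Word → Word → Type u
  | zero (a b : Word) : Diag k a b
  | add {a b : Word} (f g : Diag k a b) : Diag k a b
  | smul {a b : Word} (c : k) (f : Diag k a b) : Diag k a b
  | id (a : Word) : Diag k a a
  | comp {a b c : Word} (f : Diag k a b) (g : Diag k b c) : Diag k a c
  | strand (s : Strand) {a b : Word} (f : Diag k a b) : Diag k (s :: a) (s :: b)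
  | dot (s : Strand) (R : Word) : Diag k (s :: R) (s :: R)
  | cross (s : Strand) (R : Word) : Diag k (s :: s :: R) (s :: s :: R)
  | cup (s : Strand) (R : Word) : Diag k R (s :: s.flip :: R)
  | cap (s : Strand) (R : Word) : Diag k (s :: s.flip :: R) R

namespace Diag

variable {k : Type u}

/-- The sum `g 0 + ⋯ + g (N - 1)`. -/
def sumRange {a b : Word} (g : ℕ → Diag k a b) : ℕ → Diag k a b
  | 0 => zero a b
  | N + 1 => add (sumRange g N) (g N)

/-- The sum of `g f₁ f₂` over all natural numbers `f₁, f₂` with `f₁ + f₂ = N`;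
it is zero if `N < 0`. -/
def sum₂ {a b : Word} (N : ℤ) (g : ℕ → ℕ → Diag k a b) : Diag k a b :=
  sumRange (fun i => g i (N.toNat - i)) (N + 1).toNat

/-- The sum of `g f₁ f₂ f₃` over all natural numbers `f₁, f₂, f₃` with `f₁ + f₂ + f₃ = N`;
it is zero if `N < 0`. -/
def sum₃ {a b : Word} (N : ℤ) (g : ℕ → ℕ → ℕ → Diag k a b) : Diag k a b :=
  sum₂ N fun f₂ r => sum₂ (r : ℤ) fun f₁ f₃ => g f₁ f₂ f₃

/-- `m` dots on the leftmost strand. -/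
def dots (s : Strand) (R : Word) : ℕ → Diag k (s :: R) (s :: R)
  | 0 => id (s :: R)
  | m + 1 => comp (dots s R m) (dot s R)

/-- The cup `s` with `m` dots on its left strand. -/
def dotCup (s : Strand) (R : Word) (m : ℕ) : Diag k R (s :: s.flip :: R) :=
  comp (cup s R) (dots s (s.flip :: R) m)

/-- The cap `s` with `m` dots on its left strand. -/
def dotCap (s : Strand) (R : Word) (m : ℕ) : Diag k (s :: s.flip :: R) R :=
  comp (dots s (s.flip :: R) m) (cap s R)

/-- The (real) bubble with `m` dots: clockwise for `s = E`, counter-clockwise for `s = F`. -/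
def realBubble (s : Strand) (m : ℕ) (R : Word) : Diag k R R :=
  comp (cup s R) (dotCap s R m)

variable [CommRing k]

/-- The value of the symbol `♠` in a region of weight `w`: it is `w - 1` for clockwise
and `-w - 1` for counter-clockwise bubbles. -/
def spade (s : Strand) (w : ℤ) : ℤ := s.sgn * w - 1

/-- The fake bubble `♠ + j`, defined by recursion on `j` from the infinite Grassmannian relation
`(∑ᵢ bubble(s.flip, ♠ + i) tⁱ) (∑ᵢ bubble(s, ♠ + i) tⁱ) = 1`. If `♠ + j < 0` for the orientation
`s`, then the bubbles of the opposite orientation in the coefficient of `tʲ`, `j > 0`, are real. -/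
def fakeBubble (s : Strand) (w : ℤ) (R : Word) : ℕ → Diag k R R
  | 0 => id R
  | j + 1 => smul (-1) (sumRange (fun i =>
      comp (realBubble s.flip (spade s.flip w + (i + 1)).toNat R) (fakeBubble s w R (j - i)))
        (j + 1))
  termination_by j => j
  decreasing_by omega

/-- The bubble `♠ + j` of degree `2 j` in a region of weight `w`, for all `j : ℤ`: real
if `♠ + j ≥ 0`, fake if `♠ + j < 0`, and zero if its degree is negative. -/
def bubble (s : Strand) (w : ℤ) (j : ℤ) (R : Word) : Diag k R R :=
  if j < 0 then zero R R
  else if 0 ≤ spade s w + j then realBubble s (spade s w + j).toNat R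
  else fakeBubble s w R j.toNat

/-- The sideways crossing `s, s.flip → s.flip, s`: the upward or downward crossing is rotated
with a cup on its left and a cap on its right. -/
def side (s : Strand) (R : Word) : Diag k (s :: s.flip :: R) (s.flip :: s :: R) :=
  match s with
  | E => comp (cup F (E :: F :: R)) (comp (strand F (cross E (F :: R)))
      (strand F (strand E (cap E R))))
  | F => comp (cup E (F :: E :: R)) (comp (strand E (cross F (E :: R)))
      (strand E (strand F (cap F R))))

/-- The sideways crossing `s, s.flip → s.flip, s` written with a cup on the right and a cap on the
left of the crossing. -/
def side' (s : Strand) (R : Word) : Diag k (s :: s.flip :: R) (s.flip :: s :: R) :=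
  match s with
  | E => comp (strand E (strand F (cup F R))) (comp (strand E (cross F (E :: R)))
      (cap E (F :: E :: R)))
  | F => comp (strand F (strand E (cup E R))) (comp (strand F (cross E (F :: R)))
      (cap F (E :: F :: R)))

/-- `E` with a curl on its right (`s = E`), or `F` with a curl on its right (`s = F`). -/
def rightCurl (s : Strand) (R : Word) : Diag k (s :: R) (s :: R) :=
  comp (strand s (cup s R)) (comp (cross s (s.flip :: R)) (strand s (cap s R)))

/-- `E` with a curl on its left (`s = E`), or `F` with a curl on its left (`s = F`). -/
def leftCurl (s : Strand) (R : Word) : Diag k (s :: R) (s :: R) :=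
  match s with
  | E => comp (cup F (E :: R)) (comp (strand F (cross E R)) (cap F (E :: R)))
  | F => comp (cup E (F :: R)) (comp (strand E (cross F R)) (cap E (F :: R)))

/-- The dot `s` as a left rotation of the dot on `s.flip`. -/
def dotRotL (s : Strand) (R : Word) : Diag k (s :: R) (s :: R) :=
  match s with
  | E => comp (strand E (cup F R)) (comp (strand E (dot F (E :: R))) (cap E (E :: R)))
  | F => comp (strand F (cup E R)) (comp (strand F (dot E (F :: R))) (cap F (F :: R)))

/-- The dot `s` as a right rotation of the dot on `s.flip`. -/
def dotRotR (s : Strand) (R : Word) : Diag k (s :: R) (s :: R) :=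
  match s with
  | E => comp (cup E (E :: R)) (comp (strand E (dot F (E :: R))) (strand E (cap F R)))
  | F => comp (cup F (F :: R)) (comp (strand F (dot E (F :: R))) (strand F (cap E R)))

/-- The crossing of two strands `s` as a left rotation of the crossing of two strands `s.flip`. -/
def crossRotL (s : Strand) (R : Word) : Diag k (s :: s :: R) (s :: s :: R) :=
  match s with
  | E => comp (strand E (strand E (cup F R)))
      (comp (strand E (strand E (strand F (cup F (E :: R)))))
      (comp (strand E (strand E (cross F (E :: E :: R))))
      (comp (strand E (cap E (F :: E :: E :: R))) (cap E (E :: E :: R)))))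
  | F => comp (strand F (strand F (cup E R)))
      (comp (strand F (strand F (strand E (cup E (F :: R)))))
      (comp (strand F (strand F (cross E (F :: F :: R))))
      (comp (strand F (cap F (E :: F :: F :: R))) (cap F (F :: F :: R)))))

/-- The crossing of two strands `s` as a right rotation of the crossing of two strands `s.flip`. -/
def crossRotR (s : Strand) (R : Word) : Diag k (s :: s :: R) (s :: s :: R) :=
  match s with
  | E => comp (cup E (E :: E :: R))
      (comp (strand E (cup E (F :: E :: E :: R)))
      (comp (strand E (strand E (cross F (E :: E :: R))))
      (comp (strand E (strand E (strand F (cap F (E :: R))))) (strand E (strand E (cap F R))))))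
  | F => comp (cup F (F :: F :: R))
      (comp (strand F (cup F (E :: F :: F :: R)))
      (comp (strand F (strand F (cross E (F :: F :: R))))
      (comp (strand F (strand F (strand E (cap E (F :: R))))) (strand F (strand F (cap E R))))))

/-- The relations between (linear combinations of) diagrams whose rightmost region has weight `n`.
They are closed under composition and under adding strands on the left; identity strands on the
right are the words `R`. Relations for a strand `s` are listed for both orientations; the downward
versions are rotations of the upward ones. -/
inductive Rel (n : ℤ) : ∀ {a b : Word}, Diag k a b → Diag k a b → Prop
  -- congruence
  | add_congr_left {a b : Word} {f f' : Diag k a b} (g : Diag k a b) :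
      Rel n f f' → Rel n (add f g) (add f' g)
  | add_congr_right {a b : Word} (f : Diag k a b) {g g' : Diag k a b} :
      Rel n g g' → Rel n (add f g) (add f g')
  | smul_congr {a b : Word} (c : k) {f f' : Diag k a b} :
      Rel n f f' → Rel n (smul c f) (smul c f')
  | comp_congr_left {a b c : Word} {f f' : Diag k a b} (g : Diag k b c) :
      Rel n f f' → Rel n (comp f g) (comp f' g)
  | comp_congr_right {a b c : Word} (f : Diag k a b) {g g' : Diag k b c} :
      Rel n g g' → Rel n (comp f g) (comp f g')
  | strand_congr (s : Strand) {a b : Word} {f f' : Diag k a b} :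
      Rel n f f' → Rel n (strand s f) (strand s f')
  -- the diagrams from `a` to `b` span a `k`-module
  | add_assoc {a b : Word} (f g h : Diag k a b) : Rel n (add (add f g) h) (add f (add g h))
  | add_comm {a b : Word} (f g : Diag k a b) : Rel n (add f g) (add g f)
  | zero_add {a b : Word} (f : Diag k a b) : Rel n (add (zero a b) f) f
  | neg_add {a b : Word} (f : Diag k a b) : Rel n (add (smul (-1) f) f) (zero a b)
  | one_smul {a b : Word} (f : Diag k a b) : Rel n (smul 1 f) f
  | mul_smul {a b : Word} (c d : k) (f : Diag k a b) :
      Rel n (smul (c * d) f) (smul c (smul d f))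
  | smul_add {a b : Word} (c : k) (f g : Diag k a b) :
      Rel n (smul c (add f g)) (add (smul c f) (smul c g))
  | add_smul {a b : Word} (c d : k) (f : Diag k a b) :
      Rel n (smul (c + d) f) (add (smul c f) (smul d f))
  -- composition is bilinear, associative and unital; adding a strand is linear and functorial
  | add_comp {a b c : Word} (f g : Diag k a b) (h : Diag k b c) :
      Rel n (comp (add f g) h) (add (comp f h) (comp g h))
  | smul_comp {a b c : Word} (r : k) (f : Diag k a b) (h : Diag k b c) :
      Rel n (comp (smul r f) h) (smul r (comp f h))
  | comp_add {a b c : Word} (f : Diag k a b) (g h : Diag k b c) :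
      Rel n (comp f (add g h)) (add (comp f g) (comp f h))
  | comp_smul {a b c : Word} (r : k) (f : Diag k a b) (h : Diag k b c) :
      Rel n (comp f (smul r h)) (smul r (comp f h))
  | id_comp {a b : Word} (f : Diag k a b) : Rel n (comp (id a) f) f
  | comp_id {a b : Word} (f : Diag k a b) : Rel n (comp f (id b)) f
  | assoc {a b c d : Word} (f : Diag k a b) (g : Diag k b c) (h : Diag k c d) :
      Rel n (comp (comp f g) h) (comp f (comp g h))
  | strand_add (s : Strand) {a b : Word} (f g : Diag k a b) :
      Rel n (strand s (add f g)) (add (strand s f) (strand s g))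
  | strand_smul (s : Strand) {a b : Word} (r : k) (f : Diag k a b) :
      Rel n (strand s (smul r f)) (smul r (strand s f))
  | strand_id (s : Strand) (a : Word) : Rel n (strand s (id a)) (id (s :: a))
  | strand_comp (s : Strand) {a b c : Word} (f : Diag k a b) (g : Diag k b c) :
      Rel n (strand s (comp f g)) (comp (strand s f) (strand s g))
  -- distant parts of a diagram can be moved past each other
  | dot_nat (s : Strand) {R R' : Word} (f : Diag k R R') :
      Rel n (comp (dot s R) (strand s f)) (comp (strand s f) (dot s R'))
  | cross_nat (s : Strand) {R R' : Word} (f : Diag k R R') :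
      Rel n (comp (cross s R) (strand s (strand s f))) (comp (strand s (strand s f)) (cross s R'))
  | cup_nat (s : Strand) {R R' : Word} (f : Diag k R R') :
      Rel n (comp (cup s R) (strand s (strand s.flip f))) (comp f (cup s R'))
  | cap_nat (s : Strand) {R R' : Word} (f : Diag k R R') :
      Rel n (comp (cap s R) f) (comp (strand s (strand s.flip f)) (cap s R'))
  -- cups and caps are biadjointness morphisms
  | zigzag_EL (R : Word) : Rel n (comp (strand E (cup F R)) (cap E (E :: R))) (id (E :: R))
  | zigzag_FL (R : Word) : Rel n (comp (strand F (cup E R)) (cap F (F :: R))) (id (F :: R))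
  | zigzag_ER (R : Word) : Rel n (comp (cup E (E :: R)) (strand E (cap F R))) (id (E :: R))
  | zigzag_FR (R : Word) : Rel n (comp (cup F (F :: R)) (strand F (cap E R))) (id (F :: R))
  -- nilHecke relations
  | cross_cross (s : Strand) (R : Word) :
      Rel n (comp (cross s R) (cross s R)) (zero (s :: s :: R) (s :: s :: R))
  | braid (s : Strand) (R : Word) :
      Rel n (comp (cross s (s :: R)) (comp (strand s (cross s R)) (cross s (s :: R))))
        (comp (strand s (cross s R)) (comp (cross s (s :: R)) (strand s (cross s R))))
  | dot_slide (s : Strand) (R : Word) :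
      Rel n (add (comp (dot s (s :: R)) (cross s R))
          (smul (-1) (comp (cross s R) (strand s (dot s R)))))
        (smul (s.sgn : k) (id (s :: s :: R)))
  | dot_slide' (s : Strand) (R : Word) :
      Rel n (add (comp (cross s R) (dot s (s :: R)))
          (smul (-1) (comp (strand s (dot s R)) (cross s R))))
        (smul (s.sgn : k) (id (s :: s :: R)))
  -- dots and crossings are cyclic
  | dot_rotL (s : Strand) (R : Word) : Rel n (dotRotL s R) (dot s R)
  | dot_rotR (s : Strand) (R : Word) : Rel n (dotRotR s R) (dot s R)
  | cross_rotL (s : Strand) (R : Word) : Rel n (crossRotL s R) (cross s R)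
  | cross_rotR (s : Strand) (R : Word) : Rel n (crossRotR s R) (cross s R)
  -- bubbles of negative degree are zero, bubbles of degree zero are one
  | bubble_neg (s : Strand) (m : ℕ) (R : Word) (h : (m : ℤ) < spade s (wt n R)) :
      Rel n (realBubble s m R) (zero R R)
  | bubble_zero (s : Strand) (m : ℕ) (R : Word) (h : (m : ℤ) = spade s (wt n R)) :
      Rel n (realBubble s m R) (id R)
  -- curl relations
  | right_curl (s : Strand) (R : Word) :
      Rel n (rightCurl s R)
        (smul (-s.sgn : k) (sum₂ (-(s.sgn * wt n R)) fun f₁ f₂ =>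
          comp (strand s (bubble s (wt n R) f₂ R)) (dots s R f₁)))
  | left_curl (s : Strand) (R : Word) :
      Rel n (leftCurl s R)
        (smul (s.sgn : k) (sum₂ (s.sgn * wt n (s :: R)) fun g₁ g₂ =>
          comp (bubble s.flip (wt n (s :: R)) g₂ (s :: R)) (dots s R g₁)))
  -- decomposition of the identity of `E F` and of `F E`
  | decomp_E (R : Word) :
      Rel n (id (E :: F :: R))
        (add (smul (-1) (comp (side E R) (side F R)))
          (sum₃ (wt n R - 1) fun f₁ f₂ f₃ =>
            comp (dotCap E R f₃) (comp (bubble F (wt n R) f₂ R) (dotCup E R f₁))))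
  | decomp_F (R : Word) :
      Rel n (id (F :: E :: R))
        (add (smul (-1) (comp (side F R) (side E R)))
          (sum₃ (-wt n R - 1) fun g₁ g₂ g₃ =>
            comp (dotCap F R g₃) (comp (bubble E (wt n R) g₂ R) (dotCup F R g₁))))

end Diag

/-! ## The 2-morphisms -/

/-- The `k`-module of 2-morphisms of all degrees from `E_a 1_n` to `E_b 1_n`: linear combinations
of diagrams modulo the relations. -/
def TwoHom (k : Type u) [CommRing k] (n : ℤ) (a b : Word) : Type u :=
  Quot (Diag.Rel (k := k) n (a := a) (b := b))

namespace TwoHom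

variable {k : Type u} [CommRing k] {n : ℤ}

/-- The 2-morphism given by a linear combination of diagrams. -/
def mk {a b : Word} (f : Diag k a b) : TwoHom k n a b := Quot.mk _ f

theorem sound {a b : Word} {f g : Diag k a b} (h : Diag.Rel n f g) :
    (mk f : TwoHom k n a b) = mk g := Quot.sound h

theorem ind {a b : Word} {P : TwoHom k n a b → Prop} (h : ∀ f, P (mk f)) (x : TwoHom k n a b) :
    P x := Quot.ind h x

section module

variable {a b : Word}

instance : Zero (TwoHom k n a b) := ⟨mk (.zero a b)⟩

instance : Add (TwoHom k n a b) :=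
  ⟨Quot.map₂ .add (fun f _ _ h => .add_congr_right f h) (fun _ _ g h => .add_congr_left g h)⟩

instance : SMul k (TwoHom k n a b) := ⟨fun c => Quot.map (.smul c) fun _ _ h => .smul_congr c h⟩

instance : Neg (TwoHom k n a b) := ⟨fun x => (-1 : k) • x⟩

theorem mk_zero : (mk (.zero a b) : TwoHom k n a b) = 0 := rfl
theorem mk_add (f g : Diag k a b) : (mk (.add f g) : TwoHom k n a b) = mk f + mk g := rfl
theorem mk_smul (c : k) (f : Diag k a b) : (mk (.smul c f) : TwoHom k n a b) = c • mk f := rfl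

theorem add_comm' (x y : TwoHom k n a b) : x + y = y + x := by
  induction x using ind; induction y using ind; exact sound (.add_comm _ _)

theorem zero_add' (x : TwoHom k n a b) : 0 + x = x := by
  induction x using ind; exact sound (.zero_add _)

instance : AddCommGroup (TwoHom k n a b) where
  add_assoc x y z := by
    induction x using ind; induction y using ind; induction z using ind
    exact sound (.add_assoc _ _ _)
  zero_add := zero_add'
  add_zero x := by rw [add_comm', zero_add']
  add_comm := add_comm'
  neg_add_cancel x := by induction x using ind; exact sound (.neg_add _)
  nsmul := nsmulRec
  zsmul := zsmulRec

theorem add_smul' (c d : k) (x : TwoHom k n a b) : (c + d) • x = c • x + d • x := by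
  induction x using ind; exact sound (.add_smul _ _ _)

theorem smul_add' (c : k) (x y : TwoHom k n a b) : c • (x + y) = c • x + c • y := by
  induction x using ind; induction y using ind; exact sound (.smul_add _ _ _)

instance : Module k (TwoHom k n a b) where
  one_smul x := by induction x using ind; exact sound (.one_smul _)
  mul_smul c d x := by induction x using ind; exact sound (.mul_smul _ _ _)
  smul_add := smul_add'
  smul_zero c := by
    have h := smul_add' c (0 : TwoHom k n a b) 0
    rw [add_zero] at h
    exact left_eq_add.1 h
  add_smul := add_smul'
  zero_smul x := by
    have h := add_smul' (0 : k) 0 x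
    rw [add_zero] at h
    exact left_eq_add.1 h

end module

/-- Vertical composition (`f` below `g`). -/
def comp {a b c : Word} : TwoHom k n a b →ₗ[k] TwoHom k n b c →ₗ[k] TwoHom k n a c :=
  LinearMap.mk₂ k
    (Quot.map₂ .comp (fun f _ _ h => .comp_congr_right f h) (fun _ _ g h => .comp_congr_left g h))
    (fun x y z => by
      induction x using ind; induction y using ind; induction z using ind
      exact sound (.add_comp _ _ _))
    (fun r x y => by
      induction x using ind; induction y using ind; exact sound (.smul_comp _ _ _))
    (fun x y z => by
      induction x using ind; induction y using ind; induction z using ind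
      exact sound (.comp_add _ _ _))
    (fun r x y => by
      induction x using ind; induction y using ind; exact sound (.comp_smul _ _ _))

/-- Adding an identity strand on the left. -/
def strand (s : Strand) {a b : Word} : TwoHom k n a b →ₗ[k] TwoHom k n (s :: a) (s :: b) where
  toFun := Quot.map (.strand s) fun _ _ h => .strand_congr s h
  map_add' x y := by induction x using ind; induction y using ind; exact sound (.strand_add _ _ _)
  map_smul' c x := by induction x using ind; exact sound (.strand_smul _ _ _)

/-- The identity 2-morphism. -/
def id (a : Word) : TwoHom k n a a := mk (.id a)

theorem mk_id (a : Word) : (mk (.id a) : TwoHom k n a a) = id a := rfl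
theorem mk_comp {a b c : Word} (f : Diag k a b) (g : Diag k b c) :
    (mk (.comp f g) : TwoHom k n a c) = comp (mk f) (mk g) := rfl
theorem mk_strand (s : Strand) {a b : Word} (f : Diag k a b) :
    (mk (.strand s f) : TwoHom k n (s :: a) (s :: b)) = strand s (mk f) := rfl

@[simp] theorem id_comp {a b : Word} (x : TwoHom k n a b) : comp (id a) x = x := by
  induction x using ind; exact sound (.id_comp _)
@[simp] theorem comp_id {a b : Word} (x : TwoHom k n a b) : comp x (id b) = x := by
  induction x using ind; exact sound (.comp_id _)
theorem assoc {a b c d : Word} (x : TwoHom k n a b) (y : TwoHom k n b c) (z : TwoHom k n c d) :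
    comp (comp x y) z = comp x (comp y z) := by
  induction x using ind; induction y using ind; induction z using ind; exact sound (.assoc _ _ _)
@[simp] theorem strand_id (s : Strand) (a : Word) :
    strand s (id a : TwoHom k n a a) = id (s :: a) := sound (.strand_id s a)
theorem strand_comp (s : Strand) {a b c : Word} (x : TwoHom k n a b) (y : TwoHom k n b c) :
    strand s (comp x y) = comp (strand s x) (strand s y) := by
  induction x using ind; induction y using ind; exact sound (.strand_comp _ _ _)

/-- The generators as 2-morphisms. -/
def dot (s : Strand) (R : Word) : TwoHom k n (s :: R) (s :: R) := mk (.dot s R)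
/-- The crossing as a 2-morphism. -/
def cross (s : Strand) (R : Word) : TwoHom k n (s :: s :: R) (s :: s :: R) := mk (.cross s R)
/-- The cup as a 2-morphism. -/
def cup (s : Strand) (R : Word) : TwoHom k n R (s :: s.flip :: R) := mk (.cup s R)
/-- The cap as a 2-morphism. -/
def cap (s : Strand) (R : Word) : TwoHom k n (s :: s.flip :: R) R := mk (.cap s R)

theorem mk_dot (s : Strand) (R : Word) :
    (mk (.dot s R) : TwoHom k n (s :: R) (s :: R)) = dot s R := rfl
theorem mk_cross (s : Strand) (R : Word) :
    (mk (.cross s R) : TwoHom k n (s :: s :: R) (s :: s :: R)) = cross s R := rfl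
theorem mk_cup (s : Strand) (R : Word) :
    (mk (.cup s R) : TwoHom k n R (s :: s.flip :: R)) = cup s R := rfl
theorem mk_cap (s : Strand) (R : Word) :
    (mk (.cap s R) : TwoHom k n (s :: s.flip :: R) R) = cap s R := rfl

theorem dot_nat (s : Strand) {R R' : Word} (x : TwoHom k n R R') :
    comp (dot s R) (strand s x) = comp (strand s x) (dot s R') := by
  induction x using ind; exact sound (.dot_nat _ _)
theorem cross_nat (s : Strand) {R R' : Word} (x : TwoHom k n R R') :
    comp (cross s R) (strand s (strand s x)) = comp (strand s (strand s x)) (cross s R') := by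
  induction x using ind; exact sound (.cross_nat _ _)
theorem cup_nat (s : Strand) {R R' : Word} (x : TwoHom k n R R') :
    comp (cup s R) (strand s (strand s.flip x)) = comp x (cup s R') := by
  induction x using ind; exact sound (.cup_nat _ _)
theorem cap_nat (s : Strand) {R R' : Word} (x : TwoHom k n R R') :
    comp (cap s R) x = comp (strand s (strand s.flip x)) (cap s R') := by
  induction x using ind; exact sound (.cap_nat _ _)

/-- The `m`-fold dot. -/
def dots (s : Strand) (R : Word) (m : ℕ) : TwoHom k n (s :: R) (s :: R) := mk (.dots s R m)

theorem dots_zero (s : Strand) (R : Word) :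
    (dots s R 0 : TwoHom k n (s :: R) (s :: R)) = id (s :: R) := by
  simp [dots, Diag.dots, mk_id]
theorem dots_succ (s : Strand) (R : Word) (m : ℕ) :
    (dots s R (m + 1) : TwoHom k n (s :: R) (s :: R)) = comp (dots s R m) (dot s R) := by
  simp [dots, Diag.dots, mk_comp, mk_dot]

theorem mk_sumRange {a b : Word} (g : ℕ → Diag k a b) (N : ℕ) :
    (mk (Diag.sumRange g N) : TwoHom k n a b) = ∑ i ∈ Finset.range N, mk (g i) := by
  induction N with
  | zero => simp [Diag.sumRange, mk_zero]
  | succ N ih => simp [Diag.sumRange, mk_add, ih, Finset.sum_range_succ]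

end TwoHom

/-! ## Symmetries on diagrams -/

namespace Diag

variable {k : Type u}

section symmetries

variable [CommRing k]

/-- `ω` on diagrams: invert the orientation of each strand and rescale crossings by `-1`. -/
def omega : ∀ {a b : Word}, Diag k a b → Diag k (a.map flip) (b.map flip)
  | _, _, zero a b => zero (a.map flip) (b.map flip)
  | _, _, add f g => add (omega f) (omega g)
  | _, _, smul c f => smul c (omega f)
  | _, _, id a => id (a.map flip)
  | _, _, comp f g => comp (omega f) (omega g)
  | _, _, strand s f => strand s.flip (omega f)
  | _, _, dot s R => dot s.flip (R.map flip)
  | _, _, cross s R => smul (-1) (cross s.flip (R.map flip))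
  | _, _, cup s R => cup s.flip (R.map flip)
  | _, _, cap s R => cap s.flip (R.map flip)

/-- `ψ` on diagrams: reflect across the `x`-axis and invert the orientation. -/
def psi : ∀ {a b : Word}, Diag k a b → Diag k b a
  | _, _, zero a b => zero b a
  | _, _, add f g => add (psi f) (psi g)
  | _, _, smul c f => smul c (psi f)
  | _, _, id a => id a
  | _, _, comp f g => comp (psi g) (psi f)
  | _, _, strand s f => strand s (psi f)
  | _, _, dot s R => dot s R
  | _, _, cross s R => cross s R
  | _, _, cup s R => cap s R
  | _, _, cap s R => cup s R

/-- Add the identity strands of the reversed word `R` on the left of a diagram. -/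
def strandsRev : ∀ (R : Word) {a b : Word}, Diag k a b → Diag k (R.reverseAux a) (R.reverseAux b)
  | [], _, _, f => f
  | s :: R, _, _, f => strandsRev R (strand s f)

/-- `σ` on diagrams: reflect across the vertical axis and rescale crossings by `-1`. More precisely
this is the reflected diagram with the identity strands `acc` added on its right. (The
reflection of `a` followed by `acc` is `a.reverseAux acc`.) -/
def sigma : ∀ {a b : Word}, Diag k a b → ∀ acc : Word, Diag k (a.reverseAux acc) (b.reverseAux acc)
  | _, _, zero a b, acc => zero (a.reverseAux acc) (b.reverseAux acc)
  | _, _, add f g, acc => add (sigma f acc) (sigma g acc)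
  | _, _, smul c f, acc => smul c (sigma f acc)
  | _, _, id a, acc => id (a.reverseAux acc)
  | _, _, comp f g, acc => comp (sigma f acc) (sigma g acc)
  | _, _, strand s f, acc => sigma f (s :: acc)
  | _, _, dot s R, acc => strandsRev R (dot s acc)
  | _, _, cross s R, acc => smul (-1) (strandsRev R (cross s acc))
  | _, _, cup E R, acc => strandsRev R (cup F acc)
  | _, _, cup F R, acc => strandsRev R (cup E acc)
  | _, _, cap E R, acc => strandsRev R (cap F acc)
  | _, _, cap F R, acc => strandsRev R (cap E acc)

end symmetries

variable [CommRing k]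

@[simp] theorem wt_flip (n n' : ℤ) (h : n + n' = 0) (a : Word) :
    wt n' (a.map flip) = -wt n a := by
  induction a with
  | nil => simp; omega
  | cons s a ih => simp [ih]; ring

theorem omega_sumRange {a b : Word} (g : ℕ → Diag k a b) (N : ℕ) :
    omega (sumRange g N) = sumRange (fun i => omega (g i)) N := by
  induction N with
  | zero => rfl
  | succ N ih => simp [sumRange, omega, ih]

theorem omega_dots (s : Strand) (R : Word) (m : ℕ) :
    omega (dots s R m : Diag k _ _) = dots s.flip (R.map flip) m := by
  induction m with
  | zero => rfl
  | succ m ih => simp [dots, omega, ih]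

theorem omega_realBubble (s : Strand) (m : ℕ) (R : Word) :
    omega (realBubble s m R : Diag k _ _) = realBubble s.flip m (R.map flip) := by
  have h := omega_dots (k := k) s (s.flip :: R) m
  simp only [realBubble, dotCap, omega]
  rw [h]; rfl

theorem omega_dotCup (s : Strand) (m : ℕ) (R : Word) :
    omega (dotCup s R m : Diag k _ _) = dotCup s.flip (R.map flip) m := by
  have h := omega_dots (k := k) s (s.flip :: R) m
  simp only [dotCup, omega]
  rw [h]; rfl

theorem omega_dotCap (s : Strand) (m : ℕ) (R : Word) :
    omega (dotCap s R m : Diag k _ _) = dotCap s.flip (R.map flip) m := by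
  have h := omega_dots (k := k) s (s.flip :: R) m
  simp only [dotCap, omega]
  rw [h]; rfl

theorem spade_flip (s : Strand) (w : ℤ) : spade s.flip (-w) = spade s w := by
  simp [spade]

theorem omega_fakeBubble (s : Strand) (w : ℤ) (R : Word) (j : ℕ) :
    omega (fakeBubble s w R j : Diag k _ _) = fakeBubble s.flip (-w) (R.map flip) j := by
  induction j using Nat.strong_induction_on with
  | _ j ih =>
    cases j with
    | zero => simp [fakeBubble, omega]
    | succ j =>
      simp only [fakeBubble, omega, omega_sumRange, omega_realBubble]
      congr 2
      funext i
      rw [ih (j - i) (by omega), spade_flip]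

theorem omega_bubble (s : Strand) (w : ℤ) (j : ℤ) (R : Word) :
    omega (bubble s w j R : Diag k _ _) = bubble s.flip (-w) j (R.map flip) := by
  simp only [bubble, spade_flip]
  split_ifs
  · rfl
  · apply omega_realBubble
  · apply omega_fakeBubble

theorem omega_sum₂ {a b : Word} (N : ℤ) (g : ℕ → ℕ → Diag k a b) :
    omega (sum₂ N g) = sum₂ N fun i j => omega (g i j) := omega_sumRange _ _

theorem omega_sum₃ {a b : Word} (N : ℤ) (g : ℕ → ℕ → ℕ → Diag k a b) :
    omega (sum₃ N g) = sum₃ N fun i j l => omega (g i j l) := by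
  simp only [sum₃, omega_sum₂]

theorem omega_decompSum (s t : Strand) (N w : ℤ) (R : Word) :
    omega (sum₃ N fun f₁ f₂ f₃ =>
      comp (dotCap s R f₃) (comp (bubble t w f₂ R) (dotCup s R f₁)) : Diag k _ _) =
    sum₃ N fun f₁ f₂ f₃ => comp (dotCap s.flip (R.map flip) f₃)
      (comp (bubble t.flip (-w) f₂ (R.map flip)) (dotCup s.flip (R.map flip) f₁)) := by
  rw [omega_sum₃]
  refine congrArg (sum₃ N) ?_
  funext f₁ f₂ f₃
  rw [← omega_bubble, ← omega_dotCup, ← omega_dotCap]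
  rfl

section rescaled

open TwoHom

variable {n : ℤ}

theorem braid_neg (s : Strand) (R : Word) :
    (mk (comp (smul (-1) (cross s (s :: R))) (comp (strand s (smul (-1) (cross s R)))
      (smul (-1) (cross s (s :: R))))) : TwoHom k n _ _) =
    mk (comp (strand s (smul (-1) (cross s R))) (comp (smul (-1) (cross s (s :: R)))
      (strand s (smul (-1) (cross s R))))) := by
  have := sound (n := n) (Rel.braid (k := k) s R)
  simp only [mk_comp, mk_strand, mk_smul, map_smul, LinearMap.smul_apply] at this ⊢
  rw [this]

theorem dot_slide_neg (s : Strand) (R : Word) :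
    (mk (add (comp (dot s.flip (s.flip :: R)) (smul (-1) (cross s.flip R)))
      (smul (-1) (comp (smul (-1) (cross s.flip R)) (strand s.flip (dot s.flip R))))) :
      TwoHom k n _ _) = mk (smul (s.sgn : k) (id (s.flip :: s.flip :: R))) := by
  have := sound (n := n) (Rel.dot_slide (k := k) s.flip R)
  simp only [mk_comp, mk_strand, mk_smul, mk_add, map_smul, LinearMap.smul_apply,
    sgn_flip] at this ⊢
  rw [← smul_add, this]; simp

theorem dot_slide'_neg (s : Strand) (R : Word) :
    (mk (add (comp (smul (-1) (cross s.flip R)) (dot s.flip (s.flip :: R)))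
      (smul (-1) (comp (strand s.flip (dot s.flip R)) (smul (-1) (cross s.flip R))))) :
      TwoHom k n _ _) = mk (smul (s.sgn : k) (id (s.flip :: s.flip :: R))) := by
  have := sound (n := n) (Rel.dot_slide' (k := k) s.flip R)
  simp only [mk_comp, mk_strand, mk_smul, mk_add, map_smul, LinearMap.smul_apply,
    sgn_flip] at this ⊢
  rw [← smul_add, this]; simp

theorem right_curl_neg (s : Strand) (R : Word) :
    (mk (comp (strand s (cup s R)) (comp (smul (-1) (cross s (s.flip :: R)))
      (strand s (cap s R)))) : TwoHom k n _ _) =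
    mk (smul (s.sgn : k) (sum₂ (-(s.sgn * wt n R)) fun f₁ f₂ =>
          comp (strand s (bubble s (wt n R) f₂ R)) (dots s R f₁))) := by
  have := sound (n := n) (Rel.right_curl (k := k) s R)
  simp only [rightCurl, mk_comp, mk_strand, mk_smul, map_smul, LinearMap.smul_apply] at this ⊢
  rw [this]; simp

theorem decomp_rescale {a b : Word} {x x' : Diag k a b} {y y' : Diag k b a} {z z' : Diag k a a}
    (hx : (mk x' : TwoHom k n _ _) = (-1 : k) • mk x)
    (hy : (mk y' : TwoHom k n _ _) = (-1 : k) • mk y) (hz : z' = z) :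
    (mk (add (smul (-1) (comp x y)) z) : TwoHom k n _ _) =
      mk (add (smul (-1) (comp x' y')) z') := by
  simp [mk_add, mk_comp, mk_smul, hx, hy, hz]

theorem pull₁ {a b c d : Word} (r : k) (x : Diag k a b) (y : Diag k b c) (z : Diag k c d) :
    (mk (comp x (comp (smul r y) z)) : TwoHom k n a d) = r • mk (comp x (comp y z)) := by
  simp only [mk_comp, mk_smul, map_smul, LinearMap.smul_apply]

theorem pull₂ {a b c d : Word} (s : Strand) (r : k) (x : Diag k a (s :: b)) (y : Diag k b c)
    (z : Diag k (s :: c) d) :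
    (mk (comp x (comp (strand s (smul r y)) z)) : TwoHom k n a d) =
      r • mk (comp x (comp (strand s y) z)) := by
  simp only [mk_comp, mk_strand, mk_smul, map_smul, LinearMap.smul_apply]

theorem pull₃ {a a' b c d : Word} (s t : Strand) (r : k) (x : Diag k a a')
    (x' : Diag k a' (s :: t :: b)) (y : Diag k b c) (z : Diag k (s :: t :: c) d) :
    (mk (comp x (comp x' (comp (strand s (strand t (smul r y))) z))) : TwoHom k n a d) =
      r • mk (comp x (comp x' (comp (strand s (strand t y)) z))) := by
  simp only [mk_comp, mk_strand, mk_smul, map_smul, LinearMap.smul_apply]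

/-- The diagram `side`, with the crossing rescaled by `-1`. -/
theorem side_omega (s : Strand) (R : Word) :
    (mk (omega (side s R)) : TwoHom k n _ _) = (-1 : k) • mk (side s.flip (R.map flip)) := by
  cases s
  · exact pull₂ E (-1) _ _ _
  · exact pull₂ F (-1) _ _ _

end rescaled

open TwoHom in
theorem omega_rel {n n' : ℤ} (h : n + n' = 0) {a b : Word} {f g : Diag k a b} (r : Rel n f g) :
    (mk (omega f) : TwoHom k n' _ _) = mk (omega g) := by
  induction r with
  | add_congr_left g r ih => simp only [omega, mk_add, ih]
  | add_congr_right g r ih => simp only [omega, mk_add, ih]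
  | smul_congr c r ih => simp only [omega, mk_smul, ih]
  | comp_congr_left g r ih => simp only [omega, mk_comp, ih]
  | comp_congr_right g r ih => simp only [omega, mk_comp, ih]
  | strand_congr s r ih => simp only [omega, mk_strand, ih]
  | add_assoc f g h => exact sound (.add_assoc _ _ _)
  | add_comm f g => exact sound (.add_comm _ _)
  | zero_add f => exact sound (.zero_add _)
  | neg_add f => exact sound (.neg_add _)
  | one_smul f => exact sound (.one_smul _)
  | mul_smul c d f => exact sound (.mul_smul _ _ _)
  | smul_add c f g => exact sound (.smul_add _ _ _)
  | add_smul c d f => exact sound (.add_smul _ _ _)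
  | add_comp f g h => exact sound (.add_comp _ _ _)
  | smul_comp c f g => exact sound (.smul_comp _ _ _)
  | comp_add f g h => exact sound (.comp_add _ _ _)
  | comp_smul c f g => exact sound (.comp_smul _ _ _)
  | id_comp f => exact sound (.id_comp _)
  | comp_id f => exact sound (.comp_id _)
  | assoc f g h => exact sound (.assoc _ _ _)
  | strand_add s f g => exact sound (.strand_add _ _ _)
  | strand_smul s r f => exact sound (.strand_smul _ _ _)
  | strand_id s a => exact sound (.strand_id _ _)
  | strand_comp s f g => exact sound (.strand_comp _ _ _)
  | dot_nat s f => exact sound (.dot_nat _ _)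
  | cross_nat s f =>
    simp only [omega, mk_comp, mk_smul, mk_strand, map_smul, LinearMap.smul_apply]
    exact congrArg _ (cross_nat _ _)
  | cup_nat s f => exact sound (.cup_nat _ _)
  | cap_nat s f => exact sound (.cap_nat _ _)
  | zigzag_EL R => exact sound (.zigzag_FL _)
  | zigzag_FL R => exact sound (.zigzag_EL _)
  | zigzag_ER R => exact sound (.zigzag_FR _)
  | zigzag_FR R => exact sound (.zigzag_ER _)
  | cross_cross s R =>
    simp only [omega, mk_comp, mk_smul, map_smul, LinearMap.smul_apply]
    rw [← mk_comp, sound (.cross_cross _ _)]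
    simp [mk_zero]
  | braid s R => exact braid_neg _ _
  | dot_slide s R => exact dot_slide_neg _ _
  | dot_slide' s R => exact dot_slide'_neg _ _
  | dot_rotL s R =>
    cases s
    · exact sound (.dot_rotL F (R.map flip))
    · exact sound (.dot_rotL E (R.map flip))
  | dot_rotR s R =>
    cases s
    · exact sound (.dot_rotR F (R.map flip))
    · exact sound (.dot_rotR E (R.map flip))
  | cross_rotL s R =>
    cases s
    · exact (pull₃ F F (-1) _ _ _ _).trans
        (congrArg (fun z => (-1 : k) • z) (sound (.cross_rotL F (R.map flip))))
    · exact (pull₃ E E (-1) _ _ _ _).trans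
        (congrArg (fun z => (-1 : k) • z) (sound (.cross_rotL E (R.map flip))))
  | cross_rotR s R =>
    cases s
    · exact (pull₃ F F (-1) _ _ _ _).trans
        (congrArg (fun z => (-1 : k) • z) (sound (.cross_rotR F (R.map flip))))
    · exact (pull₃ E E (-1) _ _ _ _).trans
        (congrArg (fun z => (-1 : k) • z) (sound (.cross_rotR E (R.map flip))))
  | bubble_neg s m R h' => 
    rw [omega_realBubble]
    exact sound (.bubble_neg _ _ _ (by rwa [wt_flip n n' h, spade_flip]))
  | bubble_zero s m R h' =>
    rw [omega_realBubble]
    exact sound (.bubble_zero _ _ _ (by rwa [wt_flip n n' h, spade_flip]))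
  | right_curl s R =>
    simp only [omega, omega_sum₂, omega_dots, omega_bubble]
    refine (right_curl_neg (n := n') s.flip (R.map flip)).trans ?_
    rw [wt_flip n n' h]; simp only [sgn_flip, mul_neg, neg_mul, neg_neg, Int.cast_neg]
  | left_curl s R =>
    cases s
    · have h2 : wt n' (F :: R.map flip) = -wt n (E :: R) := wt_flip n n' h (E :: R)
      have h3 := sound (n := n') (.left_curl (k := k) F (R.map flip))
      rw [h2] at h3
      simp only [omega, omega_sum₂, omega_dots, omega_bubble]
      refine ((pull₂ E (-1) _ _ _).trans (congrArg (fun z => (-1 : k) • z) h3)).trans ?_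
      simp [mk_smul]
      rfl
    · have h2 : wt n' (E :: R.map flip) = -wt n (F :: R) := wt_flip n n' h (F :: R)
      have h3 := sound (n := n') (.left_curl (k := k) E (R.map flip))
      rw [h2] at h3
      simp only [omega, omega_sum₂, omega_dots, omega_bubble]
      refine ((pull₂ F (-1) _ _ _).trans (congrArg (fun z => (-1 : k) • z) h3)).trans ?_
      simp [mk_smul]
      rfl
  | decomp_E R =>
    have h3 := sound (n := n') (.decomp_F (k := k) (R.map flip))
    rw [wt_flip n n' h, neg_neg] at h3
    exact h3.trans (decomp_rescale (side_omega E R) (side_omega F R) (omega_decompSum E F _ _ R))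
  | decomp_F R =>
    have h3 := sound (n := n') (.decomp_E (k := k) (R.map flip))
    rw [wt_flip n n' h] at h3
    exact h3.trans (decomp_rescale (side_omega F R) (side_omega E R) (omega_decompSum F E _ _ R))

end Diag

/-! ## Consequences of the relations -/

namespace TwoHom

variable {k : Type u} [CommRing k] {n : ℤ}

theorem dots_succ' (s : Strand) (R : Word) (m : ℕ) :
    (dots s R (m + 1) : TwoHom k n (s :: R) (s :: R)) = comp (dot s R) (dots s R m) := by
  induction m with
  | zero => simp [dots_succ, dots_zero]
  | succ m ih => rw [dots_succ, ih, assoc, ← dots_succ, ← ih]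

theorem dots_nat (s : Strand) (m : ℕ) {R R' : Word} (x : TwoHom k n R R') :
    comp (dots s R m) (strand s x) = comp (strand s x) (dots s R' m) := by
  induction m with
  | zero => simp [dots_zero]
  | succ m ih => rw [dots_succ, dots_succ, assoc, dot_nat, ← assoc, ih, assoc]

theorem mk_realBubble (s : Strand) (m : ℕ) (R : Word) :
    (mk (Diag.realBubble s m R) : TwoHom k n R R) =
      comp (cup s R) (comp (dots s (s.flip :: R) m) (cap s R)) := rfl

theorem realBubble_nat (s : Strand) (m : ℕ) {R R' : Word} (x : TwoHom k n R R') :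
    comp (mk (Diag.realBubble s m R)) x = comp x (mk (Diag.realBubble s m R')) := by
  simp only [mk_realBubble, assoc, cap_nat]
  rw [← assoc (dots _ _ _), dots_nat, assoc, ← assoc, cup_nat]
  simp only [assoc]

theorem mk_sum₂ {a b : Word} (N : ℤ) (g : ℕ → ℕ → Diag k a b) :
    (mk (Diag.sum₂ N g) : TwoHom k n a b) =
      ∑ i ∈ Finset.range (N + 1).toNat, mk (g i (N.toNat - i)) := mk_sumRange _ _

theorem fakeBubble_nat (s : Strand) (w : ℤ) (j : ℕ) {R R' : Word} (x : TwoHom k n R R') :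
    comp (mk (Diag.fakeBubble s w R j)) x = comp x (mk (Diag.fakeBubble s w R' j)) := by
  induction j using Nat.strong_induction_on with
  | _ j ih =>
    cases j with
    | zero => simp [Diag.fakeBubble, mk_id]
    | succ j =>
      simp only [Diag.fakeBubble, mk_smul, mk_sumRange, map_smul, LinearMap.smul_apply, map_sum,
        LinearMap.sum_apply, mk_comp]
      congr 1
      refine Finset.sum_congr rfl fun i _ => ?_
      rw [assoc, ih (j - i) (by omega), ← assoc, realBubble_nat, assoc]

theorem bubble_nat (s : Strand) (w : ℤ) (j : ℤ) {R R' : Word} (x : TwoHom k n R R') :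
    comp (mk (Diag.bubble s w j R)) x = comp x (mk (Diag.bubble s w j R')) := by
  simp only [Diag.bubble]
  split_ifs
  · simp [mk_zero]
  · apply realBubble_nat
  · apply fakeBubble_nat

theorem zigzag_EL (R : Word) :
    comp (strand E (cup F R)) (cap E (E :: R)) = (id (E :: R) : TwoHom k n _ _) :=
  sound (.zigzag_EL R)
theorem zigzag_FL (R : Word) :
    comp (strand F (cup E R)) (cap F (F :: R)) = (id (F :: R) : TwoHom k n _ _) :=
  sound (.zigzag_FL R)
theorem zigzag_ER (R : Word) :
    comp (cup E (E :: R)) (strand E (cap F R)) = (id (E :: R) : TwoHom k n _ _) :=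
  sound (.zigzag_ER R)
theorem zigzag_FR (R : Word) :
    comp (cup F (F :: R)) (strand F (cap E R)) = (id (F :: R) : TwoHom k n _ _) :=
  sound (.zigzag_FR R)

theorem cup_nat_E {R R' : Word} (x : TwoHom k n R R') :
    comp (cup E R) (strand E (strand F x)) = comp x (cup E R') := cup_nat E x
theorem cup_nat_F {R R' : Word} (x : TwoHom k n R R') :
    comp (cup F R) (strand F (strand E x)) = comp x (cup F R') := cup_nat F x
theorem cap_nat_E {R R' : Word} (x : TwoHom k n R R') :
    comp (cap E R) x = comp (strand E (strand F x)) (cap E R') := cap_nat E x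
theorem cap_nat_F {R R' : Word} (x : TwoHom k n R R') :
    comp (cap F R) x = comp (strand F (strand E x)) (cap F R') := cap_nat F x

theorem assoc_left {a b c d e : Word} {x : TwoHom k n a b} {y : TwoHom k n b c}
    {z : TwoHom k n a d} {w : TwoHom k n d c} (h : comp x y = comp z w) (v : TwoHom k n c e) :
    comp x (comp y v) = comp z (comp w v) := by
  rw [← assoc, h, assoc]

theorem assoc_left' {a b c e : Word} {x : TwoHom k n a b} {y : TwoHom k n b c}
    {z : TwoHom k n a c} (h : comp x y = z) (v : TwoHom k n c e) :
    comp x (comp y v) = comp z v := by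
  rw [← assoc, h]

/-- A dot can be moved from the right to the left strand of the cup `E`. -/
theorem cup_dot_E (R : Word) :
    comp (cup E R) (strand E (dot F R)) = (comp (cup E R) (dot E (F :: R)) : TwoHom k n _ _) := by
  have h1 : (dot F R : TwoHom k n _ _) = comp (strand F (cup E R)) (comp (strand F (dot E (F :: R)))
    (cap F (F :: R))) := (sound (.dot_rotL F R)).symm
  rw [h1, strand_comp, strand_comp, assoc_left (cup_nat_E _), assoc_left (cup_nat_E _),
    zigzag_ER, comp_id]

theorem cup_dot_F (R : Word) :
    comp (cup F R) (strand F (dot E R)) = (comp (cup F R) (dot F (E :: R)) : TwoHom k n _ _) := by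
  have h1 : (dot E R : TwoHom k n _ _) = comp (strand E (cup F R)) (comp (strand E (dot F (E :: R)))
    (cap E (E :: R))) := (sound (.dot_rotL E R)).symm
  rw [h1, strand_comp, strand_comp, assoc_left (cup_nat_F _), assoc_left (cup_nat_F _),
    zigzag_FR, comp_id]

theorem cap_dot_E (R : Word) :
    comp (strand E (dot F R)) (cap E R) = (comp (dot E (F :: R)) (cap E R) : TwoHom k n _ _) := by
  have h1 : (dot F R : TwoHom k n _ _) = comp (cup F (F :: R)) (comp (strand F (dot E (F :: R)))
    (strand F (cap E R))) := (sound (.dot_rotR F R)).symm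
  rw [h1, strand_comp, strand_comp, assoc, assoc, ← cap_nat_E, ← assoc (strand _ (strand _ _)),
    ← cap_nat_E, assoc, assoc_left' (zigzag_EL _), id_comp]

theorem cap_dot_F (R : Word) :
    comp (strand F (dot E R)) (cap F R) = (comp (dot F (E :: R)) (cap F R) : TwoHom k n _ _) := by
  have h1 : (dot E R : TwoHom k n _ _) = comp (cup E (E :: R)) (comp (strand E (dot F (E :: R)))
    (strand E (cap F R))) := (sound (.dot_rotR E R)).symm
  rw [h1, strand_comp, strand_comp, assoc, assoc, ← cap_nat_F, ← assoc (strand _ (strand _ _)),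
    ← cap_nat_F, assoc, assoc_left' (zigzag_FL _), id_comp]

theorem side'_E (R : Word) : (mk (Diag.side' E R) : TwoHom k n _ _) = mk (Diag.side E R) := by
  have h1 : (cross F (E :: R) : TwoHom k n _ _) =
    comp (cup F (F :: F :: E :: R))
      (comp (strand F (cup F (E :: F :: F :: E :: R)))
      (comp (strand F (strand F (cross E (F :: F :: E :: R))))
      (comp (strand F (strand F (strand E (cap E (F :: E :: R)))))
        (strand F (strand F (cap E (E :: R))))))) := (sound (.cross_rotR F (E :: R))).symm
  have h2 : (mk (Diag.side' E R) : TwoHom k n _ _) = comp (strand E (strand F (cup F R)))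
    (comp (strand E (cross F (E :: R))) (cap E (F :: E :: R))) := rfl
  have h3 : (mk (Diag.side E R) : TwoHom k n _ _) = comp (cup F (E :: F :: R))
    (comp (strand F (cross E (F :: R))) (strand F (strand E (cap E R)))) := rfl
  rw [h2, h3, h1]
  simp only [strand_comp, assoc]
  have h4 := cap_nat_E (k := k) (n := n) (comp (cup F (E :: F :: F :: E :: R))
      (comp (strand F (cross E (F :: F :: E :: R)))
      (comp (strand F (strand E (cap E (F :: E :: R))))
        (strand F (cap E (E :: R))))))
  simp only [strand_comp, assoc] at h4
  rw [← h4, assoc_left' (zigzag_EL _), id_comp, ← assoc_left (cup_nat_F _)]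
  have h5 := cross_nat E (k := k) (n := n) (strand F (cup F R))
  rw [← assoc (strand F (strand E (strand E (strand F (cup F R))))), ← strand_comp, ← h5,
    strand_comp, assoc, ← assoc (strand F (strand E (strand E (strand F (cup F R))))), ← strand_comp,
    ← strand_comp E, ← cap_nat_E, strand_comp, strand_comp, assoc,
    ← strand_comp F, zigzag_EL]
  simp

theorem side'_F (R : Word) : (mk (Diag.side' F R) : TwoHom k n _ _) = mk (Diag.side F R) := by
  have h1 : (cross E (F :: R) : TwoHom k n _ _) =
    comp (cup E (E :: E :: F :: R))
      (comp (strand E (cup E (F :: E :: E :: F :: R)))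
      (comp (strand E (strand E (cross F (E :: E :: F :: R))))
      (comp (strand E (strand E (strand F (cap F (E :: F :: R)))))
        (strand E (strand E (cap F (F :: R))))))) := (sound (.cross_rotR E (F :: R))).symm
  have h2 : (mk (Diag.side' F R) : TwoHom k n _ _) = comp (strand F (strand E (cup E R)))
    (comp (strand F (cross E (F :: R))) (cap F (E :: F :: R))) := rfl
  have h3 : (mk (Diag.side F R) : TwoHom k n _ _) = comp (cup E (F :: E :: R))
    (comp (strand E (cross F (E :: R))) (strand E (strand F (cap F R)))) := rfl
  rw [h2, h3, h1]
  simp only [strand_comp, assoc]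
  have h4 := cap_nat_F (k := k) (n := n) (comp (cup E (F :: E :: E :: F :: R))
      (comp (strand E (cross F (E :: E :: F :: R)))
      (comp (strand E (strand F (cap F (E :: F :: R))))
        (strand E (cap F (F :: R))))))
  simp only [strand_comp, assoc] at h4
  rw [← h4, assoc_left' (zigzag_FL _), id_comp, ← assoc_left (cup_nat_E _)]
  have h5 := cross_nat F (k := k) (n := n) (strand E (cup E R))
  rw [← assoc (strand E (strand F (strand F (strand E (cup E R))))), ← strand_comp, ← h5,
    strand_comp, assoc, ← assoc (strand E (strand F (strand F (strand E (cup E R))))), ← strand_comp,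
    ← strand_comp F, ← cap_nat_F, strand_comp, strand_comp, assoc,
    ← strand_comp E, zigzag_FL]
  simp

/-- The two rotations of a crossing that define a sideways crossing agree. -/
theorem side'_eq_side (s : Strand) (R : Word) :
    (mk (Diag.side' s R) : TwoHom k n _ _) = mk (Diag.side s R) := by
  cases s
  · exact side'_E R
  · exact side'_F R

end TwoHom

namespace Diag

variable {k : Type u} [CommRing k] {n : ℤ}

open TwoHom

theorem psi_dots (s : Strand) (R : Word) (m : ℕ) :
    (mk (psi (dots s R m)) : TwoHom k n _ _) = TwoHom.dots s R m := by
  induction m with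
  | zero => rfl
  | succ m ih =>
    rw [dots_succ', ← ih]; rfl

theorem psi_dotCup (s : Strand) (R : Word) (m : ℕ) :
    (mk (psi (dotCup s R m)) : TwoHom k n _ _) = mk (dotCap s R m) :=
  congrArg (fun x => TwoHom.comp x (TwoHom.cap (k := k) (n := n) s R)) (psi_dots s _ m)

theorem psi_dotCap (s : Strand) (R : Word) (m : ℕ) :
    (mk (psi (dotCap s R m)) : TwoHom k n _ _) = mk (dotCup s R m) :=
  congrArg (fun x => TwoHom.comp (TwoHom.cup (k := k) (n := n) s R) x) (psi_dots s _ m)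

theorem psi_realBubble (s : Strand) (m : ℕ) (R : Word) :
    (mk (psi (realBubble s m R)) : TwoHom k n _ _) = mk (realBubble s m R) := by
  refine (congrArg (fun x => TwoHom.comp x (TwoHom.cap (k := k) (n := n) s R)) (psi_dotCap s R m)).trans ?_
  exact sound (.assoc _ _ _)

theorem psi_sumRange {k : Type u} {a b : Word} (g : ℕ → Diag k a b) (N : ℕ) :
    psi (sumRange g N) = sumRange (fun i => psi (g i)) N := by
  induction N with
  | zero => rfl
  | succ N ih => simp [sumRange, psi, ih]

theorem psi_fakeBubble (s : Strand) (w : ℤ) (R : Word) (j : ℕ) :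
    (mk (psi (fakeBubble s w R j)) : TwoHom k n _ _) = mk (fakeBubble s w R j) := by
  induction j using Nat.strong_induction_on with
  | _ j ih =>
    cases j with
    | zero => simp [fakeBubble, psi]
    | succ j =>
      simp only [fakeBubble, psi, psi_sumRange, mk_smul, mk_sumRange]
      congr 1
      refine Finset.sum_congr rfl fun i _ => ?_
      rw [mk_comp, ih (j - i) (by omega), psi_realBubble, ← realBubble_nat]
      rfl

theorem psi_bubble (s : Strand) (w : ℤ) (j : ℤ) (R : Word) :
    (mk (psi (bubble s w j R)) : TwoHom k n _ _) = mk (bubble s w j R) := by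
  simp only [bubble]
  split_ifs
  · rfl
  · apply psi_realBubble
  · apply psi_fakeBubble

theorem psi_side (s : Strand) (R : Word) :
    (mk (psi (side s R)) : TwoHom k n _ _) =
      match s with
      | E => mk (side' F R)
      | F => mk (side' E R) := by
  cases s <;> exact sound (.assoc _ _ _)

theorem mk_decompSum (s : Strand) (t : Strand) (N w : ℤ) (R : Word) :
    (mk (sum₃ N fun f₁ f₂ f₃ =>
      comp (dotCap s R f₃) (comp (bubble t w f₂ R) (dotCup s R f₁))) : TwoHom k n _ _) =
    ∑ i ∈ Finset.range (N + 1).toNat, ∑ j ∈ Finset.range (N.toNat - i + 1),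
      TwoHom.comp (mk (dotCap s R (N.toNat - i - j)))
        (TwoHom.comp (mk (bubble t w i R)) (mk (dotCup s R j))) := by
  rw [sum₃, mk_sum₂]
  refine Finset.sum_congr rfl fun i _ => ?_
  rw [mk_sum₂]
  rfl

theorem psi_decompSum (s : Strand) (t : Strand) (N w : ℤ) (R : Word) :
    (mk (psi (sum₃ N fun f₁ f₂ f₃ =>
      comp (dotCap s R f₃) (comp (bubble t w f₂ R) (dotCup s R f₁)))) : TwoHom k n _ _) =
    mk (sum₃ N fun f₁ f₂ f₃ =>
      comp (dotCap s R f₃) (comp (bubble t w f₂ R) (dotCup s R f₁))) := by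
  rw [mk_decompSum]
  simp only [sum₃, sum₂, psi_sumRange, psi, mk_sumRange, mk_comp, psi_dotCap, psi_dotCup,
    psi_bubble]
  refine Finset.sum_congr rfl fun i _ => ?_
  have h : ((N.toNat - i : ℕ) + 1 : ℤ).toNat = N.toNat - i + 1 := by omega
  simp only [Int.toNat_natCast, h]
  rw [← Finset.sum_range_reflect]
  refine Finset.sum_congr rfl fun j hj => ?_
  have h2 : N.toNat - i + 1 - 1 - j = N.toNat - i - j := by omega
  have h3 : N.toNat - i - (N.toNat - i - j) = j := by
    have := Finset.mem_range.1 hj; omega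
  rw [h2, h3, TwoHom.assoc]

theorem decomp_congr {a b : Word} {x x' : Diag k a b} {y y' : Diag k b a} {z z' : Diag k a a}
    (hx : (mk x : TwoHom k n _ _) = mk x') (hy : (mk y : TwoHom k n _ _) = mk y')
    (hz : (mk z : TwoHom k n _ _) = mk z') :
    (mk (add (smul (-1) (comp x y)) z) : TwoHom k n _ _) =
      mk (add (smul (-1) (comp x' y')) z') := by
  simp [mk_add, mk_comp, mk_smul, hx, hy, hz]

theorem psi_rel {a b : Word} {f g : Diag k a b} (r : Rel n f g) :
    (mk (psi f) : TwoHom k n _ _) = mk (psi g) := by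
  induction r with
  | add_congr_left g r ih => simp only [psi, mk_add, ih]
  | add_congr_right g r ih => simp only [psi, mk_add, ih]
  | smul_congr c r ih => simp only [psi, mk_smul, ih]
  | comp_congr_left g r ih => simp only [psi, mk_comp, ih]
  | comp_congr_right g r ih => simp only [psi, mk_comp, ih]
  | strand_congr s r ih => simp only [psi, mk_strand, ih]
  | add_assoc f g h => exact sound (.add_assoc _ _ _)
  | add_comm f g => exact sound (.add_comm _ _)
  | zero_add f => exact sound (.zero_add _)
  | neg_add f => exact sound (.neg_add _)
  | one_smul f => exact sound (.one_smul _)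
  | mul_smul c d f => exact sound (.mul_smul _ _ _)
  | smul_add c f g => exact sound (.smul_add _ _ _)
  | add_smul c d f => exact sound (.add_smul _ _ _)
  | add_comp f g h => exact sound (.comp_add _ _ _)
  | smul_comp c f g => exact sound (.comp_smul _ _ _)
  | comp_add f g h => exact sound (.add_comp _ _ _)
  | comp_smul c f g => exact sound (.smul_comp _ _ _)
  | id_comp f => exact sound (.comp_id _)
  | comp_id f => exact sound (.id_comp _)
  | assoc f g h => exact (sound (.assoc _ _ _)).symm
  | strand_add s f g => exact sound (.strand_add _ _ _)
  | strand_smul s r f => exact sound (.strand_smul _ _ _)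
  | strand_id s a => exact sound (.strand_id _ _)
  | strand_comp s f g => exact sound (.strand_comp _ _ _)
  | dot_nat s f => exact (sound (.dot_nat _ _)).symm
  | cross_nat s f => exact (sound (.cross_nat _ _)).symm
  | cup_nat s f => exact (sound (.cap_nat _ _)).symm
  | cap_nat s f => exact (sound (.cup_nat _ _)).symm
  | zigzag_EL R => exact sound (.zigzag_ER _)
  | zigzag_FL R => exact sound (.zigzag_FR _)
  | zigzag_ER R => exact sound (.zigzag_EL _)
  | zigzag_FR R => exact sound (.zigzag_FL _)
  | cross_cross s R => exact sound (.cross_cross _ _)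
  | braid s R =>
    exact (sound (.assoc _ _ _)).trans ((sound (.braid s R)).trans (sound (.assoc _ _ _)).symm)
  | dot_slide s R => exact sound (.dot_slide' _ _)
  | dot_slide' s R => exact sound (.dot_slide _ _)
  | dot_rotL s R =>
    cases s
    · exact (sound (.assoc _ _ _)).trans (sound (.dot_rotR E R))
    · exact (sound (.assoc _ _ _)).trans (sound (.dot_rotR F R))
  | dot_rotR s R =>
    cases s
    · exact (sound (.assoc _ _ _)).trans (sound (.dot_rotL E R))
    · exact (sound (.assoc _ _ _)).trans (sound (.dot_rotL F R))
  | cross_rotL s R =>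
    cases s
    · refine Eq.trans ?_ (sound (.cross_rotR E R))
      simp only [crossRotL, crossRotR, psi, mk_comp, TwoHom.assoc]
    · refine Eq.trans ?_ (sound (.cross_rotR F R))
      simp only [crossRotL, crossRotR, psi, mk_comp, TwoHom.assoc]
  | cross_rotR s R =>
    cases s
    · refine Eq.trans ?_ (sound (.cross_rotL E R))
      simp only [crossRotL, crossRotR, psi, mk_comp, TwoHom.assoc]
    · refine Eq.trans ?_ (sound (.cross_rotL F R))
      simp only [crossRotL, crossRotR, psi, mk_comp, TwoHom.assoc]
  | bubble_neg s m R h => exact (psi_realBubble _ _ _).trans (sound (.bubble_neg _ _ _ h))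
  | bubble_zero s m R h => exact (psi_realBubble _ _ _).trans (sound (.bubble_zero _ _ _ h))
  | right_curl s R =>
    refine (sound (.assoc _ _ _)).trans ((sound (.right_curl s R)).trans ?_)
    simp only [sum₂, psi, psi_sumRange, mk_smul, mk_sumRange, mk_comp, psi_dots, mk_strand,
      psi_bubble]
    refine congrArg _ (Finset.sum_congr rfl fun i _ => ?_)
    exact (dots_nat _ _ _).symm
  | left_curl s R =>
    have h : (mk (psi (leftCurl s R)) : TwoHom k n _ _) = mk (leftCurl s R) := by
      cases s <;> exact sound (.assoc _ _ _)
    refine h.trans ((sound (.left_curl s R)).trans ?_)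
    simp only [sum₂, psi, psi_sumRange, mk_smul, mk_sumRange, mk_comp, psi_dots, psi_bubble]
    refine congrArg _ (Finset.sum_congr rfl fun i _ => ?_)
    exact bubble_nat _ _ _ _
  | decomp_E R =>
    exact (sound (.decomp_E R)).trans (decomp_congr
      ((psi_side F R).trans (side'_eq_side E R)).symm
      ((psi_side E R).trans (side'_eq_side F R)).symm (psi_decompSum E F _ _ R).symm)
  | decomp_F R =>
    exact (sound (.decomp_F R)).trans (decomp_congr
      ((psi_side E R).trans (side'_eq_side F R)).symm
      ((psi_side F R).trans (side'_eq_side E R)).symm (psi_decompSum F E _ _ R).symm)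

end Diag

namespace TwoHom

variable {k : Type u} [CommRing k] {n p : ℤ}

theorem _root_.CatSL2.Diag.Rel.strandsRev (R : Word) : ∀ {a b : Word} {f g : Diag k a b},
    Diag.Rel n f g → Diag.Rel n (f.strandsRev R) (g.strandsRev R) := by
  induction R with
  | nil => exact fun h => h
  | cons s R ih => exact fun h => ih (.strand_congr s h)

/-- Add the identity strands of the reversed word `R` on the left of a 2-morphism. -/
def strandsRev (R : Word) {a b : Word} :
    TwoHom k n a b →ₗ[k] TwoHom k n (R.reverseAux a) (R.reverseAux b) where
  toFun := Quot.map (Diag.strandsRev R) fun _ _ h => h.strandsRev R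
  map_add' x y := by
    induction x using ind; induction y using ind
    rename_i f g
    change mk (Diag.strandsRev R (.add f g)) = mk (.add (f.strandsRev R) (g.strandsRev R))
    induction R generalizing a b with
    | nil => rfl
    | cons s R ih =>
      refine Eq.trans ?_ (ih (f.strand s) (g.strand s))
      exact Quot.sound (Diag.Rel.strandsRev R (.strand_add _ _ _))
  map_smul' c x := by
    induction x using ind
    rename_i f
    change mk (Diag.strandsRev R (.smul c f)) = mk (.smul c (f.strandsRev R))
    induction R generalizing a b with
    | nil => rfl
    | cons s R ih =>
      refine Eq.trans ?_ (ih (f.strand s))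
      exact Quot.sound (Diag.Rel.strandsRev R (.strand_smul _ _ _))

theorem strandsRev_cons (s : Strand) (R : Word) {a b : Word} (x : TwoHom k n a b) :
    strandsRev (s :: R) x = strandsRev R (strand s x) := by
  induction x using ind; rfl

theorem strandsRev_nil {a b : Word} (x : TwoHom k n a b) :
    strandsRev [] x = x := by
  induction x using ind; rfl

theorem strandsRev_id (R a : Word) :
    strandsRev R (id a : TwoHom k n a a) = id (R.reverseAux a) := by
  induction R generalizing a with
  | nil => rfl
  | cons s R ih =>
    rw [strandsRev_cons, strand_id]; exact ih _

theorem strandsRev_comp (R : Word) {a b c : Word} (x : TwoHom k n a b) (y : TwoHom k n b c) :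
    strandsRev R (comp x y) = comp (strandsRev R x) (strandsRev R y) := by
  induction R generalizing a b c with
  | nil => simp only [strandsRev_nil]; rfl
  | cons s R ih => simp only [strandsRev_cons, strand_comp, ih]; rfl

theorem mk_strandsRev (R : Word) {a b : Word} (f : Diag k a b) :
    (mk (f.strandsRev R) : TwoHom k n _ _) = strandsRev R (mk f) := rfl

theorem wt_add (m n : ℤ) (a : Word) : wt (m + n) a = m + wt n a := by
  induction a with
  | nil => rfl
  | cons s a ih => simp [ih]; ring

theorem wt_reverseAux (n : ℤ) (a b : Word) : wt n (a.reverseAux b) = wt n a + wt n b - n := by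
  induction a generalizing b with
  | nil => simp [List.reverseAux]
  | cons s a ih => simp only [List.reverseAux, ih, wt_cons]; ring

/-- A diagram whose bottom and top have different weights is zero. -/
theorem mk_eq_zero {a b : Word} (f : Diag k a b) (h : wt n a ≠ wt n b) :
    (mk f : TwoHom k n a b) = 0 := by
  induction f with
  | zero a b => rfl
  | add f g ihf ihg => rw [mk_add, ihf h, ihg h, add_zero]
  | smul c f ih => rw [mk_smul, ih h, smul_zero]
  | id a => exact absurd rfl h
  | @comp a b c f g ihf ihg =>
    rw [mk_comp]
    by_cases h' : wt n a = wt n b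
    · rw [ihg (h' ▸ h), map_zero]
    · rw [ihf h', map_zero, LinearMap.zero_apply]
  | strand s f ih =>
    rw [mk_strand, ih (fun h' => h (by simp [h'])), map_zero]
  | dot s R => exact absurd rfl h
  | cross s R => exact absurd rfl h
  | cup s R => exact absurd (by simp) h
  | cap s R => exact absurd (by simp) h

theorem wt_eq_iff (n m : ℤ) (a b : Word) : wt n a = wt n b ↔ wt m a = wt m b := by
  have h1 := wt_add (m - n) n a
  have h2 := wt_add (m - n) n b
  simp only [sub_add_cancel] at h1 h2
  omega

end TwoHom

namespace Diag

variable {k : Type u} [CommRing k] {n p : ℤ}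

open TwoHom

theorem neg_nat {a b c d : Word} {x : TwoHom k n a b} {y : TwoHom k n b c}
    {z : TwoHom k n a d} {w : TwoHom k n d c} (h : TwoHom.comp x y = TwoHom.comp z w) :
    TwoHom.comp ((-1 : k) • x) y = TwoHom.comp z ((-1 : k) • w) := by
  rw [map_smul, map_smul, LinearMap.smul_apply, h]

/-- Strands on the right of a reflected diagram can be moved past it. -/
theorem sigma_nat {a b : Word} (f : Diag k a b) {acc acc' : Word} (g : TwoHom k p acc acc') :
    TwoHom.comp (mk (sigma f acc)) (TwoHom.strandsRev b g) =
      TwoHom.comp (TwoHom.strandsRev a g) (mk (sigma f acc')) := by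
  induction f generalizing acc acc' with
  | zero a b => simp only [sigma, mk_zero, map_zero, LinearMap.zero_apply]
  | add f g ihf ihg => simp only [sigma, mk_add, map_add, LinearMap.add_apply, ihf, ihg]
  | smul c f ih => simp only [sigma, mk_smul, map_smul, LinearMap.smul_apply, ih]
  | id a => simp only [sigma, mk_id, TwoHom.id_comp, TwoHom.comp_id]
  | comp f g ihf ihg =>
    simp only [sigma, mk_comp]
    rw [TwoHom.assoc, ihg, ← TwoHom.assoc, ihf, TwoHom.assoc]
  | strand s f ih =>
    rw [strandsRev_cons, strandsRev_cons]
    exact ih (TwoHom.strand s g)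
  | dot s R =>
    rw [strandsRev_cons]
    have := congrArg (TwoHom.strandsRev R) (TwoHom.dot_nat s g)
    rw [strandsRev_comp, strandsRev_comp] at this
    exact this
  | cross s R =>
    rw [strandsRev_cons, strandsRev_cons]
    have := congrArg (TwoHom.strandsRev R) (TwoHom.cross_nat s g)
    rw [strandsRev_comp, strandsRev_comp] at this
    exact neg_nat this
  | cup s R =>
    cases s
    · rw [strandsRev_cons, strandsRev_cons]
      have := congrArg (TwoHom.strandsRev R) (TwoHom.cup_nat_F g)
      rw [strandsRev_comp, strandsRev_comp] at this
      exact this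
    · rw [strandsRev_cons, strandsRev_cons]
      have := congrArg (TwoHom.strandsRev R) (TwoHom.cup_nat_E g)
      rw [strandsRev_comp, strandsRev_comp] at this
      exact this
  | cap s R =>
    cases s
    · rw [strandsRev_cons, strandsRev_cons]
      have := congrArg (TwoHom.strandsRev R) (TwoHom.cap_nat_F g)
      rw [strandsRev_comp, strandsRev_comp] at this
      exact this
    · rw [strandsRev_cons, strandsRev_cons]
      have := congrArg (TwoHom.strandsRev R) (TwoHom.cap_nat_E g)
      rw [strandsRev_comp, strandsRev_comp] at this
      exact this

end Diag

namespace TwoHom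

variable {k : Type u} [CommRing k] {n : ℤ}

theorem cup_dots_E (R : Word) (m : ℕ) : comp (cup E R) (strand E (dots F R m)) =
    (comp (cup E R) (dots E (F :: R) m) : TwoHom k n _ _) := by
  induction m with
  | zero => simp [dots_zero]
  | succ m ih =>
    rw [dots_succ', strand_comp, ← assoc, cup_dot_E, assoc, dot_nat, ← assoc, ih, dots_succ, assoc]

theorem cup_dots_F (R : Word) (m : ℕ) : comp (cup F R) (strand F (dots E R m)) =
    (comp (cup F R) (dots F (E :: R) m) : TwoHom k n _ _) := by
  induction m with
  | zero => simp [dots_zero]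
  | succ m ih =>
    rw [dots_succ', strand_comp, ← assoc, cup_dot_F, assoc, dot_nat, ← assoc, ih, dots_succ, assoc]

theorem cap_dots_E (R : Word) (m : ℕ) : comp (strand E (dots F R m)) (cap E R) =
    (comp (dots E (F :: R) m) (cap E R) : TwoHom k n _ _) := by
  induction m with
  | zero => simp [dots_zero]
  | succ m ih =>
    rw [dots_succ, strand_comp, assoc, cap_dot_E, ← assoc, ← dot_nat, assoc, ih, dots_succ', assoc]

theorem cap_dots_F (R : Word) (m : ℕ) : comp (strand F (dots E R m)) (cap F R) =
    (comp (dots F (E :: R) m) (cap F R) : TwoHom k n _ _) := by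
  induction m with
  | zero => simp [dots_zero]
  | succ m ih =>
    rw [dots_succ, strand_comp, assoc, cap_dot_F, ← assoc, ← dot_nat, assoc, ih, dots_succ', assoc]

end TwoHom

namespace Diag

variable {k : Type u} [CommRing k] {n p : ℤ}

open TwoHom

theorem sigma_dots (s : Strand) (R : Word) (m : ℕ) (acc : Word) :
    (mk (sigma (dots s R m) acc) : TwoHom k p _ _) =
      TwoHom.strandsRev R (TwoHom.dots s acc m) := by
  induction m with
  | zero =>
    rw [dots_zero, strandsRev_id]; rfl
  | succ m ih =>
    rw [TwoHom.dots_succ, strandsRev_comp, ← ih]; rfl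

theorem sigma_dotCup_E (m : ℕ) (R acc : Word) :
    (mk (sigma (dotCup E R m) acc) : TwoHom k p _ _) =
      TwoHom.strandsRev R (mk (dotCup F acc m)) := by
  have h := congrArg (TwoHom.strandsRev R) (cup_dots_F (k := k) (n := p) acc m)
  rw [strandsRev_comp, ← strandsRev_cons] at h
  exact (congrArg (fun x => TwoHom.comp (TwoHom.strandsRev R (TwoHom.cup (k := k) (n := p) F acc)) x)
    (sigma_dots E (F :: R) m acc)).trans h

theorem sigma_dotCup_F (m : ℕ) (R acc : Word) :
    (mk (sigma (dotCup F R m) acc) : TwoHom k p _ _) =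
      TwoHom.strandsRev R (mk (dotCup E acc m)) := by
  have h := congrArg (TwoHom.strandsRev R) (cup_dots_E (k := k) (n := p) acc m)
  rw [strandsRev_comp, ← strandsRev_cons] at h
  exact (congrArg (fun x => TwoHom.comp (TwoHom.strandsRev R (TwoHom.cup (k := k) (n := p) E acc)) x)
    (sigma_dots F (E :: R) m acc)).trans h

theorem sigma_dotCap_E (m : ℕ) (R acc : Word) :
    (mk (sigma (dotCap E R m) acc) : TwoHom k p _ _) =
      TwoHom.strandsRev R (mk (dotCap F acc m)) := by
  have h := congrArg (TwoHom.strandsRev R) (cap_dots_F (k := k) (n := p) acc m)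
  rw [strandsRev_comp, ← strandsRev_cons] at h
  exact (congrArg (fun x => TwoHom.comp x (TwoHom.strandsRev R (TwoHom.cap (k := k) (n := p) F acc)))
    (sigma_dots E (F :: R) m acc)).trans h

theorem sigma_dotCap_F (m : ℕ) (R acc : Word) :
    (mk (sigma (dotCap F R m) acc) : TwoHom k p _ _) =
      TwoHom.strandsRev R (mk (dotCap E acc m)) := by
  have h := congrArg (TwoHom.strandsRev R) (cap_dots_E (k := k) (n := p) acc m)
  rw [strandsRev_comp, ← strandsRev_cons] at h
  exact (congrArg (fun x => TwoHom.comp x (TwoHom.strandsRev R (TwoHom.cap (k := k) (n := p) E acc)))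
    (sigma_dots F (E :: R) m acc)).trans h

theorem sigma_realBubble (s : Strand) (m : ℕ) (R acc : Word) :
    (mk (sigma (realBubble s m R) acc) : TwoHom k p _ _) =
      TwoHom.strandsRev R (mk (realBubble s.flip m acc)) := by
  cases s
  · have h := strandsRev_comp (k := k) (n := p) R (TwoHom.cup F acc) (mk (dotCap F acc m))
    refine Eq.trans ?_ h.symm
    exact congrArg (fun x => TwoHom.comp (TwoHom.strandsRev R (TwoHom.cup (k := k) (n := p) F acc)) x)
      (sigma_dotCap_E m R acc)
  · have h := strandsRev_comp (k := k) (n := p) R (TwoHom.cup E acc) (mk (dotCap E acc m))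
    refine Eq.trans ?_ h.symm
    exact congrArg (fun x => TwoHom.comp (TwoHom.strandsRev R (TwoHom.cup (k := k) (n := p) E acc)) x)
      (sigma_dotCap_F m R acc)

theorem sigma_sumRange {a b : Word} (g : ℕ → Diag k a b) (N : ℕ) (acc : Word) :
    sigma (sumRange g N) acc = sumRange (fun i => sigma (g i) acc) N := by
  induction N with
  | zero => rfl
  | succ N ih => simp [sumRange, sigma, ih]

theorem sigma_fakeBubble (s : Strand) (w : ℤ) (R acc : Word) (j : ℕ) :
    (mk (sigma (fakeBubble s w R j) acc) : TwoHom k p _ _) =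
      TwoHom.strandsRev R (mk (fakeBubble s.flip (-w) acc j)) := by
  induction j using Nat.strong_induction_on with
  | _ j ih =>
    cases j with
    | zero => simp only [fakeBubble, sigma, mk_id]; exact (strandsRev_id _ _).symm
    | succ j =>
      simp only [fakeBubble, sigma, sigma_sumRange, mk_smul, mk_sumRange, map_smul, map_sum,
        mk_comp, strandsRev_comp]
      congr 1
      refine Finset.sum_congr rfl fun i _ => ?_
      rw [ih (j - i) (by omega), sigma_realBubble, spade_flip]

theorem sigma_bubble (s : Strand) (w : ℤ) (j : ℤ) (R acc : Word) :
    (mk (sigma (bubble s w j R) acc) : TwoHom k p _ _) =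
      TwoHom.strandsRev R (mk (bubble s.flip (-w) j acc)) := by
  simp only [bubble, spade_flip]
  split_ifs
  · simp only [mk_zero, map_zero]; rfl
  · apply sigma_realBubble
  · apply sigma_fakeBubble

theorem sigma_side_E (R acc : Word) :
    (mk (sigma (side E R) acc) : TwoHom k p _ _) =
      (-1 : k) • TwoHom.strandsRev R (mk (side F acc)) := by
  refine (pull₁ (-1) _ _ _).trans (congrArg (fun x => (-1 : k) • x) ?_)
  rw [← side'_eq_side]
  simp only [side', mk_comp, strandsRev_comp]
  rfl

theorem sigma_side_F (R acc : Word) :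
    (mk (sigma (side F R) acc) : TwoHom k p _ _) =
      (-1 : k) • TwoHom.strandsRev R (mk (side E acc)) := by
  refine (pull₁ (-1) _ _ _).trans (congrArg (fun x => (-1 : k) • x) ?_)
  rw [← side'_eq_side]
  simp only [side', mk_comp, strandsRev_comp]
  rfl

theorem sigma_decompSum_E (N w : ℤ) (R acc : Word) :
    (mk (sigma (sum₃ N fun f₁ f₂ f₃ =>
      comp (dotCap E R f₃) (comp (bubble F w f₂ R) (dotCup E R f₁))) acc) : TwoHom k p _ _) =
    TwoHom.strandsRev R (mk (sum₃ N fun f₁ f₂ f₃ =>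
      comp (dotCap F acc f₃) (comp (bubble E (-w) f₂ acc) (dotCup F acc f₁)))) := by
  rw [mk_decompSum]
  simp only [sum₃, sum₂, sigma_sumRange, sigma, mk_sumRange, mk_comp, sigma_dotCap_E,
    sigma_dotCup_E, sigma_bubble, map_sum, strandsRev_comp, Int.toNat_natCast]
  rfl

theorem sigma_decompSum_F (N w : ℤ) (R acc : Word) :
    (mk (sigma (sum₃ N fun f₁ f₂ f₃ =>
      comp (dotCap F R f₃) (comp (bubble E w f₂ R) (dotCup F R f₁))) acc) : TwoHom k p _ _) =
    TwoHom.strandsRev R (mk (sum₃ N fun f₁ f₂ f₃ =>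
      comp (dotCap E acc f₃) (comp (bubble F (-w) f₂ acc) (dotCup E acc f₁)))) := by
  rw [mk_decompSum]
  simp only [sum₃, sum₂, sigma_sumRange, sigma, mk_sumRange, mk_comp, sigma_dotCap_F,
    sigma_dotCup_F, sigma_bubble, map_sum, strandsRev_comp, Int.toNat_natCast]
  rfl

end Diag

namespace Diag

variable {k : Type u} [CommRing k] {n p : ℤ}

open TwoHom

theorem sigma_left_curl (s : Strand) (R acc : Word) :
    (mk (sigma (leftCurl s R) acc) : TwoHom k p _ _) =
      (-1 : k) • TwoHom.strandsRev R (mk (rightCurl s acc)) := by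
  cases s
  · refine (pull₁ (-1) _ _ _).trans (congrArg (fun x => (-1 : k) • x) ?_)
    simp only [rightCurl, mk_comp, strandsRev_comp]
    rfl
  · refine (pull₁ (-1) _ _ _).trans (congrArg (fun x => (-1 : k) • x) ?_)
    simp only [rightCurl, mk_comp, strandsRev_comp]
    rfl

theorem sigma_right_curl (s : Strand) (R acc : Word) :
    (mk (sigma (rightCurl s R) acc) : TwoHom k p _ _) =
      (-1 : k) • TwoHom.strandsRev R (mk (leftCurl s acc)) := by
  cases s
  · refine (pull₁ (-1) _ _ _).trans (congrArg (fun x => (-1 : k) • x) ?_)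
    simp only [leftCurl, mk_comp, strandsRev_comp]
    rfl
  · refine (pull₁ (-1) _ _ _).trans (congrArg (fun x => (-1 : k) • x) ?_)
    simp only [leftCurl, mk_comp, strandsRev_comp]
    rfl

theorem pull₄ {a b c d e f : Word} (r : k) (x : Diag k a b) (y : Diag k b c) (z : Diag k c d)
    (v : Diag k d e) (w : Diag k e f) :
    (mk (comp x (comp y (comp (smul r z) (comp v w)))) : TwoHom k n _ _) =
      r • mk (comp x (comp y (comp z (comp v w)))) := by
  simp only [mk_comp, mk_smul, map_smul, LinearMap.smul_apply]

theorem sigma_crossRotL (s : Strand) (R acc : Word) :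
    (mk (sigma (crossRotL s R) acc) : TwoHom k p _ _) =
      (-1 : k) • TwoHom.strandsRev R (mk (crossRotR s acc)) := by
  cases s
  · refine (pull₄ (-1) _ _ _ _ _).trans (congrArg (fun x => (-1 : k) • x) ?_)
    simp only [crossRotR, mk_comp, strandsRev_comp]
    rfl
  · refine (pull₄ (-1) _ _ _ _ _).trans (congrArg (fun x => (-1 : k) • x) ?_)
    simp only [crossRotR, mk_comp, strandsRev_comp]
    rfl

theorem sigma_crossRotR (s : Strand) (R acc : Word) :
    (mk (sigma (crossRotR s R) acc) : TwoHom k p _ _) =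
      (-1 : k) • TwoHom.strandsRev R (mk (crossRotL s acc)) := by
  cases s
  · refine (pull₄ (-1) _ _ _ _ _).trans (congrArg (fun x => (-1 : k) • x) ?_)
    simp only [crossRotL, mk_comp, strandsRev_comp]
    rfl
  · refine (pull₄ (-1) _ _ _ _ _).trans (congrArg (fun x => (-1 : k) • x) ?_)
    simp only [crossRotL, mk_comp, strandsRev_comp]
    rfl

theorem smul_smul₃ {a b c d : Word} (x : Diag k a b) (y : Diag k b c) (z : Diag k c d) :
    (mk (comp (smul (-1) x) (comp (smul (-1) y) (smul (-1) z))) : TwoHom k n _ _) =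
      (-1 : k) • mk (comp x (comp y z)) := by
  simp [mk_comp, mk_smul]

theorem smul_sub {a b b' c : Word} (x : Diag k a b) (y : Diag k b c) (z : Diag k a b')
    (w : Diag k b' c) :
    (mk (add (comp x (smul (-1) y)) (smul (-1) (comp (smul (-1) z) w))) : TwoHom k n _ _) =
      mk (add (comp z w) (smul (-1) (comp x y))) := by
  simp only [mk_comp, mk_smul, mk_add, map_smul, LinearMap.smul_apply, smul_smul, mul_neg, mul_one,
    neg_neg, _root_.one_smul]
  exact _root_.add_comm _ _

theorem smul_sub' {a b b' c : Word} (x : Diag k a b) (y : Diag k b c) (z : Diag k a b')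
    (w : Diag k b' c) :
    (mk (add (comp (smul (-1) x) y) (smul (-1) (comp z (smul (-1) w)))) : TwoHom k n _ _) =
      mk (add (comp z w) (smul (-1) (comp x y))) := by
  simp only [mk_comp, mk_smul, mk_add, map_smul, LinearMap.smul_apply, smul_smul, mul_neg, mul_one,
    neg_neg, _root_.one_smul]
  exact _root_.add_comm _ _

theorem smul_smul₂ {a b c : Word} (x : Diag k a b) (y : Diag k b c) :
    (mk (comp (smul (-1) x) (smul (-1) y)) : TwoHom k n _ _) = mk (comp x y) := by
  simp [mk_comp, mk_smul]

theorem neg_smul_smul {a b : Word} (r : k) (x : TwoHom k n a b) :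
    (-1 : k) • r • x = (-r) • x := by
  simp

theorem sigma_rightSum (s : Strand) (N w : ℤ) (R acc : Word) :
    (mk (sigma (sum₂ N fun f₁ f₂ => comp (strand s (bubble s w f₂ R)) (dots s R f₁)) acc) :
      TwoHom k p _ _) = TwoHom.strandsRev R (mk (sum₂ N fun g₁ g₂ =>
        comp (bubble s.flip (-w) g₂ (s :: acc)) (dots s acc g₁))) := by
  simp only [sum₂, sigma_sumRange, mk_sumRange, map_sum]
  refine Finset.sum_congr rfl fun i _ => ?_
  rw [mk_comp, strandsRev_comp]
  exact congrArg₂ (fun x y => TwoHom.comp x y) (sigma_bubble s w _ R (s :: acc))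
    (sigma_dots s R i acc)

theorem sigma_leftSum (s : Strand) (N w : ℤ) (R acc : Word) :
    (mk (sigma (sum₂ N fun g₁ g₂ => comp (bubble s.flip w g₂ (s :: R)) (dots s R g₁)) acc) :
      TwoHom k p _ _) = TwoHom.strandsRev R (mk (sum₂ N fun f₁ f₂ =>
        comp (strand s (bubble s (-w) f₂ acc)) (dots s acc f₁))) := by
  simp only [sum₂, sigma_sumRange, mk_sumRange, map_sum]
  refine Finset.sum_congr rfl fun i _ => ?_
  rw [mk_comp, strandsRev_comp]
  have h := sigma_bubble (k := k) (p := p) s.flip w (N.toNat - i : ℕ) (s :: R) acc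
  rw [Strand.flip_flip] at h
  exact congrArg₂ (fun x y => TwoHom.comp x y) h (sigma_dots s R i acc)

theorem decomp_rescale' {a b : Word} {x : Diag k a b} {y : Diag k b a} {z : Diag k a a}
    {x' : TwoHom k n a b} {y' : TwoHom k n b a} {z' : TwoHom k n a a}
    (hx : mk x = (-1 : k) • x') (hy : mk y = (-1 : k) • y') (hz : mk z = z') :
    (mk (add (smul (-1) (comp x y)) z) : TwoHom k n _ _) =
      (-1 : k) • TwoHom.comp x' y' + z' := by
  simp [mk_add, mk_comp, mk_smul, hx, hy, hz]

theorem sigma_rel {a b : Word} {f g : Diag k a b} (r : Rel n f g) (acc : Word)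
    (h : wt p acc = -wt n a) :
    (mk (sigma f acc) : TwoHom k p _ _) = mk (sigma g acc) := by
  induction r generalizing acc with
  | add_congr_left g r ih => simp only [sigma, mk_add, ih acc h]
  | add_congr_right g r ih => simp only [sigma, mk_add, ih acc h]
  | smul_congr c r ih => simp only [sigma, mk_smul, ih acc h]
  | comp_congr_left g r ih => simp only [sigma, mk_comp, ih acc h]
  | @comp_congr_right a b c f g g' r ih =>
    simp only [sigma, mk_comp]
    by_cases h' : wt n a = wt n b
    · rw [ih acc (h' ▸ h)]
    · rw [mk_eq_zero (sigma f acc)]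
      · simp only [map_zero, LinearMap.zero_apply]
      · rw [wt_reverseAux, wt_reverseAux]
        intro h2
        exact h' ((wt_eq_iff n p a b).2 (by omega))
  | strand_congr s r ih => exact ih (s :: acc) (by simp only [wt_cons] at h ⊢; omega)
  | add_assoc f g h => exact sound (.add_assoc _ _ _)
  | add_comm f g => exact sound (.add_comm _ _)
  | zero_add f => exact sound (.zero_add _)
  | neg_add f => exact sound (.neg_add _)
  | one_smul f => exact sound (.one_smul _)
  | mul_smul c d f => exact sound (.mul_smul _ _ _)
  | smul_add c f g => exact sound (.smul_add _ _ _)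
  | add_smul c d f => exact sound (.add_smul _ _ _)
  | add_comp f g h => exact sound (.add_comp _ _ _)
  | smul_comp c f g => exact sound (.smul_comp _ _ _)
  | comp_add f g h => exact sound (.comp_add _ _ _)
  | comp_smul c f g => exact sound (.comp_smul _ _ _)
  | id_comp f => exact sound (.id_comp _)
  | comp_id f => exact sound (.comp_id _)
  | assoc f g h => exact sound (.assoc _ _ _)
  | strand_add s f g => rfl
  | strand_smul s r f => rfl
  | strand_id s a => rfl
  | strand_comp s f g => rfl
  | dot_nat s f => exact (sigma_nat f (TwoHom.dot s acc)).symm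
  | cross_nat s f =>
    exact neg_nat (sigma_nat f (TwoHom.cross s acc)).symm
  | cup_nat s f =>
    cases s
    · exact (sigma_nat f (TwoHom.cup F acc)).symm
    · exact (sigma_nat f (TwoHom.cup E acc)).symm
  | cap_nat s f =>
    cases s
    · exact (sigma_nat f (TwoHom.cap F acc)).symm
    · exact (sigma_nat f (TwoHom.cap E acc)).symm
  | zigzag_EL R =>
    have := congrArg (TwoHom.strandsRev R) (TwoHom.zigzag_ER (k := k) (n := p) acc)
    rw [strandsRev_comp, strandsRev_id] at this
    exact this
  | zigzag_FL R =>
    have := congrArg (TwoHom.strandsRev R) (TwoHom.zigzag_FR (k := k) (n := p) acc)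
    rw [strandsRev_comp, strandsRev_id] at this
    exact this
  | zigzag_ER R =>
    have := congrArg (TwoHom.strandsRev R) (TwoHom.zigzag_EL (k := k) (n := p) acc)
    rw [strandsRev_comp, strandsRev_id] at this
    exact this
  | zigzag_FR R =>
    have := congrArg (TwoHom.strandsRev R) (TwoHom.zigzag_FL (k := k) (n := p) acc)
    rw [strandsRev_comp, strandsRev_id] at this
    exact this
  | cross_cross s R =>
    have := congrArg (TwoHom.strandsRev R) (sound (n := p) (.cross_cross (k := k) s acc))
    rw [mk_comp, strandsRev_comp, mk_zero, map_zero] at this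
    exact (smul_smul₂ _ _).trans this
  | braid s R =>
    have := congrArg (TwoHom.strandsRev R) (sound (n := p) (.braid (k := k) s acc))
    simp only [mk_comp, strandsRev_comp] at this
    exact (smul_smul₃ _ _ _).trans ((congrArg (fun x => (-1 : k) • x) this.symm).trans
      (smul_smul₃ _ _ _).symm)
  | dot_slide s R =>
    have := congrArg (TwoHom.strandsRev R) (sound (n := p) (.dot_slide' (k := k) s acc))
    simp only [mk_add, mk_smul, map_smul, mk_comp, strandsRev_comp, map_add, mk_id,
      strandsRev_id] at this
    exact (smul_sub _ _ _ _).trans this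
  | dot_slide' s R =>
    have := congrArg (TwoHom.strandsRev R) (sound (n := p) (.dot_slide (k := k) s acc))
    simp only [mk_add, mk_smul, map_smul, mk_comp, strandsRev_comp, map_add, mk_id,
      strandsRev_id] at this
    exact (smul_sub' _ _ _ _).trans this
  | dot_rotL s R =>
    cases s
    · have := congrArg (TwoHom.strandsRev R) (sound (n := p) (.dot_rotR (k := k) E acc))
      simp only [dotRotR, mk_comp, strandsRev_comp] at this
      exact this
    · have := congrArg (TwoHom.strandsRev R) (sound (n := p) (.dot_rotR (k := k) F acc))
      simp only [dotRotR, mk_comp, strandsRev_comp] at this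
      exact this
  | dot_rotR s R =>
    cases s
    · have := congrArg (TwoHom.strandsRev R) (sound (n := p) (.dot_rotL (k := k) E acc))
      simp only [dotRotL, mk_comp, strandsRev_comp] at this
      exact this
    · have := congrArg (TwoHom.strandsRev R) (sound (n := p) (.dot_rotL (k := k) F acc))
      simp only [dotRotL, mk_comp, strandsRev_comp] at this
      exact this
  | cross_rotL s R =>
    have := congrArg (TwoHom.strandsRev R) (sound (n := p) (.cross_rotR (k := k) s acc))
    exact (sigma_crossRotL s R acc).trans (congrArg (fun x => (-1 : k) • x) this)
  | cross_rotR s R =>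
    have := congrArg (TwoHom.strandsRev R) (sound (n := p) (.cross_rotL (k := k) s acc))
    exact (sigma_crossRotR s R acc).trans (congrArg (fun x => (-1 : k) • x) this)
  | bubble_neg s m R h' =>
    rw [sigma_realBubble, sound (.bubble_neg _ _ _ (by rwa [h, spade_flip]))]
    exact map_zero (TwoHom.strandsRev R)
  | bubble_zero s m R h' =>
    rw [sigma_realBubble, sound (.bubble_zero _ _ _ (by rwa [h, spade_flip]))]
    exact strandsRev_id _ _
  | right_curl s R =>
    rw [sigma_right_curl, sound (.left_curl s acc)]
    have h2 : wt p (s :: acc) = -wt n R := by simp only [wt_cons] at h ⊢; omega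
    rw [h2]
    simp only [sigma, mk_smul]
    rw [sigma_rightSum, map_smul]
    rw [mul_neg]
    exact neg_smul_smul (k := k) (n := p) _ _
  | left_curl s R =>
    rw [sigma_left_curl, sound (.right_curl s acc), h]
    simp only [sigma, mk_smul]
    rw [sigma_leftSum, map_smul]
    rw [mul_neg, neg_neg]
    refine (neg_smul_smul (n := p) _ _).trans ?_
    rw [neg_neg]; rfl
  | decomp_E R =>
    have h2 : wt p acc = -wt n R := by simp only [wt_cons, sgn_E, sgn_F] at h; omega
    have := congrArg (TwoHom.strandsRev R) (sound (n := p) (.decomp_F (k := k) acc))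
    rw [h2, neg_neg] at this
    refine ((strandsRev_id R (F :: E :: acc)).symm.trans this).trans ?_
    rw [mk_add, mk_smul, mk_comp, map_add, map_smul, strandsRev_comp]
    exact (decomp_rescale' (sigma_side_E R acc) (sigma_side_F R acc)
      (sigma_decompSum_E _ _ R acc)).symm
  | decomp_F R =>
    have h2 : wt p acc = -wt n R := by simp only [wt_cons, sgn_E, sgn_F] at h; omega
    have := congrArg (TwoHom.strandsRev R) (sound (n := p) (.decomp_E (k := k) acc))
    rw [h2] at this
    refine ((strandsRev_id R (E :: F :: acc)).symm.trans this).trans ?_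
    rw [mk_add, mk_smul, mk_comp, map_add, map_smul, strandsRev_comp]
    exact (decomp_rescale' (sigma_side_F R acc) (sigma_side_E R acc)
      (sigma_decompSum_F _ _ R acc)).symm

end Diag

/-! ## The symmetries and the grading on 2-morphisms -/

namespace Diag

variable {k : Type u}

/-- `f.IsHomogeneous n d`: with `n` as label of the region at the right, `f` is a linear combination
of diagrams of degree `d`. -/
inductive IsHomogeneous (n : ℤ) : ℤ → ∀ {a b : Word}, Diag k a b → Prop
  | zero (d : ℤ) (a b : Word) : IsHomogeneous n d (zero a b)
  | add {d : ℤ} {a b : Word} {f g : Diag k a b} :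
      IsHomogeneous n d f → IsHomogeneous n d g → IsHomogeneous n d (add f g)
  | smul {d : ℤ} {a b : Word} (c : k) {f : Diag k a b} :
      IsHomogeneous n d f → IsHomogeneous n d (smul c f)
  | id (a : Word) : IsHomogeneous n 0 (id a)
  | comp {d e : ℤ} {a b c : Word} {f : Diag k a b} {g : Diag k b c} :
      IsHomogeneous n d f → IsHomogeneous n e g → IsHomogeneous n (d + e) (comp f g)
  | strand (s : Strand) {d : ℤ} {a b : Word} {f : Diag k a b} :
      IsHomogeneous n d f → IsHomogeneous n d (strand s f)
  | dot (s : Strand) (R : Word) : IsHomogeneous n 2 (dot s R)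
  | cross (s : Strand) (R : Word) : IsHomogeneous n (-2) (cross s R)
  | cup (s : Strand) (R : Word) : IsHomogeneous n (1 - s.sgn * wt n R) (cup s R)
  | cap (s : Strand) (R : Word) : IsHomogeneous n (1 - s.sgn * wt n R) (cap s R)

theorem IsHomogeneous.cast {n d e : ℤ} {a b : Word} {f : Diag k a b} (h : f.IsHomogeneous n d)
    (h' : d = e) : f.IsHomogeneous n e := h' ▸ h

theorem IsHomogeneous.strandsRev {n d : ℤ} (R : Word) {a b : Word} {f : Diag k a b}
    (h : f.IsHomogeneous n d) : (f.strandsRev R).IsHomogeneous n d := by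
  induction R generalizing a b with
  | nil => exact h
  | cons s R ih => exact ih (.strand s h)

end Diag

namespace TwoHom

variable {k : Type u} [CommRing k] {n p : ℤ}

/-- The symmetry `ω` on 2-morphisms: invert the orientation of each strand, negate each weight and
rescale each crossing by `-1`. -/
def omega (h : n + p = 0) {a b : Word} :
    TwoHom k n a b →ₗ[k] TwoHom k p (a.map flip) (b.map flip) where
  toFun := Quot.lift (fun f => mk f.omega) fun _ _ r => Diag.omega_rel h r
  map_add' x y := by induction x using ind; induction y using ind; rfl
  map_smul' c x := by induction x using ind; rfl

/-- The symmetry `ψ` on 2-morphisms: reflect across the `x`-axis and invert the orientation. -/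
def psi {a b : Word} : TwoHom k n a b →ₗ[k] TwoHom k n b a where
  toFun := Quot.lift (fun f => mk f.psi) fun _ _ r => Diag.psi_rel r
  map_add' x y := by induction x using ind; induction y using ind; rfl
  map_smul' c x := by induction x using ind; rfl

/-- The symmetry `σ` on 2-morphisms: reflect across the vertical axis, negate each weight and
rescale each crossing by `-1`. -/
def sigma {a b : Word} (h : wt n a + p = 0) :
    TwoHom k n a b →ₗ[k] TwoHom k p a.reverse b.reverse where
  toFun := Quot.lift (fun f => mk (f.sigma [])) fun _ _ r =>
    Diag.sigma_rel r [] (by rw [wt_nil]; omega)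
  map_add' x y := by induction x using ind; induction y using ind; rfl
  map_smul' c x := by induction x using ind; rfl

theorem omega_id (h : n + p = 0) (a : Word) :
    omega h (id a : TwoHom k n a a) = id (a.map flip) := rfl
theorem omega_comp (h : n + p = 0) {a b c : Word} (x : TwoHom k n a b) (y : TwoHom k n b c) :
    omega h (comp x y) = comp (omega h x) (omega h y) := by
  induction x using ind; induction y using ind; rfl
theorem psi_id (a : Word) : psi (id a : TwoHom k n a a) = id a := rfl
theorem psi_comp {a b c : Word} (x : TwoHom k n a b) (y : TwoHom k n b c) :
    psi (comp x y) = comp (psi y) (psi x) := by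
  induction x using ind; induction y using ind; rfl
theorem sigma_id (a : Word) (h : wt n a + p = 0) :
    sigma h (id a : TwoHom k n a a) = id a.reverse := rfl
theorem sigma_comp {a b c : Word} (h : wt n a + p = 0) (h' : wt n b + p = 0)
    (x : TwoHom k n a b) (y : TwoHom k n b c) :
    sigma h (comp x y) = comp (sigma h x) (sigma h' y) := by
  induction x using ind; induction y using ind; rfl

variable (k n) in
/-- The 2-morphisms of degree `d`. -/
def deg (d : ℤ) (a b : Word) : Submodule k (TwoHom k n a b) where
  carrier := {x | ∃ f : Diag k a b, f.IsHomogeneous n d ∧ mk f = x}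
  zero_mem' := ⟨_, .zero d a b, rfl⟩
  add_mem' := by
    rintro _ _ ⟨f, hf, rfl⟩ ⟨g, hg, rfl⟩
    exact ⟨_, hf.add hg, rfl⟩
  smul_mem' := by
    rintro c _ ⟨f, hf, rfl⟩
    exact ⟨_, hf.smul c, rfl⟩

theorem mk_mem {d : ℤ} {a b : Word} {f : Diag k a b} (h : f.IsHomogeneous n d) :
    mk f ∈ deg k n d a b := ⟨f, h, rfl⟩

theorem id_mem (t : ℤ) (a : Word) : id a ∈ deg k n (t - t) a a :=
  ⟨_, (Diag.IsHomogeneous.id a).cast (sub_self t).symm, rfl⟩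

theorem comp_mem {a b c : Word} {t t' t'' : ℤ} {x : TwoHom k n a b} {y : TwoHom k n b c}
    (hx : x ∈ deg k n (t - t') a b) (hy : y ∈ deg k n (t' - t'') b c) :
    comp x y ∈ deg k n (t - t'') a c := by
  obtain ⟨f, hf, rfl⟩ := hx
  obtain ⟨g, hg, rfl⟩ := hy
  exact ⟨_, (hf.comp hg).cast (by ring), rfl⟩

theorem omega_mem (h : n + p = 0) {d : ℤ} {a b : Word} {x : TwoHom k n a b}
    (hx : x ∈ deg k n d a b) : omega h x ∈ deg k p d (a.map flip) (b.map flip) := by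
  obtain ⟨f, hf, rfl⟩ := hx
  refine ⟨f.omega, ?_, rfl⟩
  induction hf with
  | zero d a b => exact .zero _ _ _
  | add _ _ ihf ihg => exact .add ihf ihg
  | smul c _ ih => exact .smul c ih
  | id a => exact .id _
  | comp _ _ ihf ihg => exact .comp ihf ihg
  | strand s _ ih => exact .strand _ ih
  | dot s R => exact .dot _ _
  | cross s R => exact .smul _ (.cross _ _)
  | cup s R => exact (Diag.IsHomogeneous.cup s.flip (R.map flip)).cast (by
      rw [Diag.wt_flip n p h, sgn_flip]; ring)
  | cap s R => exact (Diag.IsHomogeneous.cap s.flip (R.map flip)).cast (by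
      rw [Diag.wt_flip n p h, sgn_flip]; ring)

theorem psi_mem {d : ℤ} {a b : Word} {x : TwoHom k n a b} (hx : x ∈ deg k n d a b) :
    psi x ∈ deg k n d b a := by
  obtain ⟨f, hf, rfl⟩ := hx
  refine ⟨f.psi, ?_, rfl⟩
  induction hf with
  | zero d a b => exact .zero _ _ _
  | add _ _ ihf ihg => exact .add ihf ihg
  | smul c _ ih => exact .smul c ih
  | id a => exact .id _
  | comp _ _ ihf ihg => exact (Diag.IsHomogeneous.comp ihg ihf).cast (add_comm _ _)
  | strand s _ ih => exact .strand _ ih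
  | dot s R => exact .dot _ _
  | cross s R => exact .cross _ _
  | cup s R => exact .cap _ _
  | cap s R => exact .cup _ _

theorem mk_sigma_mem {d : ℤ} {a b : Word} {f : Diag k a b} (hf : f.IsHomogeneous n d)
    (acc : Word) (h : wt p acc = -wt n a) :
    (mk (f.sigma acc) : TwoHom k p _ _) ∈ deg k p d (a.reverseAux acc) (b.reverseAux acc) := by
  induction hf generalizing acc with
  | zero d a b => exact Submodule.zero_mem _
  | add _ _ ihf ihg => exact Submodule.add_mem _ (ihf acc h) (ihg acc h)
  | smul c _ ih => exact Submodule.smul_mem _ c (ih acc h)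
  | id a => exact mk_mem (.id _)
  | @comp d e a b c f g hf hg ihf ihg =>
    by_cases h' : wt n a = wt n b
    · obtain ⟨f', hf', e1⟩ := ihf acc h
      obtain ⟨g', hg', e2⟩ := ihg acc (h' ▸ h)
      refine ⟨f'.comp g', hf'.comp hg', ?_⟩
      rw [mk_comp, e1, e2]; rfl
    · have h0 : (mk ((f.comp g).sigma acc) : TwoHom k p _ _) = 0 := by
        rw [Diag.sigma, mk_comp, mk_eq_zero (f.sigma acc), map_zero, LinearMap.zero_apply]
        rw [wt_reverseAux, wt_reverseAux]
        intro h2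
        exact h' ((wt_eq_iff n p a b).2 (by omega))
      rw [h0]; exact Submodule.zero_mem _
  | strand s _ ih => exact ih (s :: acc) (by simp only [wt_cons] at h ⊢; omega)
  | dot s R => exact mk_mem (.strandsRev R (.dot _ _))
  | cross s R => exact mk_mem (.smul _ (.strandsRev R (.cross _ _)))
  | cup s R =>
    cases s
    · exact mk_mem (.strandsRev R ((Diag.IsHomogeneous.cup F acc).cast (by rw [h]; simp)))
    · exact mk_mem (.strandsRev R ((Diag.IsHomogeneous.cup E acc).cast (by rw [h]; simp)))
  | cap s R =>
    simp only [wt_cons, sgn_flip] at h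
    cases s
    · exact mk_mem (.strandsRev R ((Diag.IsHomogeneous.cap F acc).cast (by rw [h]; simp)))
    · exact mk_mem (.strandsRev R ((Diag.IsHomogeneous.cap E acc).cast (by rw [h]; simp)))

theorem sigma_mem {d : ℤ} {a b : Word} (h : wt n a + p = 0) {x : TwoHom k n a b}
    (hx : x ∈ deg k n d a b) : sigma h x ∈ deg k p d a.reverse b.reverse := by
  obtain ⟨f, hf, rfl⟩ := hx
  exact mk_sigma_mem hf [] (by rw [wt_nil]; omega)

end TwoHom

/-! ## The category `U(n, m)` -/

/-- A 1-morphism `E_a 1_n {t}` from `n` to `m` in `U`. -/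
structure Ob (k : Type u) (n m : ℤ) where
  /-- The signed sequence `a`. -/
  seq : Word
  /-- The grading shift `t`. -/
  shift : ℤ
  wt_seq : wt n seq = m

namespace Ob

variable {k : Type u} [CommRing k] {n m n' m' : ℤ}

/-- The 2-morphisms `E_a 1_n {t} ⟶ E_b 1_n {t'}` are the linear combinations of diagrams of
degree `t - t'`, modulo the relations. -/
instance : Category (Ob k n m) where
  Hom x y := TwoHom.deg k n (x.shift - y.shift) x.seq y.seq
  id x := ⟨TwoHom.id x.seq, TwoHom.id_mem _ _⟩
  comp f g := ⟨TwoHom.comp f.1 g.1, TwoHom.comp_mem f.2 g.2⟩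
  id_comp f := Subtype.ext (TwoHom.id_comp f.1)
  comp_id f := Subtype.ext (TwoHom.comp_id f.1)
  assoc f g h := Subtype.ext (TwoHom.assoc f.1 g.1 h.1)

instance (x y : Ob k n m) : AddCommGroup (x ⟶ y) :=
  inferInstanceAs (AddCommGroup (TwoHom.deg k n (x.shift - y.shift) x.seq y.seq))

instance (x y : Ob k n m) : Module k (x ⟶ y) :=
  inferInstanceAs (Module k (TwoHom.deg k n (x.shift - y.shift) x.seq y.seq))

instance : Preadditive (Ob k n m) where
  add_comp _ _ _ f f' g := Subtype.ext (by
    exact LinearMap.map_add₂ TwoHom.comp f.1 f'.1 g.1)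
  comp_add _ _ _ f g g' := Subtype.ext (map_add (TwoHom.comp f.1) g.1 g'.1)

instance : Linear k (Ob k n m) where
  smul_comp _ _ _ r f g := Subtype.ext (LinearMap.map_smul₂ TwoHom.comp r f.1 g.1)
  comp_smul _ _ _ f r g := Subtype.ext (map_smul (TwoHom.comp f.1) r g.1)

@[ext] theorem hom_ext {x y : Ob k n m} {f g : x ⟶ y} (h : f.1 = g.1) : f = g := Subtype.ext h

@[simp] theorem add_val {x y : Ob k n m} (f g : x ⟶ y) : (f + g).1 = f.1 + g.1 := rfl
@[simp] theorem zero_val {x y : Ob k n m} : (0 : x ⟶ y).1 = 0 := rfl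
@[simp] theorem id_val (x : Ob k n m) : (𝟙 x : x ⟶ x).1 = TwoHom.id x.seq := rfl
@[simp] theorem comp_val {x y z : Ob k n m} (f : x ⟶ y) (g : y ⟶ z) :
    (f ≫ g).1 = TwoHom.comp f.1 g.1 := rfl

end Ob

/-! ## The symmetries as functors -/

noncomputable section functors

variable (k : Type u) [CommRing k] {n m n' m' : ℤ}

theorem wt_reverse (h : n + n' = 0) (h' : m + m' = 0) (a : Word) (ha : wt n a = m) :
    wt m' a.reverse = n' := by
  have h1 := TwoHom.wt_reverseAux m' a []
  have h2 := TwoHom.wt_add (m' - n) n a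
  rw [sub_add_cancel] at h2
  change wt m' (a.reverseAux []) = n'
  rw [h1, h2, ha, wt_nil]
  omega

/-- `ω : U(n, m) ⥤ U(-n, -m)` on the 1-morphisms `E_a 1_n {t}`. -/
@[simps obj]
def omegaOb (h : n + n' = 0) (h' : m + m' = 0) : Ob k n m ⥤ Ob k n' m' where
  obj x := ⟨x.seq.map flip, x.shift, by
    rw [Diag.wt_flip n n' h, x.wt_seq]; omega⟩
  map f := ⟨TwoHom.omega h f.1, TwoHom.omega_mem h f.2⟩
  map_id x := Subtype.ext (TwoHom.omega_id h x.seq)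
  map_comp f g := Subtype.ext (TwoHom.omega_comp h f.1 g.1)

/-- `σ : U(n, m) ⥤ U(-m, -n)` on the 1-morphisms `E_a 1_n {t}`. -/
@[simps obj]
def sigmaOb (h : n + n' = 0) (h' : m + m' = 0) : Ob k n m ⥤ Ob k m' n' where
  obj x := ⟨x.seq.reverse, x.shift, wt_reverse h h' x.seq x.wt_seq⟩
  map {x _} f := ⟨TwoHom.sigma (by rw [x.wt_seq, h']) f.1, TwoHom.sigma_mem _ f.2⟩
  map_id x := Subtype.ext (TwoHom.sigma_id x.seq _)
  map_comp f g := Subtype.ext (TwoHom.sigma_comp _ _ f.1 g.1)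

/-- `ψ : U(n, m) ⥤ U(n, m)`, contravariant, on the 1-morphisms `E_a 1_n {t}`. -/
@[simps obj]
def psiOb (n m : ℤ) : (Ob k n m)ᵒᵖ ⥤ Ob k n m where
  obj x := ⟨x.unop.seq, -x.unop.shift, x.unop.wt_seq⟩
  map {x y} f := ⟨TwoHom.psi f.unop.1, by
    have h := TwoHom.psi_mem f.unop.2
    have e : y.unop.shift - x.unop.shift = -x.unop.shift - -y.unop.shift := by ring
    exact e ▸ h⟩
  map_id x := Subtype.ext (TwoHom.psi_id x.unop.seq)
  map_comp f g := Subtype.ext (TwoHom.psi_comp g.unop.1 f.unop.1)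

instance (h : n + n' = 0) (h' : m + m' = 0) : (omegaOb k h h').Additive where
  map_add {_ _ f g} := Subtype.ext (map_add (TwoHom.omega h) f.1 g.1)

instance (h : n + n' = 0) (h' : m + m' = 0) : (sigmaOb k h h').Additive where
  map_add {x _ f g} := Subtype.ext (map_add (TwoHom.sigma (by rw [x.wt_seq, h'])) f.1 g.1)

theorem psiOb_map_add {x y : Ob k n m} (f g : x ⟶ y) :
    (psiOb k n m).map (f + g).op = (psiOb k n m).map f.op + (psiOb k n m).map g.op :=
  Subtype.ext (map_add TwoHom.psi f.1 g.1)

instance : (psiOb k n m).Additive where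
  map_add {_ _ f g} := psiOb_map_add k f.unop g.unop

/-- The additive category `U(n, m)`: formal finite direct sums of the 1-morphisms `E_a 1_n {t}`
from `n` to `m`, and matrices of 2-morphisms. -/
abbrev U (n m : ℤ) := Mat_ (Ob k n m)

/-- Complexes over the additive category `U(n, m)` and their chain maps. -/
abbrev Kom (n m : ℤ) := CochainComplex (U k n m) ℤ

instance {A B : Type*} [Category A] [Category B] [Preadditive A] [Preadditive B] (F : A ⥤ B)
    [F.Additive] : F.mapMat_.Additive where
  map_add {_ _ _ _} := Mat_.hom_ext _ _ fun _ _ => F.map_add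

/-- `ω` on complexes. -/
def omega (h : n + n' = 0) (h' : m + m' = 0) : Kom k n m ⥤ Kom k n' m' :=
  (omegaOb k h h').mapMat_.mapHomologicalComplex _

/-- `σ` on complexes. -/
def sigma (h : n + n' = 0) (h' : m + m' = 0) : Kom k n m ⥤ Kom k m' n' :=
  (sigmaOb k h h').mapMat_.mapHomologicalComplex _

/-- `ψ` on direct sums of 1-morphisms: it is applied to each summand, and a matrix is transposed. -/
def psiMat (n m : ℤ) : (U k n m)ᵒᵖ ⥤ U k n m where
  obj M := ⟨M.unop.ι, fun i => (psiOb k n m).obj (.op (M.unop.X i))⟩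
  map f i j := (psiOb k n m).map (f.unop j i).op
  map_id M := by
    refine Mat_.hom_ext _ _ fun i j => ?_
    classical
    by_cases h : i = j
    · subst h
      refine (congrArg (fun x => (psiOb k n m).map (Quiver.Hom.op x))
        (Mat_.id_apply_self M.unop i)).trans ?_
      exact ((psiOb k n m).map_id _).trans (Mat_.id_apply_self _ i).symm
    · refine (congrArg (fun x => (psiOb k n m).map (Quiver.Hom.op x))
        (Mat_.id_apply_of_ne M.unop j i (Ne.symm h))).trans ?_
      exact ((psiOb k n m).map_zero _ _).trans (Mat_.id_apply_of_ne _ i j h).symm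
  map_comp {M N K} f g := by
    refine Mat_.hom_ext _ _ fun i j => ?_
    refine (congrArg (fun x => (psiOb k n m).map (Quiver.Hom.op x))
      (Mat_.comp_apply g.unop f.unop j i)).trans ?_
    refine Eq.trans ?_ (Mat_.comp_apply _ _ i j).symm
    rw [op_sum, Functor.map_sum]
    refine Finset.sum_congr rfl fun l _ => ?_
    rw [op_comp, Functor.map_comp]

instance : (psiMat k n m).Additive where
  map_add {_ _ f g} := by
    refine Mat_.hom_ext _ _ fun i j => ?_
    exact psiOb_map_add k (f.unop j i) (g.unop j i)

/-- `ψ` on complexes, contravariant: `(ψ X)ⁱ = ψ (X⁻ⁱ)`. -/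
def psi (n m : ℤ) : (Kom k n m)ᵒᵖ ⥤ Kom k n m where
  obj X :=
    { X := fun i => (psiMat k n m).obj (.op (X.unop.X (-i)))
      d := fun i j => (psiMat k n m).map (X.unop.d (-j) (-i)).op
      shape := fun i j h => by
        rw [X.unop.shape]
        · exact (psiMat k n m).map_zero _ _
        · intro h'
          apply h
          simp only [ComplexShape.up_Rel] at h' ⊢
          omega
      d_comp_d' := fun i j l _ _ => by
        rw [← Functor.map_comp, ← op_comp, HomologicalComplex.d_comp_d]
        exact (psiMat k n m).map_zero _ _ }
  map f :=
    { f := fun i => (psiMat k n m).map (f.unop.f (-i)).op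
      comm' := fun i j _ => by
        rw [← Functor.map_comp, ← Functor.map_comp, ← op_comp, ← op_comp,
          HomologicalComplex.Hom.comm] }
  map_id X := by
    ext1 i; exact (psiMat k n m).map_id _
  map_comp f g := by
    ext1 i; exact (psiMat k n m).map_comp _ _

end functors

/-! ## The symmetries are involutions that commute with each other -/

namespace TwoHom

section heq

variable {k : Type u} [CommRing k] {n : ℤ}

theorem heq_zero {a a' b b' : Word} (ha : a = a') (hb : b = b') :
    HEq (0 : TwoHom k n a b) (0 : TwoHom k n a' b') := by
  subst ha hb; rfl

theorem heq_add {a a' b b' : Word} (ha : a = a') (hb : b = b') {x y : TwoHom k n a b}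
    {x' y' : TwoHom k n a' b'} (hx : HEq x x') (hy : HEq y y') : HEq (x + y) (x' + y') := by
  subst ha hb; cases hx; cases hy; rfl

theorem heq_smul {a a' b b' : Word} (ha : a = a') (hb : b = b') (c : k) {x : TwoHom k n a b}
    {x' : TwoHom k n a' b'} (hx : HEq x x') : HEq (c • x) (c • x') := by
  subst ha hb; cases hx; rfl

theorem heq_id {a a' : Word} (ha : a = a') :
    HEq (id a : TwoHom k n a a) (id a' : TwoHom k n a' a') := by
  subst ha; rfl

theorem heq_comp {a a' b b' c c' : Word} (ha : a = a') (hb : b = b') (hc : c = c')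
    {x : TwoHom k n a b} {x' : TwoHom k n a' b'} {y : TwoHom k n b c} {y' : TwoHom k n b' c'}
    (hx : HEq x x') (hy : HEq y y') : HEq (comp x y) (comp x' y') := by
  subst ha hb hc; cases hx; cases hy; rfl

theorem heq_strand (s : Strand) {a a' b b' : Word} (ha : a = a') (hb : b = b')
    {x : TwoHom k n a b} {x' : TwoHom k n a' b'} (hx : HEq x x') :
    HEq (strand s x) (strand s x') := by
  subst ha hb; cases hx; rfl

theorem heq_strandsRev (R : Word) {a a' b b' : Word} (ha : a = a') (hb : b = b')
    {x : TwoHom k n a b} {x' : TwoHom k n a' b'} (hx : HEq x x') :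
    HEq (strandsRev R x) (strandsRev R x') := by
  subst ha hb; cases hx; rfl

theorem heq_dot (s : Strand) {R R' : Word} (h : R = R') :
    HEq (dot s R : TwoHom k n _ _) (dot s R' : TwoHom k n _ _) := by subst h; rfl
theorem heq_cross (s : Strand) {R R' : Word} (h : R = R') :
    HEq (cross s R : TwoHom k n _ _) (cross s R' : TwoHom k n _ _) := by subst h; rfl
theorem heq_cup (s : Strand) {R R' : Word} (h : R = R') :
    HEq (cup s R : TwoHom k n _ _) (cup s R' : TwoHom k n _ _) := by subst h; rfl
theorem heq_cap (s : Strand) {R R' : Word} (h : R = R') :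
    HEq (cap s R : TwoHom k n _ _) (cap s R' : TwoHom k n _ _) := by subst h; rfl

theorem rev_rev (a acc : Word) : (a.reverseAux acc).reverse = acc.reverseAux a := by
  simp [List.reverseAux_eq]

theorem sigma_strandsRev (R : Word) {a b : Word} (f : Diag k a b) (acc : Word) :
    HEq (mk ((f.strandsRev R).sigma acc) : TwoHom k n _ _)
      (mk (f.sigma (R ++ acc)) : TwoHom k n _ _) := by
  induction R generalizing a b with
  | nil => rfl
  | cons s R ih => exact ih (f.strand s)

theorem mk_sigma_sigma {a b : Word} (f : Diag k a b) (acc : Word) :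
    HEq (mk ((f.sigma acc).sigma []) : TwoHom k n _ _)
      (mk (f.strandsRev acc) : TwoHom k n _ _) := by
  induction f generalizing acc with
  | zero a b =>
    rw [mk_strandsRev, mk_zero, map_zero]
    exact heq_zero (rev_rev a acc) (rev_rev b acc)
  | @add a b f g ihf ihg =>
    rw [mk_strandsRev, mk_add, map_add]
    exact heq_add (rev_rev a acc) (rev_rev b acc) (ihf acc) (ihg acc)
  | @smul a b c f ih =>
    rw [mk_strandsRev, mk_smul, map_smul]
    exact heq_smul (rev_rev a acc) (rev_rev b acc) c (ih acc)
  | id a =>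
    rw [mk_strandsRev, mk_id, strandsRev_id]
    exact heq_id (rev_rev a acc)
  | @comp a b c f g ihf ihg =>
    rw [mk_strandsRev, mk_comp, strandsRev_comp]
    exact heq_comp (rev_rev a acc) (rev_rev b acc) (rev_rev c acc) (ihf acc) (ihg acc)
  | strand s f ih => exact ih (s :: acc)
  | dot s R =>
    refine (sigma_strandsRev R (.dot s acc) []).trans ?_
    have h : R ++ [] = R := List.append_nil R
    exact heq_strandsRev acc (by rw [h]) (by rw [h]) (heq_dot s h)
  | cross s R =>
    have h : R ++ [] = R := List.append_nil R
    have h1 := heq_smul (rev_rev (s :: s :: R) acc) (rev_rev (s :: s :: R) acc) (-1)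
      ((sigma_strandsRev (k := k) (n := n) R (.cross s acc) []).trans
        (heq_smul (k := k) (n := n) (by rw [h]) (by rw [h]) (-1)
          (heq_strandsRev acc (by rw [h]) (by rw [h]) (heq_cross s h))))
    refine HEq.trans h1 (heq_of_eq ?_)
    rw [smul_smul]
    simp
    rfl
  | cup s R =>
    have h : R ++ [] = R := List.append_nil R
    cases s
    · refine (sigma_strandsRev R (.cup F acc) []).trans ?_
      exact heq_strandsRev acc (by rw [h]) (by rw [h]) (heq_cup E h)
    · refine (sigma_strandsRev R (.cup E acc) []).trans ?_
      exact heq_strandsRev acc (by rw [h]) (by rw [h]) (heq_cup F h)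
  | cap s R =>
    have h : R ++ [] = R := List.append_nil R
    cases s
    · refine (sigma_strandsRev R (.cap F acc) []).trans ?_
      exact heq_strandsRev acc (by rw [h]) (by rw [h]) (heq_cap E h)
    · refine (sigma_strandsRev R (.cap E acc) []).trans ?_
      exact heq_strandsRev acc (by rw [h]) (by rw [h]) (heq_cap F h)

theorem map_rev (a acc : Word) :
    (a.reverseAux acc).map flip = (a.map flip).reverseAux (acc.map flip) := by
  simp [List.reverseAux_eq]

theorem omega_strandsRev (R : Word) {a b : Word} (f : Diag k a b) :
    HEq (mk (f.strandsRev R).omega : TwoHom k n _ _)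
      (mk (f.omega.strandsRev (R.map flip)) : TwoHom k n _ _) := by
  induction R generalizing a b with
  | nil => rfl
  | cons s R ih => exact ih (f.strand s)

theorem mk_omega_sigma {a b : Word} (f : Diag k a b) (acc : Word) :
    HEq (mk (f.sigma acc).omega : TwoHom k n _ _)
      (mk (f.omega.sigma (acc.map flip)) : TwoHom k n _ _) := by
  induction f generalizing acc with
  | zero a b => exact heq_zero (map_rev a acc) (map_rev b acc)
  | @add a b f g ihf ihg => exact heq_add (map_rev a acc) (map_rev b acc) (ihf acc) (ihg acc)
  | @smul a b c f ih => exact heq_smul (map_rev a acc) (map_rev b acc) c (ih acc)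
  | id a => exact heq_id (map_rev a acc)
  | @comp a b c f g ihf ihg =>
    exact heq_comp (map_rev a acc) (map_rev b acc) (map_rev c acc) (ihf acc) (ihg acc)
  | strand s f ih => exact ih (s :: acc)
  | dot s R => exact omega_strandsRev R (.dot s acc)
  | cross s R =>
    refine HEq.trans (heq_smul (map_rev (s :: s :: R) acc) (map_rev (s :: s :: R) acc) (-1)
      (omega_strandsRev R (.cross s acc))) (heq_of_eq ?_)
    exact congrArg (fun x => (-1 : k) • x) (map_smul (strandsRev (R.map flip)) (-1 : k)
      (cross s.flip (acc.map flip)))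
  | cup s R => cases s <;> exact omega_strandsRev R _
  | cap s R => cases s <;> exact omega_strandsRev R _

end heq

theorem psi_strandsRev {k : Type u} (R : Word) {a b : Word} (f : Diag k a b) :
    (f.strandsRev R).psi = f.psi.strandsRev R := by
  induction R generalizing a b with
  | nil => rfl
  | cons s R ih => exact ih (f.strand s)

section eq

variable {k : Type u} [CommRing k]

theorem psi_sigma {a b : Word} (f : Diag k a b) (acc : Word) :
    (f.sigma acc).psi = f.psi.sigma acc := by
  induction f generalizing acc with
  | zero a b => rfl
  | add f g ihf ihg => exact congrArg₂ Diag.add (ihf acc) (ihg acc)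
  | smul c f ih => exact congrArg (Diag.smul c) (ih acc)
  | id a => rfl
  | comp f g ihf ihg => exact congrArg₂ Diag.comp (ihg acc) (ihf acc)
  | strand s f ih => exact ih (s :: acc)
  | dot s R => exact psi_strandsRev R (.dot s acc)
  | cross s R => exact congrArg (Diag.smul (-1)) (psi_strandsRev R (.cross s acc))
  | cup s R => cases s <;> exact psi_strandsRev R _
  | cap s R => cases s <;> exact psi_strandsRev R _

theorem psi_omega {a b : Word} (f : Diag k a b) : f.omega.psi = f.psi.omega := by
  induction f with
  | zero a b => rfl
  | add f g ihf ihg => exact congrArg₂ Diag.add ihf ihg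
  | smul c f ih => exact congrArg (Diag.smul c) ih
  | id a => rfl
  | comp f g ihf ihg => exact congrArg₂ Diag.comp ihg ihf
  | strand s f ih => exact congrArg (Diag.strand s.flip) ih
  | dot s R => rfl
  | cross s R => rfl
  | cup s R => rfl
  | cap s R => rfl

end eq

end TwoHom

noncomputable section

namespace Ob

variable {k : Type u} [CommRing k] {n m n' m' : ℤ}

theorem ext' {k : Type u} {n m : ℤ} {x y : Ob k n m} (h : x.seq = y.seq) (h' : x.shift = y.shift) : x = y := by
  cases x; cases y; subst h; subst h'; rfl

theorem heq_hom {x x' y y' : Ob k n m} (hx : x = x') (hy : y = y') {f : x ⟶ y} {f' : x' ⟶ y'}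
    (h : HEq f.1 f'.1) : HEq f f' := by
  subst hx hy
  exact heq_of_eq (Subtype.ext (eq_of_heq h))

end Ob

variable (k : Type u) [CommRing k] {n m n' m' : ℤ}

theorem neg_symm (h : n + n' = 0) : n' + n = 0 := by rw [add_comm]; exact h

theorem sigmaOb_sigmaOb (h : n + n' = 0) (h' : m + m' = 0) :
    sigmaOb k h h' ⋙ sigmaOb k (neg_symm h') (neg_symm h) = 𝟭 (Ob k n m) := by
  have hx (x : Ob k n m) : (sigmaOb k h h' ⋙ sigmaOb k (neg_symm h') (neg_symm h)).obj x = x :=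
    Ob.ext' (List.reverse_reverse x.seq) rfl
  refine Functor.hext hx fun x y f => Ob.heq_hom (hx x) (hx y) ?_
  obtain ⟨f, hf⟩ := f
  induction f using TwoHom.ind with
  | h f => exact TwoHom.mk_sigma_sigma f []

theorem sigmaOb_omegaOb (h : n + n' = 0) (h' : m + m' = 0) :
    sigmaOb k h h' ⋙ omegaOb k (neg_symm h') (neg_symm h) =
      omegaOb k h h' ⋙ sigmaOb k (neg_symm h) (neg_symm h') := by
  have hx (x : Ob k n m) : (sigmaOb k h h' ⋙ omegaOb k (neg_symm h') (neg_symm h)).obj x =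
      (omegaOb k h h' ⋙ sigmaOb k (neg_symm h) (neg_symm h')).obj x :=
    Ob.ext' List.map_reverse rfl
  refine Functor.hext hx fun x y f => Ob.heq_hom (hx x) (hx y) ?_
  obtain ⟨f, hf⟩ := f
  induction f using TwoHom.ind with
  | h f => exact TwoHom.mk_omega_sigma f []

theorem mapMat_congr {A B : Type*} [Category A] [Category B] [Preadditive A] [Preadditive B]
    {F G : A ⥤ B} [F.Additive] [G.Additive] (h : F = G) (X : CochainComplex (Mat_ A) ℤ) :
    (F.mapMat_.mapHomologicalComplex _).obj X = (G.mapMat_.mapHomologicalComplex _).obj X := by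
  subst h; rfl

/-- `σ` is an involution. -/
theorem sigma_sigma (h : n + n' = 0) (h' : m + m' = 0) (X : Kom k n m) :
    (sigma k (neg_symm h') (neg_symm h)).obj ((sigma k h h').obj X) = X :=
  mapMat_congr (F := sigmaOb k h h' ⋙ sigmaOb k (neg_symm h') (neg_symm h)) (G := 𝟭 _)
    (sigmaOb_sigmaOb k h h') X

/-- `σ` and `ω` commute. -/
theorem omega_sigma (h : n + n' = 0) (h' : m + m' = 0) (X : Kom k n m) :
    (omega k (neg_symm h') (neg_symm h)).obj ((sigma k h h').obj X) =
      (sigma k (neg_symm h) (neg_symm h')).obj ((omega k h h').obj X) :=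
  mapMat_congr (F := sigmaOb k h h' ⋙ omegaOb k (neg_symm h') (neg_symm h))
    (G := omegaOb k h h' ⋙ sigmaOb k (neg_symm h) (neg_symm h')) (sigmaOb_omegaOb k h h') X

theorem complex_ext {C : Type*} [Category C] [Preadditive C] {X : ℤ → C}
    {d d' : ∀ i j, X i ⟶ X j} {s s' e e'} (h : d = d') :
    (⟨X, d, s, e⟩ : CochainComplex C ℤ) = ⟨X, d', s', e'⟩ := by subst h; rfl

/-- `ψ` and `σ` commute. -/
theorem psi_sigma (h : n + n' = 0) (h' : m + m' = 0) (X : Kom k n m) :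
    (psi k m' n').obj (.op ((sigma k h h').obj X)) =
      (sigma k h h').obj ((psi k n m).obj (.op X)) := by
  refine complex_ext (funext fun i => funext fun j => Mat_.hom_ext _ _ fun p q => ?_)
  change (psiOb k m' n').map ((sigmaOb k h h').map (X.d (-j) (-i) q p)).op =
    (sigmaOb k h h').map ((psiOb k n m).map (X.d (-j) (-i) q p).op)
  generalize X.d (-j) (-i) q p = f
  obtain ⟨f, hf⟩ := f
  refine Ob.hom_ext ?_
  induction f using TwoHom.ind with
  | h f => exact congrArg TwoHom.mk (TwoHom.psi_sigma f [])

/-- `ψ` and `ω` commute. -/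
theorem psi_omega (h : n + n' = 0) (h' : m + m' = 0) (X : Kom k n m) :
    (psi k n' m').obj (.op ((omega k h h').obj X)) =
      (omega k h h').obj ((psi k n m).obj (.op X)) := by
  refine complex_ext (funext fun i => funext fun j => Mat_.hom_ext _ _ fun p q => ?_)
  change (psiOb k n' m').map ((omegaOb k h h').map (X.d (-j) (-i) q p)).op =
    (omegaOb k h h').map ((psiOb k n m).map (X.d (-j) (-i) q p).op)
  generalize X.d (-j) (-i) q p = f
  obtain ⟨f, hf⟩ := f
  refine Ob.hom_ext ?_
  induction f using TwoHom.ind with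
  | h f => exact congrArg TwoHom.mk (TwoHom.psi_omega f)

end

/-! ## The Casimir complex -/

noncomputable section

/-- The direct sum `x ⊕ y` of two 1-morphisms. -/
def pair {k : Type u} [CommRing k] {n m : ℤ} (x y : Ob k n m) : U k n m :=
  ⟨Fin 2, fun | 0 => x | 1 => y⟩

/-- The matrix with rows `(a b)` and `(c d)` as a morphism `x₁ ⊕ x₂ ⟶ y₁ ⊕ y₂`; it acts on columns,
so that `b` is the component `x₂ ⟶ y₁`. -/
def matHom {k : Type u} [CommRing k] {n m : ℤ} {x₁ x₂ y₁ y₂ : Ob k n m} (a : x₁ ⟶ y₁) (b : x₂ ⟶ y₁)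
    (c : x₁ ⟶ y₂) (d : x₂ ⟶ y₂) : pair x₁ x₂ ⟶ pair y₁ y₂ :=
  let f : ∀ i j : Fin 2, (pair x₁ x₂).X i ⟶ (pair y₁ y₂).X j
    | 0, 0 => a | 1, 0 => b | 0, 1 => c | 1, 1 => d
  f

theorem matHom_comp_matHom {k : Type u} [CommRing k] {n m : ℤ} {x₁ x₂ y₁ y₂ z₁ z₂ : Ob k n m}
    {a : x₁ ⟶ y₁} {b : x₂ ⟶ y₁} {c : x₁ ⟶ y₂} {d : x₂ ⟶ y₂}
    {a' : y₁ ⟶ z₁} {b' : y₂ ⟶ z₁} {c' : y₁ ⟶ z₂} {d' : y₂ ⟶ z₂}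
    (h₁ : a ≫ a' + c ≫ b' = 0) (h₂ : b ≫ a' + d ≫ b' = 0)
    (h₃ : a ≫ c' + c ≫ d' = 0) (h₄ : b ≫ c' + d ≫ d' = 0) :
    matHom a b c d ≫ matHom a' b' c' d' = 0 := by
  refine Mat_.hom_ext _ _ fun i j => ?_
  refine (Mat_.comp_apply _ _ i j).trans ?_
  refine (Fin.sum_univ_two _).trans ?_
  change Fin 2 at i j
  match i, j with
  | 0, 0 => exact h₁
  | 1, 0 => exact h₂
  | 0, 1 => exact h₃
  | 1, 1 => exact h₄

variable (k : Type u) [CommRing k]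

/-- `E F 1_n {t}` if `s = E`, and `F E 1_n {t}` if `s = F`. -/
def obEF (s : Strand) (n t : ℤ) : Ob k n n := ⟨[s, s.flip], t, by simp⟩

/-- `1_n {t}`. -/
def obOne (n t : ℤ) : Ob k n n := ⟨[], t, rfl⟩

end

section

variable (k : Type u)

/-- The dot on the strand `E` of `E F` (if `s = E`) or of `F E` (if `s = F`). -/
def dotE : ∀ s : Strand, Diag k [s, s.flip] [s, s.flip]
  | E => .dot E [F]
  | F => .strand F (.dot E [])

/-- The dot on the strand `F` of `E F` (if `s = E`) or of `F E` (if `s = F`). -/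
def dotF : ∀ s : Strand, Diag k [s, s.flip] [s, s.flip]
  | E => .strand E (.dot F [])
  | F => .dot F [E]

end

noncomputable section

theorem dotE_homogeneous {k : Type u} (s : Strand) (n : ℤ) : (dotE k s).IsHomogeneous n 2 := by
  cases s
  · exact .dot E [F]
  · exact .strand F (.dot E [])

theorem dotF_homogeneous {k : Type u} (s : Strand) (n : ℤ) : (dotF k s).IsHomogeneous n 2 := by
  cases s
  · exact .strand E (.dot F [])
  · exact .dot F [E]

variable {k : Type u} [CommRing k]

theorem dotE_dotF (s : Strand) (n : ℤ) :
    TwoHom.comp (TwoHom.mk (dotE k s)) (TwoHom.mk (dotF k s)) =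
      (TwoHom.comp (TwoHom.mk (dotF k s)) (TwoHom.mk (dotE k s)) : TwoHom k n _ _) := by
  cases s
  · exact TwoHom.dot_nat E (TwoHom.dot F [])
  · exact (TwoHom.dot_nat F (TwoHom.dot E [])).symm

theorem cup_dotE (s : Strand) (n : ℤ) :
    TwoHom.comp (TwoHom.cup s []) (TwoHom.mk (dotE k s)) =
      (TwoHom.comp (TwoHom.cup s []) (TwoHom.mk (dotF k s)) : TwoHom k n _ _) := by
  cases s
  · exact (TwoHom.cup_dot_E []).symm
  · exact TwoHom.cup_dot_F []

theorem dotE_cap (s : Strand) (n : ℤ) :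
    TwoHom.comp (TwoHom.mk (dotE k s)) (TwoHom.cap s []) =
      (TwoHom.comp (TwoHom.mk (dotF k s)) (TwoHom.cap s []) : TwoHom k n _ _) := by
  cases s
  · exact (TwoHom.cap_dot_E []).symm
  · exact TwoHom.cap_dot_F []

variable (k)

section

variable (s : Strand) (n : ℤ) {t t' : ℤ}

/-- The dot on the strand `E`, of degree `2`. -/
def homDotE (h : t - t' = 2) : obEF k s n t ⟶ obEF k s n t' :=
  ⟨TwoHom.mk (dotE k s), TwoHom.mk_mem ((dotE_homogeneous s n).cast h.symm)⟩

/-- The dot on the strand `F`, of degree `2`. -/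
def homDotF (h : t - t' = 2) : obEF k s n t ⟶ obEF k s n t' :=
  ⟨TwoHom.mk (dotF k s), TwoHom.mk_mem ((dotF_homogeneous s n).cast h.symm)⟩

/-- The cup `1_n ⟶ E F 1_n` (if `s = E`) or `1_n ⟶ F E 1_n` (if `s = F`). -/
def homCup (h : t - t' = 1 - s.sgn * n) : obOne k n t ⟶ obEF k s n t' :=
  ⟨TwoHom.cup s [], TwoHom.mk_mem ((Diag.IsHomogeneous.cup s []).cast h.symm)⟩

/-- The cap `E F 1_n ⟶ 1_n` (if `s = E`) or `F E 1_n ⟶ 1_n` (if `s = F`). -/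
def homCap (h : t - t' = 1 - s.sgn * n) : obEF k s n t ⟶ obOne k n t' :=
  ⟨TwoHom.cap s [], TwoHom.mk_mem ((Diag.IsHomogeneous.cap s []).cast h.symm)⟩

/-- The differential `E F {2} ⊕ 1 {1 - n} ⟶ E F ⊕ E F` (if `s = E`) from degree `-1` to `0`. -/
def casimirD₀ : pair (obEF k s n 2) (obOne k n (1 - s.sgn * n)) ⟶
    pair (obEF k s n 0) (obEF k s n 0) :=
  matHom (homDotE k s n rfl) (homCup k s n (sub_zero _))
    (homDotF k s n rfl) (homCup k s n (sub_zero _))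

/-- The differential `E F ⊕ E F ⟶ E F {-2} ⊕ 1 {n - 1}` (if `s = E`) from degree `0` to `1`. -/
def casimirD₁ : pair (obEF k s n 0) (obEF k s n 0) ⟶
    pair (obEF k s n (-2)) (obOne k n (s.sgn * n - 1)) :=
  matHom (-homDotF k s n rfl) (homDotE k s n rfl)
    (homCap k s n (by ring)) (-homCap k s n (by ring))

theorem casimirD₀_casimirD₁ : casimirD₀ k s n ≫ casimirD₁ k s n = 0 := by
  refine matHom_comp_matHom ?_ ?_ ?_ ?_
  · rw [Preadditive.comp_neg, neg_add_eq_zero]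
    exact Ob.hom_ext (dotE_dotF s n)
  · rw [Preadditive.comp_neg, neg_add_eq_zero]
    exact Ob.hom_ext (cup_dotE s n).symm
  · rw [Preadditive.comp_neg, add_neg_eq_zero]
    exact Ob.hom_ext (dotE_cap s n)
  · rw [Preadditive.comp_neg, add_neg_eq_zero]

/-- The terms of the Casimir complex. The integers `-1`, `0`, `1` are `.negSucc 0`, `.ofNat 0`,
`.ofNat 1`. -/
def casimirX : ℤ → U k n n
  | .negSucc 0 => pair (obEF k s n 2) (obOne k n (1 - s.sgn * n))
  | .ofNat 0 => pair (obEF k s n 0) (obEF k s n 0)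
  | .ofNat 1 => pair (obEF k s n (-2)) (obOne k n (s.sgn * n - 1))
  | _ => ⟨Fin 0, Fin.elim0⟩

/-- The differentials of the Casimir complex. -/
def casimird : ∀ i j : ℤ, casimirX k s n i ⟶ casimirX k s n j
  | .negSucc 0, .ofNat 0 => casimirD₀ k s n
  | .ofNat 0, .ofNat 1 => casimirD₁ k s n
  | _, _ => 0

/-- The Casimir complex and its version with `E` and `F` interchanged. -/
def casimir : Kom k n n where
  X := casimirX k s n
  d := casimird k s n
  shape i j h := by
    simp only [ComplexShape.up_Rel] at h
    match i, j with
    | .negSucc 0, .ofNat 0 => exact absurd rfl h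
    | .negSucc 0, .ofNat (_ + 1) => rfl
    | .negSucc 0, .negSucc _ => rfl
    | .negSucc (_ + 1), .ofNat _ => rfl
    | .negSucc (_ + 1), .negSucc _ => rfl
    | .ofNat 0, .ofNat 0 => rfl
    | .ofNat 0, .ofNat 1 => exact absurd rfl h
    | .ofNat 0, .ofNat (_ + 2) => rfl
    | .ofNat 0, .negSucc _ => rfl
    | .ofNat (_ + 1), .ofNat _ => rfl
    | .ofNat (_ + 1), .negSucc _ => rfl
  d_comp_d' i j l hij hjl := by
    simp only [ComplexShape.up_Rel] at hij hjl
    subst hij hjl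
    match i with
    | .negSucc 0 => exact casimirD₀_casimirD₁ k s n
    | .ofNat 0 => exact Limits.comp_zero
    | .ofNat (_ + 1) => exact Limits.zero_comp
    | .negSucc 1 => exact Limits.zero_comp
    | .negSucc (_ + 2) => exact Limits.zero_comp

end

/-- The Casimir complex `C 1_n`. -/
abbrev C (n : ℤ) : Kom k n n := casimir k E n

/-- The complex `C' 1_n`. -/
abbrev C' (n : ℤ) : Kom k n n := casimir k F n

end

/-! ## The symmetric forms of the Casimir complex -/

noncomputable section

section

variable (k : Type u) [CommRing k] (n : ℤ) {n' : ℤ}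

/-- `σ(C 1_{n'})` as a complex over `U(n, n)`, where `n' = -n`. -/
abbrev σC (h : n + n' = 0) : Kom k n n := (sigma k (neg_symm h) (neg_symm h)).obj (C k n')

/-- `ω(C 1_{n'})` as a complex over `U(n, n)`, where `n' = -n`. -/
abbrev ωC (h : n + n' = 0) : Kom k n n := (omega k (neg_symm h) (neg_symm h)).obj (C k n')

/-- `ψ(C 1_n)`. -/
abbrev ψC : Kom k n n := (psi k n n).obj (.op (C k n))

/-- `σω(C 1_n)`. -/
abbrev σωC (h : n + n' = 0) : Kom k n n :=
  (sigma k (neg_symm h) (neg_symm h)).obj ((omega k h h).obj (C k n))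

/-- `σψ(C 1_{n'})` as a complex over `U(n, n)`, where `n' = -n`. -/
abbrev σψC (h : n + n' = 0) : Kom k n n := (sigma k (neg_symm h) (neg_symm h)).obj (ψC k n')

/-- `ωψ(C 1_{n'})` as a complex over `U(n, n)`, where `n' = -n`. -/
abbrev ωψC (h : n + n' = 0) : Kom k n n := (omega k (neg_symm h) (neg_symm h)).obj (ψC k n')

/-- `σωψ(C 1_n)`. -/
abbrev σωψC (h : n + n' = 0) : Kom k n n :=
  (sigma k (neg_symm h) (neg_symm h)).obj ((omega k h h).obj (ψC k n))

end

/-- Enumerations of the (two) summands of the terms of a complex in the degrees `-1`, `0`, `1`. -/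
structure Enum {k : Type u} [CommRing k] {n m : ℤ} (X : Kom k n m) where
  /-- The summands in degree `-1`. -/
  neg : Fin 2 → (X.X (-1)).ι
  /-- The summands in degree `0`. -/
  zero : Fin 2 → (X.X 0).ι
  /-- The summands in degree `1`. -/
  one : Fin 2 → (X.X 1).ι

section

variable (k : Type u) [CommRing k] (n : ℤ) {n' : ℤ}

/-- The summands of `C 1_n`, in the order of the definition. -/
def enumC : Enum (C k n) := ⟨fun i => i, fun i => i, fun i => i⟩

/-- The summands of `σ(C 1_{n'})`, in the order of the definition of `C 1_{n'}`. -/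
def enumσC (h : n + n' = 0) : Enum (σC k n h) := ⟨fun i => i, fun i => i, fun i => i⟩

/-- The summands of `ψ(C 1_n)`; the terms of `C 1_n` in the degrees `±1` are interchanged. -/
def enumψC : Enum (ψC k n) := ⟨fun i => i, fun i => i, fun i => i⟩

/-- The summands of `σω(C 1_n)`, in the order of the definition of `C 1_n`. -/
def enumσωC (h : n + n' = 0) : Enum (σωC k n h) := ⟨fun i => i, fun i => i, fun i => i⟩

end

/-- `HasMatrix φ p q a b c d`: with respect to the enumerations `p` and `q` of the summands of `M`
and `N`, the morphism `φ` is given by the matrix with rows `(a b)` and `(c d)`; as matrices act on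
columns, `b` is the component from `p 1` to `q 0`. -/
def HasMatrix {k : Type u} [CommRing k] {n m : ℤ} {M N : U k n m} (φ : M ⟶ N)
    (p : Fin 2 → M.ι) (q : Fin 2 → N.ι)
    (a : Diag k (M.X (p 0)).seq (N.X (q 0)).seq) (b : Diag k (M.X (p 1)).seq (N.X (q 0)).seq)
    (c : Diag k (M.X (p 0)).seq (N.X (q 1)).seq) (d : Diag k (M.X (p 1)).seq (N.X (q 1)).seq) :
    Prop :=
  (φ (p 0) (q 0)).1 = TwoHom.mk a ∧ (φ (p 1) (q 0)).1 = TwoHom.mk b ∧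
  (φ (p 0) (q 1)).1 = TwoHom.mk c ∧ (φ (p 1) (q 1)).1 = TwoHom.mk d

section

variable {k : Type u} [CommRing k] {n n' : ℤ}

namespace Diag

/-- The negative of a linear combination of diagrams. -/
def neg {a b : Word} (f : Diag k a b) : Diag k a b := smul (-1) f

variable (k)

/-- The sum over `f₁ + f₂ = N` of the cup `s` with `f₁` dots over the bubble `♠ + f₂` of orientation
`s'` in the outer region, whose weight is `n`. -/
def bubbleCup (s s' : Strand) (n N : ℤ) : Diag k [] [s, s.flip] :=
  sum₂ N fun f₁ f₂ => comp (bubble s' n f₂ []) (dotCup s [] f₁)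

/-- The sum over `f₁ + f₂ = N` of the cap `s` with `f₁` dots under the bubble `♠ + f₂` of orientation
`s'` in the outer region, whose weight is `n`. -/
def capBubble (s s' : Strand) (n N : ℤ) : Diag k [s, s.flip] [] :=
  sum₂ N fun f₁ f₂ => comp (dotCap s [] f₁) (bubble s' n f₂ [])

/-- The sum over `f₁ + f₂ + f₃ = N` of the cup `s` with `f₁` dots over the bubble `♠ + f₂` of
orientation `s'` over the cap `s` with `f₃` dots. -/
def capBubbleCup (s s' : Strand) (n N : ℤ) : Diag k [s, s.flip] [s, s.flip] :=
  sum₃ N fun f₁ f₂ f₃ => comp (dotCap s [] f₃) (comp (bubble s' n f₂ []) (dotCup s [] f₁))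

end Diag

open Diag

/-- The formula for `ρ^ψ : C 1_n ⟶ ψ(C 1_n)`. -/
structure IsRhoPsi (φ : C k n ⟶ ψC k n) : Prop where
  deg_neg_one : HasMatrix (φ.f (-1)) (enumC k n).neg (enumψC k n).neg
    (neg (id [E, F])) (zero _ _) (zero _ _) (id [])
  deg_zero : HasMatrix (φ.f 0) (enumC k n).zero (enumψC k n).zero
    (zero _ _) (id [E, F]) (neg (id [E, F])) (zero _ _)
  deg_one : HasMatrix (φ.f 1) (enumC k n).one (enumψC k n).one
    (id [E, F]) (zero _ _) (zero _ _) (neg (id []))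

/-- The formula for the inverse `ρ̂^ψ : ψ(C 1_n) ⟶ C 1_n`. -/
structure IsRhoHatPsi (φ : ψC k n ⟶ C k n) : Prop where
  deg_neg_one : HasMatrix (φ.f (-1)) (enumψC k n).neg (enumC k n).neg
    (neg (id [E, F])) (zero _ _) (zero _ _) (id [])
  deg_zero : HasMatrix (φ.f 0) (enumψC k n).zero (enumC k n).zero
    (zero _ _) (neg (id [E, F])) (id [E, F]) (zero _ _)
  deg_one : HasMatrix (φ.f 1) (enumψC k n).one (enumC k n).one
    (id [E, F]) (zero _ _) (zero _ _) (neg (id []))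

/-- The formula for `ρ^{σω} : C 1_n ⟶ σω(C 1_n)`. -/
structure IsRhoSigmaOmega (h : n + n' = 0) (φ : C k n ⟶ σωC k n h) : Prop where
  deg_neg_one : HasMatrix (φ.f (-1)) (enumC k n).neg (enumσωC k n h).neg
    (id [E, F]) (zero _ _) (zero _ _) (id [])
  deg_zero : HasMatrix (φ.f 0) (enumC k n).zero (enumσωC k n h).zero
    (zero _ _) (id [E, F]) (id [E, F]) (zero _ _)
  deg_one : HasMatrix (φ.f 1) (enumC k n).one (enumσωC k n h).one
    (neg (id [E, F])) (zero _ _) (zero _ _) (neg (id []))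

/-- The formula for the inverse `ρ̂^{σω} : σω(C 1_n) ⟶ C 1_n`. -/
structure IsRhoHatSigmaOmega (h : n + n' = 0) (φ : σωC k n h ⟶ C k n) : Prop where
  deg_neg_one : HasMatrix (φ.f (-1)) (enumσωC k n h).neg (enumC k n).neg
    (id [E, F]) (zero _ _) (zero _ _) (id [])
  deg_zero : HasMatrix (φ.f 0) (enumσωC k n h).zero (enumC k n).zero
    (zero _ _) (id [E, F]) (id [E, F]) (zero _ _)
  deg_one : HasMatrix (φ.f 1) (enumσωC k n h).one (enumC k n).one
    (neg (id [E, F])) (zero _ _) (zero _ _) (neg (id []))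

/-- The formula for `ρ^σ : C 1_n ⟶ σ(C 1_{n'})`. -/
structure IsRhoSigma (h : n + n' = 0) (φ : C k n ⟶ σC k n h) : Prop where
  deg_neg_one : HasMatrix (φ.f (-1)) (enumC k n).neg (enumσC k n h).neg
    (side E []) (neg (bubbleCup k F E n (-n - 1)))
    (neg (cap E [])) (neg (bubble E n (-n) []))
  deg_zero : HasMatrix (φ.f 0) (enumC k n).zero (enumσC k n h).zero
    (side E []) (zero _ _)
    (zero _ _) (side E [])
  deg_one : HasMatrix (φ.f 1) (enumC k n).one (enumσC k n h).one
    (side E []) (neg (cup F []))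
    (neg (capBubble k E F n (n - 1))) (bubble F n n [])

/-- The formula for the homotopy inverse `ρ̂^σ : σ(C 1_{n'}) ⟶ C 1_n`. -/
structure IsRhoHatSigma (h : n + n' = 0) (φ : σC k n h ⟶ C k n) : Prop where
  deg_neg_one : HasMatrix (φ.f (-1)) (enumσC k n h).neg (enumC k n).neg
    (neg (side F [])) (neg (bubbleCup k E F n (n - 1)))
    (neg (cap F [])) (neg (bubble F n n []))
  deg_zero : HasMatrix (φ.f 0) (enumσC k n h).zero (enumC k n).zero
    (neg (side F [])) (zero _ _)
    (zero _ _) (neg (side F []))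
  deg_one : HasMatrix (φ.f 1) (enumσC k n h).one (enumC k n).one
    (neg (side F [])) (neg (cup E []))
    (neg (capBubble k F E n (-n - 1))) (bubble E n (-n) [])

/-- The formula for the homotopy between `ρ̂^σ ∘ ρ^σ` and the identity of `C 1_n`. -/
structure IsHomotopyC {f g : C k n ⟶ C k n} (H : Homotopy f g) : Prop where
  deg_zero : HasMatrix (H.hom 0 (-1)) (enumC k n).zero (enumC k n).neg
    (neg (capBubbleCup k E F n (n - 2))) (zero _ _)
    (neg (capBubble k E F n (n - 1))) (zero _ _)
  deg_one : HasMatrix (H.hom 1 0) (enumC k n).one (enumC k n).zero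
    (zero _ _) (zero _ _)
    (neg (capBubbleCup k E F n (n - 2))) (bubbleCup k E F n (n - 1))

/-- The formula for the homotopy between `ρ^σ ∘ ρ̂^σ` and the identity of `σ(C 1_{n'})`. -/
structure IsHomotopyσC (h : n + n' = 0) {f g : σC k n h ⟶ σC k n h} (H : Homotopy f g) :
    Prop where
  deg_zero : HasMatrix (H.hom 0 (-1)) (enumσC k n h).zero (enumσC k n h).neg
    (neg (capBubbleCup k F E n (-n - 2))) (zero _ _)
    (neg (capBubble k F E n (-n - 1))) (zero _ _)
  deg_one : HasMatrix (H.hom 1 0) (enumσC k n h).one (enumσC k n h).zero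
    (zero _ _) (zero _ _)
    (neg (capBubbleCup k F E n (-n - 2))) (bubbleCup k F E n (-n - 1))

end

/-! ## The cube of maps -/

section

/-- Chain maps `ρ^ψ`, `ρ^{σω}`, `ρ^σ` and `ρ̂^ψ`, `ρ̂^{σω}`, `ρ̂^σ` for all weights `n`, where
`n' = -n`. -/
structure Maps (k : Type u) [CommRing k] where
  /-- `ρ^ψ` -/
  ρψ (n : ℤ) : C k n ⟶ ψC k n
  /-- `ρ̂^ψ` -/
  ρψ_hat (n : ℤ) : ψC k n ⟶ C k n
  /-- `ρ^{σω}` -/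
  ρσω {n n' : ℤ} (h : n + n' = 0) : C k n ⟶ σωC k n h
  /-- `ρ̂^{σω}` -/
  ρσω_hat {n n' : ℤ} (h : n + n' = 0) : σωC k n h ⟶ C k n
  /-- `ρ^σ` -/
  ρσ {n n' : ℤ} (h : n + n' = 0) : C k n ⟶ σC k n h
  /-- `ρ̂^σ` -/
  ρσ_hat {n n' : ℤ} (h : n + n' = 0) : σC k n h ⟶ C k n

/-- The maps are given by the explicit formulas. -/
structure Maps.IsExplicit {k : Type u} [CommRing k] (r : Maps k) : Prop where
  ρψ (n : ℤ) : IsRhoPsi (r.ρψ n)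
  ρψ_hat (n : ℤ) : IsRhoHatPsi (r.ρψ_hat n)
  ρσω {n n' : ℤ} (h : n + n' = 0) : IsRhoSigmaOmega h (r.ρσω h)
  ρσω_hat {n n' : ℤ} (h : n + n' = 0) : IsRhoHatSigmaOmega h (r.ρσω_hat h)
  ρσ {n n' : ℤ} (h : n + n' = 0) : IsRhoSigma h (r.ρσ h)
  ρσ_hat {n n' : ℤ} (h : n + n' = 0) : IsRhoHatSigma h (r.ρσ_hat h)

/-! The edges of the cube. The equalities between complexes (`σ` is an involution, and the symmetries
commute) appear as `eqToHom`. -/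

namespace Maps

variable {k : Type u} [CommRing k] (r : Maps k) {n n' : ℤ} (h : n + n' = 0)

/-- `σ(ρ^{σω}) : σ(C 1_{n'}) ⟶ σσω(C 1_{n'}) = ω(C 1_{n'})`. -/
def σ_ρσω : σC k n h ⟶ ωC k n h :=
  (sigma k (neg_symm h) (neg_symm h)).map (r.ρσω (neg_symm h)) ≫
    eqToHom (sigma_sigma k h h (ωC k n h))

/-- `σ(ρ̂^{σω}) : ω(C 1_{n'}) = σσω(C 1_{n'}) ⟶ σ(C 1_{n'})`. -/
def σ_ρσω_hat : ωC k n h ⟶ σC k n h :=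
  eqToHom (sigma_sigma k h h (ωC k n h)).symm ≫
    (sigma k (neg_symm h) (neg_symm h)).map (r.ρσω_hat (neg_symm h))

/-- `ρ^ω = σ(ρ^{σω}) ∘ ρ^σ`. -/
def ρω : C k n ⟶ ωC k n h := r.ρσ h ≫ r.σ_ρσω h

/-- `ρ̂^ω = ρ̂^σ ∘ σ(ρ̂^{σω})`. -/
def ρω_hat : ωC k n h ⟶ C k n := r.σ_ρσω_hat h ≫ r.ρσ_hat h

/-- `ω(ρ̂^σ) : σω(C 1_n) = ωσ(C 1_n) ⟶ ω(C 1_{n'})`. -/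
def ω_ρσ_hat : σωC k n h ⟶ ωC k n h :=
  eqToHom (omega_sigma k h h (C k n)).symm ≫
    (omega k (neg_symm h) (neg_symm h)).map (r.ρσ_hat (neg_symm h))

/-- `ω(ρ^ψ) : ω(C 1_{n'}) ⟶ ωψ(C 1_{n'})`. -/
def ω_ρψ : ωC k n h ⟶ ωψC k n h := (omega k (neg_symm h) (neg_symm h)).map (r.ρψ n')

/-- `σ(ρ^ψ) : σ(C 1_{n'}) ⟶ σψ(C 1_{n'})`. -/
def σ_ρψ : σC k n h ⟶ σψC k n h := (sigma k (neg_symm h) (neg_symm h)).map (r.ρψ n')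

/-- `σω(ρ^ψ) : σω(C 1_n) ⟶ σωψ(C 1_n)`. -/
def σω_ρψ : σωC k n h ⟶ σωψC k n h :=
  (sigma k (neg_symm h) (neg_symm h)).map ((omega k h h).map (r.ρψ n))

/-- `ψ(ρ̂^{σω}) : ψ(C 1_n) ⟶ ψσω(C 1_n) = σωψ(C 1_n)`. -/
def ψ_ρσω_hat : ψC k n ⟶ σωψC k n h :=
  (psi k n n).map (r.ρσω_hat h).op ≫
    eqToHom ((psi_sigma k (neg_symm h) (neg_symm h) ((omega k h h).obj (C k n))).trans
      (congrArg (sigma k (neg_symm h) (neg_symm h)).obj (psi_omega k h h (C k n))))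

/-- `ψ(ρ̂^σ) : ψ(C 1_n) ⟶ ψσ(C 1_{n'}) = σψ(C 1_{n'})`. -/
def ψ_ρσ_hat : ψC k n ⟶ σψC k n h :=
  (psi k n n).map (r.ρσ_hat h).op ≫ eqToHom (psi_sigma k (neg_symm h) (neg_symm h) (C k n'))

/-- `ψ(ρ̂^ω) : ψ(C 1_n) ⟶ ψω(C 1_{n'}) = ωψ(C 1_{n'})`. -/
def ψ_ρω_hat : ψC k n ⟶ ωψC k n h :=
  (psi k n n).map (r.ρω_hat h).op ≫ eqToHom (psi_omega k (neg_symm h) (neg_symm h) (C k n'))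

/-- `ψσ(ρ̂^{σω}) : σψ(C 1_{n'}) = ψσ(C 1_{n'}) ⟶ ψσσω(C 1_{n'}) = ωψ(C 1_{n'})`. -/
def ψσ_ρσω_hat : σψC k n h ⟶ ωψC k n h :=
  eqToHom (psi_sigma k (neg_symm h) (neg_symm h) (C k n')).symm ≫
    (psi k n n).map ((sigma k (neg_symm h) (neg_symm h)).map (r.ρσω_hat (neg_symm h))).op ≫
    eqToHom ((congrArg (fun X => (psi k n n).obj (.op X)) (sigma_sigma k h h (ωC k n h))).trans
      (psi_omega k (neg_symm h) (neg_symm h) (C k n')))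

/-- `ψω(ρ^σ) : σωψ(C 1_n) = ψωσ(C 1_n) ⟶ ψω(C 1_{n'}) = ωψ(C 1_{n'})`. -/
def ψω_ρσ : σωψC k n h ⟶ ωψC k n h :=
  eqToHom (((congrArg (fun X => (psi k n n).obj (.op X)) (omega_sigma k h h (C k n))).trans
      (psi_sigma k (neg_symm h) (neg_symm h) ((omega k h h).obj (C k n)))).trans
      (congrArg (sigma k (neg_symm h) (neg_symm h)).obj (psi_omega k h h (C k n)))).symm ≫
    (psi k n n).map ((omega k (neg_symm h) (neg_symm h)).map (r.ρσ (neg_symm h))).op ≫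
    eqToHom (psi_omega k (neg_symm h) (neg_symm h) (C k n'))

end Maps

/-- `f` is a homotopy equivalence. -/
def IsHomotopyEquiv {k : Type u} [CommRing k] {n m : ℤ} {X Y : Kom k n m} (f : X ⟶ Y) : Prop :=
  ∃ e : HomotopyEquiv X Y, e.hom = f

end

end

end CatSL2

namespace CatSL2

open Strand

namespace TwoHom

variable {k : Type u} [CommRing k] {n : ℤ}

local infixr:80 " ⊚ " => TwoHom.comp

/-! ### Sliding dots through a sideways crossing -/

/-! Each nonzero term of the complexes is a sum of two 1-morphisms, so differentials, chain maps and
homotopies are two by two matrices of 2-morphisms, and every claim is an identity between products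
of such matrices. The maps for `ψ` and `σω` have entries 0 and ±1. The substance is in `ϱ^σ`.

Products are written in diagrammatic order. For the letter `E` let `T`, `S`, `P` be the sums of
bubbles with a dotted cup (total index n - 1), with a dotted cap (n - 1) and with both (n - 2), and
let `c` be the bubble `c̄_n`. For the letter `F` the orientations are exchanged and n becomes -n. If
the crossing back from `FE` to `EF` is taken with a minus sign (`signedSide`), the relations become
symmetric in the two letters. The maps `ϱ^σ` and `ϱ̂^σ` are then the same three matrices read for
`E` and for `F`, and each computation is done once for a letter s and used twice.

Four facts carry the computation. (1) Sliding a dot through a sideways crossing costs a cap followed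
by a cup. This is the rotated nilHecke relation. (2) Closing a sideways crossing by a cup or a cap
gives a curl, that is, up to sign, a dotted sum of index one higher than `T` or `S`. (3) A dot added
to such a sum raises its index by one, up to the summand without dots. For the double sum this works
at the cup and at the cap, so that `ε T + x P = S η + P x`, and both sides are the correction term
in the decomposition of the identity. (4) A real bubble with too few dots has negative degree and
vanishes. Hence `η P`, `P ε`, `T X` and `X S` are zero (in the last product `S` is that of the
flipped letter). Of the three terms in `CasimirData.Outer.T_ε` exactly one survives, according to
the sign of n, and it is the identity.

These facts are packaged in `CasimirData.Inner` and `CasimirData.Outer`. From them the chain map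
equations (`d₀_rhoZero`, `d₁_rhoOne`) and the homotopy equations in the degrees -1, 0, 1
(`rhoNeg_rhoNeg`, `rhoZero_rhoZero`, `rhoOne_rhoOne`) follow entry by entry.

For the cube, `ω` exchanges the data of the two letters without signs, while `ψ` transposes,
exchanges `T` with `S`, and sends the signed crossing back to `-X`. The matrices of all edges can
then be written down. The triangles commute because the identity, the swap of two copies and -1
commute with the matrices of `ϱ^σ`. The squares anticommute because of that sign in `ψ`, or because
the matrix of `ϱ^ψ` in degree 0 is a quarter turn, which anticommutes with the swap.

Finally `σ(C 1_{-n})` has the words, shifts and differentials of `C' 1_n`, so the last claim is the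
equivalence `ϱ^σ` again. -/

theorem dot_cross (s : Strand) (R : Word) :
    (dot s (s :: R) ⊚ cross s R : TwoHom k n _ _) =
      cross s R ⊚ strand s (dot s R) + (s.sgn : k) • id (s :: s :: R) := by
  have h := sound (n := n) (Diag.Rel.dot_slide (k := k) s R)
  simp only [mk_add, mk_smul, mk_comp, mk_strand, mk_dot, mk_cross, mk_id] at h
  rw [← h, neg_one_smul]
  abel

theorem cross_dot (s : Strand) (R : Word) :
    (cross s R ⊚ dot s (s :: R) : TwoHom k n _ _) =
      strand s (dot s R) ⊚ cross s R + (s.sgn : k) • id (s :: s :: R) := by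
  have h := sound (n := n) (Diag.Rel.dot_slide' (k := k) s R)
  simp only [mk_add, mk_smul, mk_comp, mk_strand, mk_dot, mk_cross, mk_id] at h
  rw [← h, neg_one_smul]
  abel

theorem mk_side_E (R : Word) : (mk (Diag.side E R) : TwoHom k n _ _) =
    cup F (E :: F :: R) ⊚ strand F (cross E (F :: R)) ⊚ strand F (strand E (cap E R)) := rfl

theorem mk_side_F (R : Word) : (mk (Diag.side F R) : TwoHom k n _ _) =
    cup E (F :: E :: R) ⊚ strand E (cross F (E :: R)) ⊚ strand E (strand F (cap F R)) := rfl

/-- The strand `E` runs from the lower left to the upper right, and its dot passes the upward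
crossing by `cross_dot`. The identity term of that relation becomes a cap followed by a cup after
rotation. -/
theorem side_E_dot_right (R : Word) :
    (mk (Diag.side E R) ⊚ strand F (dot E R) : TwoHom k n _ _) =
      dot E (F :: R) ⊚ mk (Diag.side E R) + cap E R ⊚ cup F R := by
  rw [mk_side_E, assoc, assoc, ← strand_comp F, ← dot_nat E, strand_comp F,
    ← assoc (strand F (cross _ _)),
    ← strand_comp F, cross_dot E]
  simp only [strand_comp, map_add, LinearMap.add_apply, sgn_E, Int.cast_one, one_smul, strand_id,
    id_comp, assoc]
  rw [assoc_left (cup_nat_F _), cup_nat_F]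

/-- The dot travels along the whole `F`-strand: round the cup to the lower left of the upward
crossing, through it by `dot_cross`, and round the cap to the bottom. The correction term is the
same as for the other strand, which is why one entry of `ϱ^σ` serves both dots. -/
theorem side_E_dot_left (R : Word) :
    (mk (Diag.side E R) ⊚ dot F (E :: R) : TwoHom k n _ _) =
      strand E (dot F R) ⊚ mk (Diag.side E R) + cap E R ⊚ cup F R := by
  rw [mk_side_E, assoc, assoc, ← dot_nat F, assoc_left (dot_nat F _).symm, ← assoc (cup F _),
    ← cup_dot_F, assoc, ← assoc (strand F (dot _ _)), ← strand_comp F, dot_cross E]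
  simp only [strand_comp, map_add, LinearMap.add_apply, sgn_E, Int.cast_one, one_smul, strand_id,
    id_comp, assoc]
  rw [← assoc_left (cup_nat_F _), ← strand_comp F (strand E (dot _ _)), ← strand_comp E, ← cap_dot_E,
    strand_comp E, strand_comp F,
    ← assoc (strand F (cross _ _)), ← strand_comp F, cross_nat E, strand_comp F, assoc]
  exact congrArg (_ + ·) (cup_nat_F _)

/-- For downward strands the nilHecke relation carries the sign -1, so here the correction is
subtracted. `signedSide` removes this asymmetry. -/
theorem side_F_dot_right (R : Word) :
    (mk (Diag.side F R) ⊚ strand E (dot F R) : TwoHom k n _ _) =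
      dot F (E :: R) ⊚ mk (Diag.side F R) - cap F R ⊚ cup E R := by
  rw [mk_side_F, assoc, assoc, ← strand_comp E, ← dot_nat F, strand_comp E,
    ← assoc (strand E (cross _ _)),
    ← strand_comp E, cross_dot F]
  simp only [strand_comp, sgn_F, Int.cast_neg, Int.cast_one, neg_smul, one_smul, strand_id, id_comp,
    assoc, ← sub_eq_add_neg, map_sub, LinearMap.sub_apply]
  rw [assoc_left (cup_nat_E _), cup_nat_E]

theorem side_F_dot_left (R : Word) :
    (mk (Diag.side F R) ⊚ dot E (F :: R) : TwoHom k n _ _) =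
      strand F (dot E R) ⊚ mk (Diag.side F R) - cap F R ⊚ cup E R := by
  rw [mk_side_F, assoc, assoc, ← dot_nat E, assoc_left (dot_nat E _).symm, ← assoc (cup E _),
    ← cup_dot_E, assoc, ← assoc (strand E (dot _ _)), ← strand_comp E, dot_cross F]
  simp only [strand_comp, sgn_F, Int.cast_neg, Int.cast_one, neg_smul, one_smul, strand_id, id_comp,
    assoc, ← sub_eq_add_neg, map_sub, LinearMap.sub_apply]
  rw [← assoc_left (cup_nat_E _), ← strand_comp E (strand F (dot _ _)), ← strand_comp F, ← cap_dot_F,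
    strand_comp F, strand_comp E,
    ← assoc (strand E (cross _ _)), ← strand_comp E, cross_nat F, strand_comp E, assoc]
  exact congrArg (_ - ·) (cup_nat_E _)

/-! ### Sums of cups and caps with dots and bubbles -/

theorem mk_dotCup (s : Strand) (R : Word) (m : ℕ) :
    (mk (Diag.dotCup s R m) : TwoHom k n _ _) = cup s R ⊚ dots s (s.flip :: R) m := rfl

theorem mk_dotCap (s : Strand) (R : Word) (m : ℕ) :
    (mk (Diag.dotCap s R m) : TwoHom k n _ _) = dots s (s.flip :: R) m ⊚ cap s R := rfl

theorem mk_dotCup_zero (s : Strand) (R : Word) :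
    (mk (Diag.dotCup s R 0) : TwoHom k n _ _) = cup s R := by
  rw [mk_dotCup, dots_zero, comp_id]

theorem mk_dotCap_zero (s : Strand) (R : Word) :
    (mk (Diag.dotCap s R 0) : TwoHom k n _ _) = cap s R := by
  rw [mk_dotCap, dots_zero, id_comp]

theorem mk_dotCup_succ (s : Strand) (R : Word) (m : ℕ) :
    (mk (Diag.dotCup s R (m + 1)) : TwoHom k n _ _) =
      mk (Diag.dotCup s R m) ⊚ dot s (s.flip :: R) := by
  rw [mk_dotCup, mk_dotCup, dots_succ, assoc]

theorem mk_dotCap_succ (s : Strand) (R : Word) (m : ℕ) :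
    (mk (Diag.dotCap s R (m + 1)) : TwoHom k n _ _) =
      dot s (s.flip :: R) ⊚ mk (Diag.dotCap s R m) := by
  rw [mk_dotCap, mk_dotCap, dots_succ', assoc]

theorem mk_bubbleCup (s s' : Strand) (p N : ℤ) :
    (mk (Diag.bubbleCup k s s' p N) : TwoHom k n _ _) =
      ∑ i ∈ Finset.range (N + 1).toNat,
        mk (Diag.bubble s' p (N.toNat - i : ℕ) []) ⊚ mk (Diag.dotCup s [] i) := mk_sum₂ _ _

theorem mk_capBubble (s s' : Strand) (p N : ℤ) :
    (mk (Diag.capBubble k s s' p N) : TwoHom k n _ _) =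
      ∑ i ∈ Finset.range (N + 1).toNat,
        mk (Diag.dotCap s [] i) ⊚ mk (Diag.bubble s' p (N.toNat - i : ℕ) []) := mk_sum₂ _ _

theorem mk_capBubbleCup (s s' : Strand) (p N : ℤ) :
    (mk (Diag.capBubbleCup k s s' p N) : TwoHom k n _ _) =
      ∑ i ∈ Finset.range (N + 1).toNat, ∑ j ∈ Finset.range (N.toNat - i + 1),
        mk (Diag.dotCap s [] (N.toNat - i - j)) ⊚ mk (Diag.bubble s' p i []) ⊚
          mk (Diag.dotCup s [] j) := Diag.mk_decompSum s s' N p []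

theorem mk_bubbleCup_of_neg (s s' : Strand) (p : ℤ) {N : ℤ} (h : N < 0) :
    (mk (Diag.bubbleCup k s s' p N) : TwoHom k n _ _) = 0 := by
  rw [mk_bubbleCup, Int.toNat_of_nonpos (by omega)]; rfl

theorem mk_capBubble_of_neg (s s' : Strand) (p : ℤ) {N : ℤ} (h : N < 0) :
    (mk (Diag.capBubble k s s' p N) : TwoHom k n _ _) = 0 := by
  rw [mk_capBubble, Int.toNat_of_nonpos (by omega)]; rfl

theorem mk_capBubbleCup_of_neg (s s' : Strand) (p : ℤ) {N : ℤ} (h : N < 0) :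
    (mk (Diag.capBubbleCup k s s' p N) : TwoHom k n _ _) = 0 := by
  rw [mk_capBubbleCup, Int.toNat_of_nonpos (by omega)]; rfl

theorem mk_bubble_of_neg (s : Strand) (p : ℤ) {N : ℤ} (h : N < 0) (R : Word) :
    (mk (Diag.bubble s p N R) : TwoHom k n _ _) = 0 := by
  rw [Diag.bubble, if_pos h, mk_zero]

/-- An extra dot on the cup accounts for all summands of the next sum except the one without dots.
No lower bound on `N` is required: for `N = -1` the first sum is empty and the bubble term is the
whole right side, and below that every term vanishes. -/
theorem mk_bubbleCup_dot (s s' : Strand) (p N : ℤ) :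
    (mk (Diag.bubbleCup k s s' p N) ⊚ dot s [s.flip] + mk (Diag.bubble s' p (N + 1) []) ⊚ cup s [] :
      TwoHom k n _ _) = mk (Diag.bubbleCup k s s' p (N + 1)) := by
  rcases lt_or_ge (N + 1) 0 with h | h
  · rw [mk_bubbleCup_of_neg _ _ _ h, mk_bubbleCup_of_neg _ _ _ (by omega), mk_bubble_of_neg _ _ h]
    simp
  · obtain ⟨M, hM⟩ := Int.eq_ofNat_of_zero_le h
    obtain rfl : N = M - 1 := by omega
    rw [mk_bubbleCup, mk_bubbleCup]
    simp only [sub_add_cancel, Int.toNat_natCast, Int.toNat_natCast_add_one, map_sum,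
      LinearMap.sum_apply]
    rw [Finset.sum_range_succ', Nat.sub_zero, mk_dotCup_zero]
    congr 1
    refine Finset.sum_congr rfl fun i _ => ?_
    rw [mk_dotCup_succ, assoc, show ((M : ℤ) - 1).toNat - i = M - (i + 1) by omega]

theorem dot_mk_capBubble (s s' : Strand) (p N : ℤ) :
    (dot s [s.flip] ⊚ mk (Diag.capBubble k s s' p N) + cap s [] ⊚ mk (Diag.bubble s' p (N + 1) []) :
      TwoHom k n _ _) = mk (Diag.capBubble k s s' p (N + 1)) := by
  rcases lt_or_ge (N + 1) 0 with h | h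
  · rw [mk_capBubble_of_neg _ _ _ h, mk_capBubble_of_neg _ _ _ (by omega), mk_bubble_of_neg _ _ h]
    simp
  · obtain ⟨M, hM⟩ := Int.eq_ofNat_of_zero_le h
    obtain rfl : N = M - 1 := by omega
    rw [mk_capBubble, mk_capBubble]
    simp only [sub_add_cancel, Int.toNat_natCast, Int.toNat_natCast_add_one, map_sum]
    rw [Finset.sum_range_succ', Nat.sub_zero, mk_dotCap_zero]
    congr 1
    refine Finset.sum_congr rfl fun i _ => ?_
    rw [mk_dotCap_succ, assoc, show ((M : ℤ) - 1).toNat - i = M - (i + 1) by omega]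

/-- The single sums are indexed by the number of dots, the double sum `mk_capBubbleCup` by the
degree of the bubble. Reversing the index makes their summands match. -/
theorem _root_.Finset.sum_range_succ_reflect {A : Type*} [AddCommMonoid A] (f : ℕ → A) (M : ℕ) :
    ∑ i ∈ Finset.range (M + 1), f i = ∑ i ∈ Finset.range M, f (M - i) + f 0 := by
  rw [← Finset.sum_range_reflect, Finset.sum_range_succ]
  simp

/-- The summands without dots on the cup form the single sum, and in all others a dot of the cup can
be split off. `dot_mk_capBubbleCup` does the same at the cap. Comparing the two gives the commutator
of the double sum with a dot, which is the key relation `CasimirData.Inner.decomp`. -/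
theorem mk_capBubbleCup_dot (s s' : Strand) (p N : ℤ) :
    (mk (Diag.capBubble k s s' p (N + 1)) ⊚ cup s [] +
      mk (Diag.capBubbleCup k s s' p N) ⊚ dot s [s.flip] : TwoHom k n _ _) =
      mk (Diag.capBubbleCup k s s' p (N + 1)) := by
  rcases lt_or_ge (N + 1) 0 with h | h
  · rw [mk_capBubble_of_neg _ _ _ h, mk_capBubbleCup_of_neg _ _ _ h,
      mk_capBubbleCup_of_neg _ _ _ (by omega)]
    simp
  · obtain ⟨M, hM⟩ := Int.eq_ofNat_of_zero_le h
    obtain rfl : N = M - 1 := by omega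
    rw [mk_capBubbleCup, mk_capBubbleCup, mk_capBubble]
    simp only [sub_add_cancel, Int.toNat_natCast, Int.toNat_natCast_add_one, map_sum,
      LinearMap.sum_apply]
    refine (congrArg (· + _) (Finset.sum_range_succ_reflect _ M)).trans ?_
    -- The last outer summand on the right (all of the index in the bubble, no dots) is matched with
    -- the term split off by the reflection. The remaining summands are compared for each degree of
    -- the bubble.
    rw [Finset.sum_range_succ _ M, add_right_comm, ← Finset.sum_add_distrib]
    refine congrArg₂ _ (Finset.sum_congr rfl fun i hi => ?_) ?_
    · have hi := Finset.mem_range.1 hi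
      rw [show ((M : ℤ) - 1).toNat - i + 1 = M - i by omega, Finset.sum_range_succ', add_comm,
        mk_dotCup_zero, show M - (M - i) = i by omega,
        Nat.sub_zero, assoc]
      congr 1
      refine Finset.sum_congr rfl fun j _ => ?_
      rw [mk_dotCup_succ, assoc, assoc,
        show ((M : ℤ) - 1).toNat - i - j = M - i - (j + 1) by omega]
    · simp [mk_dotCup_zero, assoc]

theorem dot_mk_capBubbleCup (s s' : Strand) (p N : ℤ) :
    (cap s [] ⊚ mk (Diag.bubbleCup k s s' p (N + 1)) +
      dot s [s.flip] ⊚ mk (Diag.capBubbleCup k s s' p N) : TwoHom k n _ _) =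
      mk (Diag.capBubbleCup k s s' p (N + 1)) := by
  rcases lt_or_ge (N + 1) 0 with h | h
  · rw [mk_bubbleCup_of_neg _ _ _ h, mk_capBubbleCup_of_neg _ _ _ h,
      mk_capBubbleCup_of_neg _ _ _ (by omega)]
    simp
  · obtain ⟨M, hM⟩ := Int.eq_ofNat_of_zero_le h
    obtain rfl : N = M - 1 := by omega
    rw [mk_capBubbleCup, mk_capBubbleCup, mk_bubbleCup]
    simp only [sub_add_cancel, Int.toNat_natCast, Int.toNat_natCast_add_one, map_sum]
    refine (congrArg (· + _) (Finset.sum_range_succ_reflect _ M)).trans ?_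
    rw [Finset.sum_range_succ _ M, add_right_comm, ← Finset.sum_add_distrib]
    refine congrArg₂ _ (Finset.sum_congr rfl fun i hi => ?_) ?_
    · have hi := Finset.mem_range.1 hi
      rw [show ((M : ℤ) - 1).toNat - i + 1 = M - i by omega, Finset.sum_range_succ, add_comm,
        Nat.sub_self, mk_dotCap_zero,
        show M - (M - i) = i by omega]
      congr 1
      refine Finset.sum_congr rfl fun j hj => ?_
      have hj := Finset.mem_range.1 hj
      rw [show M - i - j = ((M : ℤ) - 1).toNat - i - j + 1 by omega, mk_dotCap_succ, assoc]
    · simp [mk_dotCap_zero]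

/-! ### Curls -/

/-- The cup plugged into the sideways crossing makes a right curl on the upward strand of the cup
`F`. The curl relation leaves dots on that right strand, and `cup_dots_F` carries them to the left
one. -/
theorem cup_side_E : (cup E [] ⊚ mk (Diag.side E []) : TwoHom k n _ _) =
    -mk (Diag.bubbleCup k F E n (-n)) := by
  have h : (strand E (cup E []) ⊚ cross E [F] ⊚ strand E (cap E []) : TwoHom k n _ _) = _ :=
    sound (.right_curl E [])
  rw [mk_side_E, ← assoc_left (cup_nat_F _), ← assoc (strand F _), ← strand_comp, ← strand_comp,
    assoc, h, mk_smul, mk_sum₂, mk_bubbleCup, map_smul, map_smul, map_sum, map_sum]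
  simp only [sgn_E, Int.cast_one, one_mul, wt_nil, neg_smul, one_smul]
  refine congrArg _ (Finset.sum_congr rfl fun i _ => ?_)
  rw [mk_comp, strand_comp, mk_strand, assoc_left (cup_nat_F _)]
  exact congrArg _ (cup_dots_F [] i)

theorem cup_side_F : (cup F [] ⊚ mk (Diag.side F []) : TwoHom k n _ _) =
    mk (Diag.bubbleCup k E F n n) := by
  have h : (strand F (cup F []) ⊚ cross F [E] ⊚ strand F (cap F []) : TwoHom k n _ _) = _ :=
    sound (.right_curl F [])
  rw [mk_side_F, ← assoc_left (cup_nat_E _), ← assoc (strand E _), ← strand_comp, ← strand_comp,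
    assoc, h, mk_smul, mk_sum₂, mk_bubbleCup, map_smul, map_smul, map_sum, map_sum]
  simp only [sgn_F, Int.cast_neg, Int.cast_one, neg_mul, one_mul, wt_nil, neg_neg, one_smul]
  refine (Finset.sum_congr rfl fun i _ => ?_)
  rw [mk_comp, strand_comp, mk_strand, assoc_left (cup_nat_E _)]
  exact congrArg _ (cup_dots_E [] i)

/-- Closing with the cap makes a left curl on the upward strand. Its bubbles lie to the left of
`EF`, where the weight is n again, and `bubble_nat` moves them past the cap. -/
theorem side_E_cap : (mk (Diag.side E []) ⊚ cap F [] : TwoHom k n _ _) =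
    mk (Diag.capBubble k E F n n) := by
  have h : (cup F [E, F] ⊚ strand F (cross E [F]) ⊚ cap F [E, F] : TwoHom k n _ _) = _ :=
    sound (.left_curl E [F])
  rw [mk_side_E, assoc, assoc, ← cap_nat_F, ← assoc (strand F _), ← assoc (cup F _), h, mk_smul,
    mk_sum₂, mk_capBubble]
  simp only [wt_cons, wt_nil, sgn_E, sgn_F, one_mul, Int.cast_one, one_smul, map_sum,
    LinearMap.sum_apply, mk_comp, assoc, bubble_nat]
  rw [show n + 2 * -1 + 2 * 1 = n by ring]
  exact Finset.sum_congr rfl fun i _ => (assoc _ _ _).symm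

theorem side_F_cap : (mk (Diag.side F []) ⊚ cap E [] : TwoHom k n _ _) =
    -mk (Diag.capBubble k F E n (-n)) := by
  have h : (cup E [F, E] ⊚ strand E (cross F [E]) ⊚ cap E [F, E] : TwoHom k n _ _) = _ :=
    sound (.left_curl F [E])
  rw [mk_side_F, assoc, assoc, ← cap_nat_E, ← assoc (strand E _), ← assoc (cup E _), h, mk_smul,
    mk_sum₂, mk_capBubble]
  simp only [wt_cons, wt_nil, sgn_E, sgn_F, neg_mul, one_mul, Int.cast_neg, Int.cast_one, neg_smul,
    one_smul, map_sum, map_neg, LinearMap.neg_apply, LinearMap.sum_apply, mk_comp, assoc,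
    bubble_nat]
  rw [show n + 2 * 1 + 2 * -1 = n by ring]
  exact congrArg _ (Finset.sum_congr rfl fun i _ => (assoc _ _ _).symm)

end TwoHom

end CatSL2

namespace CatSL2

open Strand

namespace TwoHom

variable {k : Type u} [CommRing k] {n : ℤ}

local infixr:80 " ⊚ " => TwoHom.comp

/-! ### Dots on the right strand of a cup or cap -/

theorem mk_dotCup_dot_right (s : Strand) (m : ℕ) :
    (mk (Diag.dotCup s [] m) ⊚ strand s (dot s.flip []) : TwoHom k n _ _) =
      mk (Diag.dotCup s [] m) ⊚ dot s [s.flip] := by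
  rw [mk_dotCup, assoc, dots_nat, assoc, ← dots_succ, dots_succ', ← assoc, ← assoc]
  cases s
  · exact congrArg (· ⊚ dots E [F] m) (cup_dot_E [])
  · exact congrArg (· ⊚ dots F [E] m) (cup_dot_F [])

theorem dot_right_mk_dotCap (s : Strand) (m : ℕ) :
    (strand s (dot s.flip []) ⊚ mk (Diag.dotCap s [] m) : TwoHom k n _ _) =
      dot s [s.flip] ⊚ mk (Diag.dotCap s [] m) := by
  rw [mk_dotCap, ← assoc, ← dots_nat, assoc, ← assoc (dot _ _), ← dots_succ', dots_succ, assoc]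
  cases s
  · exact congrArg (dots E [F] m ⊚ ·) (cap_dot_E [])
  · exact congrArg (dots F [E] m ⊚ ·) (cap_dot_F [])

/-- Cups, caps and their dots are organised by position (left or right strand), the differentials by
orientation. This dictionary allows arguments uniform in the letter. -/
theorem dots_eq (s : Strand) :
    ((mk (dotE k s) : TwoHom k n _ _) = dot s [s.flip] ∧
      (mk (dotF k s) : TwoHom k n _ _) = strand s (dot s.flip [])) ∨
    ((mk (dotF k s) : TwoHom k n _ _) = dot s [s.flip] ∧
      (mk (dotE k s) : TwoHom k n _ _) = strand s (dot s.flip [])) := by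
  cases s
  · exact .inl ⟨rfl, rfl⟩
  · exact .inr ⟨rfl, rfl⟩

theorem mk_dotCup_dotE (s : Strand) (m : ℕ) :
    (mk (Diag.dotCup s [] m) ⊚ mk (dotE k s) : TwoHom k n _ _) =
      mk (Diag.dotCup s [] m) ⊚ dot s [s.flip] := by
  rcases dots_eq (k := k) (n := n) s with ⟨h, -⟩ | ⟨-, h⟩ <;> rw [h]
  exact mk_dotCup_dot_right s m

theorem mk_dotCup_dotF (s : Strand) (m : ℕ) :
    (mk (Diag.dotCup s [] m) ⊚ mk (dotF k s) : TwoHom k n _ _) =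
      mk (Diag.dotCup s [] m) ⊚ dot s [s.flip] := by
  rcases dots_eq (k := k) (n := n) s with ⟨-, h⟩ | ⟨h, -⟩ <;> rw [h]
  exact mk_dotCup_dot_right s m

theorem dotE_mk_dotCap (s : Strand) (m : ℕ) :
    (mk (dotE k s) ⊚ mk (Diag.dotCap s [] m) : TwoHom k n _ _) =
      dot s [s.flip] ⊚ mk (Diag.dotCap s [] m) := by
  rcases dots_eq (k := k) (n := n) s with ⟨h, -⟩ | ⟨-, h⟩ <;> rw [h]
  exact dot_right_mk_dotCap s m

theorem dotF_mk_dotCap (s : Strand) (m : ℕ) :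
    (mk (dotF k s) ⊚ mk (Diag.dotCap s [] m) : TwoHom k n _ _) =
      dot s [s.flip] ⊚ mk (Diag.dotCap s [] m) := by
  rcases dots_eq (k := k) (n := n) s with ⟨-, h⟩ | ⟨h, -⟩ <;> rw [h]
  exact dot_right_mk_dotCap s m

/-- Every summand ends in a dotted cup. This lemma and its three variants are applied to the dots on
the two strands, which cannot be distinguished next to a dotted cup or cap. -/
theorem mk_bubbleCup_congr (s s' : Strand) (p N : ℤ) {a : Word} {x y : TwoHom k n [s, s.flip] a}
    (h : ∀ m, mk (Diag.dotCup s [] m) ⊚ x = mk (Diag.dotCup s [] m) ⊚ y) :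
    mk (Diag.bubbleCup k s s' p N) ⊚ x = mk (Diag.bubbleCup k s s' p N) ⊚ y := by
  simp only [mk_bubbleCup, map_sum, LinearMap.sum_apply, assoc, h]

theorem mk_capBubble_congr (s s' : Strand) (p N : ℤ) {a : Word} {x y : TwoHom k n a [s, s.flip]}
    (h : ∀ m, x ⊚ mk (Diag.dotCap s [] m) = y ⊚ mk (Diag.dotCap s [] m)) :
    x ⊚ mk (Diag.capBubble k s s' p N) = y ⊚ mk (Diag.capBubble k s s' p N) := by
  simp only [mk_capBubble, map_sum, ← assoc, h]

theorem mk_capBubbleCup_congr_right (s s' : Strand) (p N : ℤ) {a : Word}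
    {x y : TwoHom k n [s, s.flip] a}
    (h : ∀ m, mk (Diag.dotCup s [] m) ⊚ x = mk (Diag.dotCup s [] m) ⊚ y) :
    mk (Diag.capBubbleCup k s s' p N) ⊚ x = mk (Diag.capBubbleCup k s s' p N) ⊚ y := by
  simp only [mk_capBubbleCup, map_sum, LinearMap.sum_apply, assoc, h]

theorem mk_capBubbleCup_congr_left (s s' : Strand) (p N : ℤ) {a : Word}
    {x y : TwoHom k n a [s, s.flip]}
    (h : ∀ m, x ⊚ mk (Diag.dotCap s [] m) = y ⊚ mk (Diag.dotCap s [] m)) :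
    x ⊚ mk (Diag.capBubbleCup k s s' p N) = y ⊚ mk (Diag.capBubbleCup k s s' p N) := by
  simp only [mk_capBubbleCup, map_sum, ← assoc, h]

/-! ### Bubbles of small degree -/

theorem cup_mk_dotCap (s : Strand) (m : ℕ) :
    (cup s [] ⊚ mk (Diag.dotCap s [] m) : TwoHom k n _ _) = mk (Diag.realBubble s m []) := rfl

theorem mk_dotCup_cap (s : Strand) (m : ℕ) :
    (mk (Diag.dotCup s [] m) ⊚ cap s [] : TwoHom k n _ _) = mk (Diag.realBubble s m []) := by
  rw [mk_dotCup, assoc]; rfl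

theorem mk_realBubble_eq_zero {s : Strand} {m : ℕ} (h : (m : ℤ) < s.sgn * n - 1) :
    (mk (Diag.realBubble s m []) : TwoHom k n _ _) = 0 := sound (.bubble_neg s m [] h)

theorem mk_realBubble_eq_id {s : Strand} {m : ℕ} (h : (m : ℤ) = s.sgn * n - 1) :
    (mk (Diag.realBubble s m []) : TwoHom k n _ _) = id [] := sound (.bubble_zero s m [] h)

/-- Under this inequality the bubble of degree zero would carry a negative number of dots. It is
therefore fake, and the recursion for fake bubbles starts with the identity. -/
theorem mk_bubble_zero {s : Strand} {p : ℤ} (h : s.sgn * p < 1) :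
    (mk (Diag.bubble s p 0 []) : TwoHom k n _ _) = id [] := by
  rw [Diag.bubble, if_neg (lt_irrefl 0), if_neg (by unfold Diag.spade; omega), Int.toNat_zero,
    Diag.fakeBubble, mk_id]

/-- In each summand the cup closes the dotted cap to a real bubble with at most `N` dots, hence of
negative degree. -/
theorem cup_mk_capBubbleCup (s s' : Strand) (p N : ℤ) (h : N < s.sgn * n - 1) :
    (cup s [] ⊚ mk (Diag.capBubbleCup k s s' p N) : TwoHom k n _ _) = 0 := by
  simp only [mk_capBubbleCup, map_sum]
  refine Finset.sum_eq_zero fun i hi => Finset.sum_eq_zero fun j _ => ?_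
  have hi := Finset.mem_range.1 hi
  rw [← assoc, cup_mk_dotCap, mk_realBubble_eq_zero (by omega), map_zero, LinearMap.zero_apply]

theorem mk_capBubbleCup_cap (s s' : Strand) (p N : ℤ) (h : N < s.sgn * n - 1) :
    (mk (Diag.capBubbleCup k s s' p N) ⊚ cap s [] : TwoHom k n _ _) = 0 := by
  simp only [mk_capBubbleCup, map_sum, LinearMap.sum_apply]
  refine Finset.sum_eq_zero fun i hi => Finset.sum_eq_zero fun j hj => ?_
  have hi := Finset.mem_range.1 hi
  have hj := Finset.mem_range.1 hj
  rw [assoc, assoc, mk_dotCup_cap, mk_realBubble_eq_zero (by omega), map_zero, map_zero]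

/-- The cup closes the caps to real bubbles, all of negative degree except the one with the most
dots, which has degree zero. In that summand the other bubble also has degree zero, so both factors
are the identity. -/
theorem cup_mk_capBubble (s : Strand) (h : 1 ≤ s.sgn * n) :
    (cup s [] ⊚ mk (Diag.capBubble k s s.flip n (s.sgn * n - 1)) : TwoHom k n _ _) = id [] := by
  rw [mk_capBubble, map_sum, show (s.sgn * n - 1 + 1).toNat = (s.sgn * n - 1).toNat + 1 by omega,
    Finset.sum_range_succ, Finset.sum_eq_zero, zero_add, ← assoc, cup_mk_dotCap,
    mk_realBubble_eq_id (by omega), id_comp, Nat.sub_self, Nat.cast_zero,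
    mk_bubble_zero (by rw [sgn_flip]; linarith)]
  intro i hi
  have hi := Finset.mem_range.1 hi
  rw [← assoc, cup_mk_dotCap, mk_realBubble_eq_zero (by omega), map_zero, LinearMap.zero_apply]

theorem mk_bubbleCup_cap (s : Strand) (h : 1 ≤ s.sgn * n) :
    (mk (Diag.bubbleCup k s s.flip n (s.sgn * n - 1)) ⊚ cap s [] : TwoHom k n _ _) = id [] := by
  rw [mk_bubbleCup, map_sum, LinearMap.sum_apply,
    show (s.sgn * n - 1 + 1).toNat = (s.sgn * n - 1).toNat + 1 by omega,
    Finset.sum_range_succ, Finset.sum_eq_zero, zero_add, assoc, mk_dotCup_cap,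
    mk_realBubble_eq_id (by omega), comp_id, Nat.sub_self, Nat.cast_zero,
    mk_bubble_zero (by rw [sgn_flip]; linarith)]
  intro i hi
  have hi := Finset.mem_range.1 hi
  rw [assoc, mk_dotCup_cap, mk_realBubble_eq_zero (by omega), map_zero]

/-- A dot of the cap is slid back through `A`. The correction term closes the remaining dotted cap
to a bubble with one dot fewer than `t.sgn * n - 1` allows, so it has negative degree. The morphism
`A` stands for a signed sideways crossing. -/
theorem comp_mk_dotCap_eq_zero {a : Word} {t : Strand} {A : TwoHom k n a [t, t.flip]}
    {x : TwoHom k n a a} {e : TwoHom k n a []} (hA : A ⊚ dot t [t.flip] = x ⊚ A + e ⊚ cup t [])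
    (h0 : A ⊚ cap t [] = 0) (m : ℕ) (hm : (m : ℤ) < t.sgn * n) :
    A ⊚ mk (Diag.dotCap t [] m) = 0 := by
  induction m with
  | zero => rw [mk_dotCap_zero, h0]
  | succ m ih =>
    rw [mk_dotCap_succ, ← assoc, hA, map_add, LinearMap.add_apply, assoc, ih (by omega), map_zero,
      zero_add, assoc, cup_mk_dotCap, mk_realBubble_eq_zero (by omega), map_zero]

theorem mk_dotCup_comp_eq_zero {a : Word} {t : Strand} {A : TwoHom k n [t, t.flip] a}
    {x : TwoHom k n a a} {e : TwoHom k n [] a} (hA : dot t [t.flip] ⊚ A = A ⊚ x - cap t [] ⊚ e)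
    (h0 : cup t [] ⊚ A = 0) (m : ℕ) (hm : (m : ℤ) < t.sgn * n) :
    mk (Diag.dotCup t [] m) ⊚ A = 0 := by
  induction m with
  | zero => rw [mk_dotCup_zero, h0]
  | succ m ih =>
    rw [mk_dotCup_succ, assoc, hA, map_sub, ← assoc, ih (by omega), map_zero,
      LinearMap.zero_apply, ← assoc, mk_dotCup_cap, mk_realBubble_eq_zero (by omega), map_zero,
      LinearMap.zero_apply, sub_zero]

/-- The vanishing on the undotted cap is required only if the sum is nonempty. For the sideways
crossing this is the range in which the curl relation provides it. -/
theorem comp_mk_capBubble_eq_zero {a : Word} {t : Strand} {A : TwoHom k n a [t, t.flip]}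
    {x : TwoHom k n a a} {e : TwoHom k n a []} (hA : A ⊚ dot t [t.flip] = x ⊚ A + e ⊚ cup t [])
    (s' : Strand) (p : ℤ) {N : ℤ} (hN : N < t.sgn * n) (h0 : 0 ≤ N → A ⊚ cap t [] = 0) :
    A ⊚ mk (Diag.capBubble k t s' p N) = 0 := by
  rw [mk_capBubble, map_sum]
  refine Finset.sum_eq_zero fun i hi => ?_
  have hi := Finset.mem_range.1 hi
  rw [← assoc, comp_mk_dotCap_eq_zero hA (h0 (by omega)) i (by omega), map_zero,
    LinearMap.zero_apply]

theorem mk_bubbleCup_comp_eq_zero {a : Word} {t : Strand} {A : TwoHom k n [t, t.flip] a}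
    {x : TwoHom k n a a} {e : TwoHom k n [] a} (hA : dot t [t.flip] ⊚ A = A ⊚ x - cap t [] ⊚ e)
    (s' : Strand) (p : ℤ) {N : ℤ} (hN : N < t.sgn * n) (h0 : 0 ≤ N → cup t [] ⊚ A = 0) :
    mk (Diag.bubbleCup k t s' p N) ⊚ A = 0 := by
  rw [mk_bubbleCup, map_sum, LinearMap.sum_apply]
  refine Finset.sum_eq_zero fun i hi => ?_
  have hi := Finset.mem_range.1 hi
  rw [assoc, mk_dotCup_comp_eq_zero hA (h0 (by omega)) i (by omega), map_zero]

end TwoHom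

/-! ## The algebra behind the homotopy equivalences -/

variable {k : Type u} [CommRing k] {n : ℤ}

local infixr:80 " ⊚ " => TwoHom.comp

variable (k n) in
/-- The 2-morphisms that enter the differentials, chain maps and homotopies at the complex with
terms `E_a 1_n` and `1_n`. -/
structure CasimirData (a : Word) where
  /-- the dot on `E` -/
  xE : TwoHom k n a a
  /-- the dot on `F` -/
  xF : TwoHom k n a a
  /-- the cup -/
  η : TwoHom k n [] a
  /-- the cap -/
  ε : TwoHom k n a []
  /-- the sum of dotted cups with bubbles -/
  T : TwoHom k n [] a
  /-- the sum of dotted caps with bubbles -/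
  S : TwoHom k n a []
  /-- the sum of dotted cups over dotted caps with bubbles -/
  P : TwoHom k n a a
  /-- the bubble -/
  c : TwoHom k n [] []

variable (k n) in
/-- The data for `E F 1_n` (if `s = E`) or `F E 1_n` (if `s = F`). -/
def casimirData (s : Strand) : CasimirData k n [s, s.flip] where
  xE := .mk (dotE k s)
  xF := .mk (dotF k s)
  η := .cup s []
  ε := .cap s []
  T := .mk (Diag.bubbleCup k s s.flip n (s.sgn * n - 1))
  S := .mk (Diag.capBubble k s s.flip n (s.sgn * n - 1))
  P := .mk (Diag.capBubbleCup k s s.flip n (s.sgn * n - 2))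
  c := .mk (Diag.bubble s.flip n (s.sgn * n) [])

/-- The relations between the data at the source of `X`. -/
structure CasimirData.Inner {a : Word} (A : CasimirData k n a) : Prop where
  T_xF : A.T ⊚ A.xF = A.T ⊚ A.xE
  xF_S : A.xF ⊚ A.S = A.xE ⊚ A.S
  P_xF : A.P ⊚ A.xF = A.P ⊚ A.xE
  xF_P : A.xF ⊚ A.P = A.xE ⊚ A.P
  decomp : A.ε ⊚ A.T + A.xE ⊚ A.P = A.S ⊚ A.η + A.P ⊚ A.xE
  η_P : A.η ⊚ A.P = 0
  P_ε : A.P ⊚ A.ε = 0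

/-- Next to a dotted cup or cap a dot may change strands, which gives the first four fields. In
`decomp` both sides are the double sum of index `s.sgn * n - 1`, with a dot split off at the cap or
at the cup. The last two hold because `P` has index `s.sgn * n - 2`, one less than the number of
dots of a bubble of degree zero. -/
theorem casimirData_inner (s : Strand) : (casimirData k n s).Inner where
  T_xF := TwoHom.mk_bubbleCup_congr _ _ _ _ fun m =>
    (TwoHom.mk_dotCup_dotF s m).trans (TwoHom.mk_dotCup_dotE s m).symm
  xF_S := TwoHom.mk_capBubble_congr _ _ _ _ fun m =>
    (TwoHom.dotF_mk_dotCap s m).trans (TwoHom.dotE_mk_dotCap s m).symm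
  P_xF := TwoHom.mk_capBubbleCup_congr_right _ _ _ _ fun m =>
    (TwoHom.mk_dotCup_dotF s m).trans (TwoHom.mk_dotCup_dotE s m).symm
  xF_P := TwoHom.mk_capBubbleCup_congr_left _ _ _ _ fun m =>
    (TwoHom.dotF_mk_dotCap s m).trans (TwoHom.dotE_mk_dotCap s m).symm
  decomp := by
    have h1 := TwoHom.mk_capBubbleCup_dot (k := k) (n := n) s s.flip n (s.sgn * n - 2)
    rw [← TwoHom.dot_mk_capBubbleCup] at h1
    rw [← TwoHom.mk_capBubbleCup_congr_right _ _ _ _ (TwoHom.mk_dotCup_dotE s),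
      ← TwoHom.mk_capBubbleCup_congr_left _ _ _ _ (TwoHom.dotE_mk_dotCap s),
      show s.sgn * n - 2 + 1 = s.sgn * n - 1 by ring] at h1
    exact h1.symm
  η_P := TwoHom.cup_mk_capBubbleCup _ _ _ _ (by omega)
  P_ε := TwoHom.mk_capBubbleCup_cap _ _ _ _ (by omega)

/-- The relations between the data and the sideways crossings. -/
structure CasimirData.Outer {a b : Word} (A : CasimirData k n a) (B : CasimirData k n b)
    (X : TwoHom k n a b) (Y : TwoHom k n b a) : Prop where
  X_xE : X ⊚ B.xE = A.xE ⊚ X + A.ε ⊚ B.η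
  X_xF : X ⊚ B.xF = A.xF ⊚ X + A.ε ⊚ B.η
  X_Y : X ⊚ Y = TwoHom.id a - (A.S ⊚ A.η + A.P ⊚ A.xE)
  η_X : A.η ⊚ X = -(B.T ⊚ B.xE + B.c ⊚ B.η)
  X_ε : X ⊚ B.ε = A.xE ⊚ A.S + A.ε ⊚ A.c
  X_S : X ⊚ B.S = 0
  T_X : A.T ⊚ X = 0
  S_c : A.S ⊚ B.c = 0
  c_T : B.c ⊚ A.T = 0
  T_ε : B.T ⊚ B.ε + A.η ⊚ A.S + B.c ⊚ A.c = TwoHom.id []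

/-- The sideways crossing `E F ⟶ F E`, or the negative of the sideways crossing `F E ⟶ E F`. -/
def signedSide (k : Type u) [CommRing k] (n : ℤ) :
    ∀ s : Strand, TwoHom k n [s, s.flip] [s.flip, s.flip.flip]
  | E => .mk (.side E [])
  | F => -.mk (.side F [])

/-- The curl relations produce sums of index `s.sgn * n`, one more than that of `T` and `S`. This
lemma and the next rewrite them in terms of the data. -/
theorem casimirData_T_xE (s : Strand) :
    (casimirData k n s).T ⊚ (casimirData k n s).xE + (casimirData k n s).c ⊚ (casimirData k n s).η =
      .mk (Diag.bubbleCup k s s.flip n (s.sgn * n)) := by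
  have h := TwoHom.mk_bubbleCup_dot (k := k) (n := n) s s.flip n (s.sgn * n - 1)
  rw [← TwoHom.mk_bubbleCup_congr _ _ _ _ (TwoHom.mk_dotCup_dotE s), sub_add_cancel] at h
  exact h

theorem casimirData_xE_S (s : Strand) :
    (casimirData k n s).xE ⊚ (casimirData k n s).S + (casimirData k n s).ε ⊚ (casimirData k n s).c =
      .mk (Diag.capBubble k s s.flip n (s.sgn * n)) := by
  have h := TwoHom.dot_mk_capBubble (k := k) (n := n) s s.flip n (s.sgn * n - 1)
  rw [← TwoHom.mk_capBubble_congr _ _ _ _ (TwoHom.dotE_mk_dotCap s), sub_add_cancel] at h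
  exact h

/-- For `s = F` the sign of the crossing cancels the sign of the downward nilHecke relation, so the
correction is positive for both letters. -/
theorem signedSide_xE (s : Strand) :
    signedSide k n s ⊚ (casimirData k n s.flip).xE =
      (casimirData k n s).xE ⊚ signedSide k n s +
        (casimirData k n s).ε ⊚ (casimirData k n s.flip).η := by
  cases s
  · exact TwoHom.side_E_dot_right []
  · simp only [signedSide, map_neg, LinearMap.neg_apply]
    refine (congrArg _ (TwoHom.side_F_dot_left [])).trans ?_
    rw [neg_sub', sub_neg_eq_add]
    rfl

theorem signedSide_xF (s : Strand) :
    signedSide k n s ⊚ (casimirData k n s.flip).xF =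
      (casimirData k n s).xF ⊚ signedSide k n s +
        (casimirData k n s).ε ⊚ (casimirData k n s.flip).η := by
  cases s
  · exact TwoHom.side_E_dot_left []
  · simp only [signedSide, map_neg, LinearMap.neg_apply]
    refine (congrArg _ (TwoHom.side_F_dot_right [])).trans ?_
    rw [neg_sub', sub_neg_eq_add]
    rfl

/-- The minus sign in front of the two crossings in the decomposition of the identity is absorbed in
the second one. -/
theorem signedSide_E_F : signedSide k n E ⊚ signedSide k n F =
    (TwoHom.id [E, F] : TwoHom k n _ _) -
      TwoHom.mk (Diag.capBubbleCup k E F n (E.sgn * n - 1)) := by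
  have h := TwoHom.sound (n := n) (Diag.Rel.decomp_E (k := k) [])
  simp only [wt_nil, TwoHom.mk_add, TwoHom.mk_smul, TwoHom.mk_comp, TwoHom.mk_id] at h
  simp only [signedSide, map_neg, sgn_E, one_mul]
  rw [eq_sub_iff_add_eq]
  refine Eq.trans ?_ h.symm
  rw [neg_one_smul]; rfl

theorem signedSide_F_E : signedSide k n F ⊚ signedSide k n E =
    (TwoHom.id [F, E] : TwoHom k n _ _) -
      TwoHom.mk (Diag.capBubbleCup k F E n (F.sgn * n - 1)) := by
  have h := TwoHom.sound (n := n) (Diag.Rel.decomp_F (k := k) [])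
  simp only [wt_nil, TwoHom.mk_add, TwoHom.mk_smul, TwoHom.mk_comp, TwoHom.mk_id] at h
  simp only [signedSide, map_neg, LinearMap.neg_apply, sgn_F, neg_mul, one_mul]
  rw [eq_sub_iff_add_eq]
  refine Eq.trans ?_ h.symm
  rw [neg_one_smul]; rfl

theorem cup_signedSide (s : Strand) : TwoHom.cup s [] ⊚ signedSide k n s =
    -TwoHom.mk (Diag.bubbleCup k s.flip s n (-(s.sgn * n))) := by
  cases s
  · rw [sgn_E, one_mul]; exact TwoHom.cup_side_E
  · rw [sgn_F, neg_mul, one_mul, neg_neg, signedSide, map_neg]; exact congrArg _ TwoHom.cup_side_F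

theorem signedSide_cap (s : Strand) : signedSide k n s ⊚ TwoHom.cap s.flip [] =
    .mk (Diag.capBubble k s s.flip n (s.sgn * n)) := by
  cases s
  · rw [sgn_E, one_mul]; exact TwoHom.side_E_cap
  · rw [sgn_F, neg_mul, one_mul, signedSide, map_neg, LinearMap.neg_apply]
    exact (congrArg _ TwoHom.side_F_cap).trans (neg_neg _)

/-- The morphism `x` is the dot on the corresponding strand of the source, on `E` or on `F`
depending on the letter. The inductions over the number of dots use only that some such `x` exists.
-/
theorem signedSide_dot (s : Strand) : ∃ x,
    signedSide k n s ⊚ TwoHom.dot s.flip [s.flip.flip] =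
      x ⊚ signedSide k n s + TwoHom.cap s [] ⊚ TwoHom.cup s.flip [] := by
  rcases TwoHom.dots_eq (k := k) (n := n) s.flip with ⟨h, -⟩ | ⟨h, -⟩
  · exact ⟨_, by rw [← h]; exact signedSide_xE s⟩
  · exact ⟨_, by rw [← h]; exact signedSide_xF s⟩

theorem dot_signedSide (s : Strand) : ∃ x,
    TwoHom.dot s [s.flip] ⊚ signedSide k n s =
      signedSide k n s ⊚ x - TwoHom.cap s [] ⊚ TwoHom.cup s.flip [] := by
  rcases TwoHom.dots_eq (k := k) (n := n) s with ⟨h, -⟩ | ⟨h, -⟩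
  · exact ⟨_, by rw [← h]; exact eq_sub_of_add_eq (signedSide_xE s).symm⟩
  · exact ⟨_, by rw [← h]; exact eq_sub_of_add_eq (signedSide_xF s).symm⟩

theorem mk_bubbleCup_flip (s : Strand) :
    (TwoHom.mk (Diag.bubbleCup k s.flip s.flip.flip n (s.flip.sgn * n)) : TwoHom k n _ _) =
      TwoHom.mk (Diag.bubbleCup k s.flip s n (-(s.sgn * n))) := by
  rw [sgn_flip, neg_mul]
  cases s <;> rfl

/-- The crossing back is a parameter because the target of `signedSide k n s.flip` involves
`s.flip.flip`, which reduces to `s` only for a concrete letter. Of all fields only `X_Y` mentions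
it. -/
theorem casimirData_outer (s : Strand) {Y : TwoHom k n [s.flip, s.flip.flip] [s, s.flip]}
    (hY : signedSide k n s ⊚ Y =
      TwoHom.id [s, s.flip] - TwoHom.mk (Diag.capBubbleCup k s s.flip n (s.sgn * n - 1))) :
    (casimirData k n s).Outer (casimirData k n s.flip) (signedSide k n s) Y where
  X_xE := signedSide_xE s
  X_xF := signedSide_xF s
  X_Y := by
    have h1 := TwoHom.mk_capBubbleCup_dot (k := k) (n := n) s s.flip n (s.sgn * n - 2)
    rw [← TwoHom.mk_capBubbleCup_congr_right _ _ _ _ (TwoHom.mk_dotCup_dotE s),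
      show s.sgn * n - 2 + 1 = s.sgn * n - 1 by ring] at h1
    rw [hY, ← h1]
    rfl
  η_X := by
    rw [casimirData_T_xE, mk_bubbleCup_flip]
    exact cup_signedSide s
  X_ε := by
    rw [casimirData_xE_S]
    exact signedSide_cap s
  X_S := by
    obtain ⟨x, hx⟩ := signedSide_dot (k := k) (n := n) s
    refine TwoHom.comp_mk_capBubble_eq_zero hx _ _ (by omega) fun h => ?_
    -- If `S` of the flipped letter is nonempty, then `s.sgn * n` is negative, and the sum given by
    -- the curl of index `s.sgn * n` is empty.
    rw [sgn_flip, neg_mul] at h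
    rw [signedSide_cap, TwoHom.mk_capBubble_of_neg _ _ _ (by omega)]
  T_X := by
    obtain ⟨x, hx⟩ := dot_signedSide (k := k) (n := n) s
    refine TwoHom.mk_bubbleCup_comp_eq_zero hx _ _ (by omega) fun h => ?_
    rw [cup_signedSide, TwoHom.mk_bubbleCup_of_neg _ _ _ (by omega), neg_zero]
  S_c := by
    simp only [casimirData, sgn_flip, neg_mul]
    -- Below 1 the sum `S` is empty, and from 1 on the bubble has negative degree. The two factors
    -- are never nonzero together.
    rcases lt_or_ge (s.sgn * n) 1 with h | h
    · rw [TwoHom.mk_capBubble_of_neg _ _ _ (by omega), map_zero, LinearMap.zero_apply]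
    · rw [TwoHom.mk_bubble_of_neg _ _ (by omega), map_zero]
  c_T := by
    simp only [casimirData, sgn_flip, neg_mul]
    rcases lt_or_ge (s.sgn * n) 1 with h | h
    · rw [TwoHom.mk_bubbleCup_of_neg _ _ _ (by omega), map_zero]
    · rw [TwoHom.mk_bubble_of_neg _ _ (by omega), map_zero, LinearMap.zero_apply]
  T_ε := by
    have hs : s.flip.sgn * n = -(s.sgn * n) := by rw [sgn_flip, neg_mul]
    dsimp only [casimirData]
    -- One term survives in each case: `T ε` of the flipped letter for negative, the product of the
    -- two bubbles for zero, and `η S` for positive `s.sgn * n`.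
    rcases lt_trichotomy (s.sgn * n) 0 with h | h | h
    · rw [TwoHom.mk_bubbleCup_cap _ (by omega), TwoHom.mk_capBubble_of_neg _ _ _ (by omega),
        TwoHom.mk_bubble_of_neg s.flip _ h]
      simp only [map_zero, add_zero]
    · rw [TwoHom.mk_bubbleCup_of_neg _ _ _ (by omega), TwoHom.mk_capBubble_of_neg _ _ _ (by omega),
        hs, h, neg_zero, TwoHom.mk_bubble_zero (by rw [sgn_flip, neg_mul, hs]; omega),
        TwoHom.mk_bubble_zero (by omega)]
      simp only [map_zero, LinearMap.zero_apply, zero_add, TwoHom.id_comp]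
    · rw [TwoHom.cup_mk_capBubble _ (by omega), TwoHom.mk_bubbleCup_of_neg _ _ _ (by omega),
        TwoHom.mk_bubble_of_neg s.flip.flip _ (by omega)]
      simp only [map_zero, LinearMap.zero_apply, zero_add, add_zero]

theorem casimirData_outer_E : (casimirData k n E).Outer (casimirData k n F)
    (signedSide k n E) (signedSide k n F) :=
  casimirData_outer E signedSide_E_F

theorem casimirData_outer_F : (casimirData k n F).Outer (casimirData k n E)
    (signedSide k n F) (signedSide k n E) :=
  casimirData_outer F signedSide_F_E

end CatSL2

namespace CatSL2

open Strand

variable {k : Type u} [CommRing k] {n : ℤ}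

local infixr:80 " ⊚ " => TwoHom.comp

/-! ### Matrices of 2-morphisms -/

variable (k n) in
/-- Two by two matrices of 2-morphisms from `a₀ ⊕ a₁` to `b₀ ⊕ b₁` with rows `(a b)` and `(c d)`. -/
@[ext]
structure HomMat (a₀ a₁ b₀ b₁ : Word) where
  /-- the entry from `a₀` to `b₀` -/
  a : TwoHom k n a₀ b₀
  /-- the entry from `a₁` to `b₀` -/
  b : TwoHom k n a₁ b₀
  /-- the entry from `a₀` to `b₁` -/
  c : TwoHom k n a₀ b₁
  /-- the entry from `a₁` to `b₁` -/
  d : TwoHom k n a₁ b₁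

namespace HomMat

variable {a₀ a₁ b₀ b₁ c₀ c₁ : Word}

/-- The composition `M` followed by `N`. -/
def comp (M : HomMat k n a₀ a₁ b₀ b₁) (N : HomMat k n b₀ b₁ c₀ c₁) : HomMat k n a₀ a₁ c₀ c₁ where
  a := M.a ⊚ N.a + M.c ⊚ N.b
  b := M.b ⊚ N.a + M.d ⊚ N.b
  c := M.a ⊚ N.c + M.c ⊚ N.d
  d := M.b ⊚ N.c + M.d ⊚ N.d

variable (k n) in
/-- The identity matrix. -/
def one (a₀ a₁ : Word) : HomMat k n a₀ a₁ a₀ a₁ := ⟨.id a₀, 0, 0, .id a₁⟩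

/-- The sum of two matrices. -/
def add (M N : HomMat k n a₀ a₁ b₀ b₁) : HomMat k n a₀ a₁ b₀ b₁ :=
  ⟨M.a + N.a, M.b + N.b, M.c + N.c, M.d + N.d⟩

/-- The negative of a matrix. -/
def neg (M : HomMat k n a₀ a₁ b₀ b₁) : HomMat k n a₀ a₁ b₀ b₁ := ⟨-M.a, -M.b, -M.c, -M.d⟩

end HomMat

/-! ### The matrices of the differentials, of `ϱ^σ` and of the homotopies, and the identities
between them -/

namespace CasimirData

variable {a b : Word} (A : CasimirData k n a) (B : CasimirData k n b)

/-- The differential from degree `-1` to `0`. -/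
def d₀ : HomMat k n a [] a a := ⟨A.xE, A.η, A.xF, A.η⟩

/-- The differential from degree `0` to `1`. -/
def d₁ : HomMat k n a a a [] := ⟨-A.xF, A.xE, A.ε, -A.ε⟩

/-- The chain map in degree `-1`. -/
def rhoNeg (X : TwoHom k n a b) : HomMat k n a [] b [] := ⟨X, -B.T, -A.ε, -B.c⟩

/-- The chain map in degree `0`. -/
def rhoZero (X : TwoHom k n a b) : HomMat k n a a b b := ⟨X, 0, 0, X⟩

/-- The chain map in degree `1`. -/
def rhoOne (X : TwoHom k n a b) : HomMat k n a [] b [] := ⟨X, -B.η, -A.S, A.c⟩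

/-- The homotopy from degree `0` to `-1`. -/
def h₀ : HomMat k n a a a [] := ⟨-A.P, 0, -A.S, 0⟩

/-- The homotopy from degree `1` to `0`. -/
def h₁ : HomMat k n a [] a a := ⟨0, 0, -A.P, A.T⟩

variable {A B} {X : TwoHom k n a b} {Y : TwoHom k n b a}

/-- On the first summand this is dot sliding: the correction `ε η` is the same for both dots and is
supplied by the entry `-ε`. On the second summand it is the curl `η X`, and the two rows agree
because a dot on `T` may sit on either strand. -/
theorem Outer.d₀_rhoZero (h : A.Outer B X Y) (hB : B.Inner) :
    A.d₀.comp (rhoZero X) = (rhoNeg A B X).comp B.d₀ := by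
  have h1 := h.X_xE
  have h2 := h.X_xF
  have h3 := h.η_X
  have h4 := hB.T_xF
  ext1 <;> simp only [HomMat.comp, d₀, rhoZero, rhoNeg, map_zero, map_neg, LinearMap.neg_apply,
    add_zero, zero_add, h1, h2, h3, h4] <;> abel

/-- The upper row is dot sliding, with the correction supplied by the entry `-η`. The lower row is
the curl `X ε`, up to sign. -/
theorem Outer.d₁_rhoOne (h : A.Outer B X Y) (hA : A.Inner) :
    A.d₁.comp (rhoOne A B X) = (rhoZero X).comp B.d₁ := by
  have h1 := h.X_xE
  have h2 := h.X_xF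
  have h3 := h.X_ε
  have h4 := hA.xF_S
  ext1 <;> simp only [HomMat.comp, d₁, rhoZero, rhoOne, map_zero, map_neg, LinearMap.neg_apply,
    LinearMap.zero_apply, add_zero, zero_add, h1, h2, h3, h4] <;> abel

/-- Degree -1, where only `d h` contributes in this order of composition. The entry into the second
summand from the first is the curl `X ε`. The entry in the other direction vanishes by `T_X` and
`c_T`, and the last diagonal entry is `T_ε`. -/
theorem Outer.rhoNeg_rhoNeg (h : A.Outer B X Y) (h' : B.Outer A Y X) (hA : A.Inner) :
    (rhoNeg A B X).comp (rhoNeg B A Y) = (A.d₀.comp A.h₀).add (.one k n a []) := by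
  have h1 := h.X_Y
  have h2 := h.X_ε
  have h3 := h.T_ε
  have h4 := h.c_T
  have h5 := h'.T_X
  have h9 := hA.η_P
  -- The correction in `X Y` is taken in the form `ε T + x P`, because `ε T` is the product of the
  -- off-diagonal entries and cancels.
  rw [← hA.decomp] at h1
  ext1 <;> simp only [HomMat.comp, HomMat.add, HomMat.one, d₀, h₀, rhoNeg, map_zero, map_neg,
    LinearMap.neg_apply, add_zero, h1, h2, h4, h5, h9, neg_zero, neg_neg]
  · abel
  · abel
  · rw [← h3]; abel

/-- The two diagonal entries use the two forms `S η + P x` and `ε T + x P` of the same correction.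
The off-diagonal entry that is not trivially zero is their difference. -/
theorem Outer.rhoZero_rhoZero (h : A.Outer B X Y) (hA : A.Inner) :
    (rhoZero X).comp (rhoZero Y) = ((A.d₁.comp A.h₁).add (A.h₀.comp A.d₀)).add (.one k n a a) := by
  have h1 := h.X_Y
  have h6 := hA.decomp
  have h7 := hA.P_xF
  have h8 := hA.xF_P
  ext1 <;> simp only [HomMat.comp, HomMat.add, HomMat.one, d₀, h₀, d₁, h₁, rhoZero, map_zero,
    map_neg, LinearMap.neg_apply, LinearMap.zero_apply, add_zero, zero_add, h1, h7, h8, neg_neg]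
  · abel
  · rw [add_comm (A.xE ⊚ A.P), h6]; abel
  · rw [← h6]; abel

/-- Here the form `S η + P x` of the correction is needed, since `S η` is the product of the
off-diagonal entries. The remaining entries are the curl `η Y`, the vanishing of `X S` and `S c`,
and `T_ε` for the other letter. -/
theorem Outer.rhoOne_rhoOne (h : A.Outer B X Y) (h' : B.Outer A Y X) (hA : A.Inner) :
    (rhoOne A B X).comp (rhoOne B A Y) = (A.h₁.comp A.d₁).add (.one k n a []) := by
  have h1 := h.X_Y
  have h2 := h'.η_X
  have h3 := h'.T_ε
  have h4 := h.S_c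
  have h5 := h.X_S
  have h6 := hA.P_ε
  ext1 <;> simp only [HomMat.comp, HomMat.add, HomMat.one, d₁, h₁, rhoOne, map_zero, map_neg,
    LinearMap.neg_apply, LinearMap.zero_apply, add_zero, zero_add, h1, h2, h4, h5, h6, neg_zero,
    neg_neg]
  · abel
  · abel
  · rw [← h3]; abel

end CasimirData

end CatSL2

namespace CatSL2

open Strand

/-! ### Degrees of diagrams -/

namespace Diag

namespace IsHomogeneous

variable {k : Type u} {n : ℤ}

theorem sumRange {d : ℤ} {a b : Word} {g : ℕ → Diag k a b} (N : ℕ)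
    (h : ∀ i < N, (g i).IsHomogeneous n d) : (sumRange g N).IsHomogeneous n d := by
  induction N with
  | zero => exact .zero _ _ _
  | succ N ih => exact .add (ih fun i hi => h i (by omega)) (h N (by omega))

theorem sum₂ {d N : ℤ} {a b : Word} {g : ℕ → ℕ → Diag k a b}
    (h : ∀ i j : ℕ, (i + j : ℤ) = N → (g i j).IsHomogeneous n d) :
    (sum₂ N g).IsHomogeneous n d := sumRange _ fun i hi => h _ _ (by omega)

theorem sum₃ {d N : ℤ} {a b : Word} {g : ℕ → ℕ → ℕ → Diag k a b}
    (h : ∀ i j l : ℕ, (i + j + l : ℤ) = N → (g i j l).IsHomogeneous n d) :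
    (sum₃ N g).IsHomogeneous n d := sum₂ fun _ _ _ => sum₂ fun _ _ _ => h _ _ _ (by omega)

theorem dots (s : Strand) (R : Word) (m : ℕ) :
    (dots s R m : Diag k _ _).IsHomogeneous n (2 * m) := by
  induction m with
  | zero => exact .id _
  | succ m ih => exact (ih.comp (.dot s R)).cast (by push_cast; ring)

theorem dotCup (s : Strand) (R : Word) (m : ℕ) :
    (dotCup s R m : Diag k _ _).IsHomogeneous n (1 - s.sgn * wt n R + 2 * m) :=
  (IsHomogeneous.cup s R).comp (dots s _ m)

theorem dotCap (s : Strand) (R : Word) (m : ℕ) :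
    (dotCap s R m : Diag k _ _).IsHomogeneous n (2 * m + (1 - s.sgn * wt n R)) :=
  (dots s _ m).comp (.cap s R)

theorem realBubble (s : Strand) (m : ℕ) (R : Word) :
    (realBubble s m R : Diag k _ _).IsHomogeneous n (2 * (m - spade s (wt n R))) :=
  ((IsHomogeneous.cup s R).comp (dotCap s R m)).cast (by rw [spade]; ring)

/-- The cup and the cap have opposite orientations and see the same weight w, so their degrees 1 + w
and 1 - w add up to 2 and cancel the degree -2 of the crossing. -/
theorem side (s : Strand) (R : Word) : (side s R : Diag k _ _).IsHomogeneous n 0 := by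
  cases s
  · exact ((IsHomogeneous.cup F _).comp ((IsHomogeneous.strand F (.cross E _)).comp
      (.strand F (.strand E (.cap E R))))).cast (by simp; ring)
  · exact ((IsHomogeneous.cup E _).comp ((IsHomogeneous.strand E (.cross F _)).comp
      (.strand E (.strand F (.cap F R))))).cast (by simp; ring)

variable [CommRing k]

/-- The values of ♠ for the two orientations add up to -2. For a bubble that is really fake, the
opposite bubbles in its recursion therefore carry a nonnegative number of dots, and `toNat` does not
truncate. -/
theorem fakeBubble (s : Strand) (R : Word) (j : ℕ) (h : spade s (wt n R) + j < 0) :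
    (fakeBubble s (wt n R) R j : Diag k _ _).IsHomogeneous n (2 * j) := by
  induction j using Nat.strong_induction_on with
  | _ j ih =>
    cases j with
    | zero => rw [Diag.fakeBubble]; exact .id _
    | succ j =>
      rw [Diag.fakeBubble]
      refine .smul _ (sumRange _ fun i hi => ?_)
      refine ((realBubble s.flip _ R).comp (ih (j - i) (by omega) (by omega))).cast ?_
      have h1 : spade s.flip (wt n R) + spade s (wt n R) = -2 := by
        simp only [spade, sgn_flip]; ring
      push_cast at h
      rw [Int.toNat_of_nonneg (by omega), Nat.cast_sub (by omega)]
      push_cast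
      ring

/-- The label `w` is a free parameter of `Diag.bubble`. The degree is claimed only when it is the
actual weight of the region. -/
theorem bubble (s : Strand) (R : Word) {w : ℤ} (hw : w = wt n R) (j : ℤ) :
    (bubble s w j R : Diag k _ _).IsHomogeneous n (2 * j) := by
  subst hw
  rw [Diag.bubble]
  split_ifs with h1 h2
  · exact .zero _ _ _
  · exact (realBubble s _ R).cast (by rw [Int.toNat_of_nonneg h2]; ring)
  · exact (fakeBubble s R _ (by omega)).cast (by rw [Int.toNat_of_nonneg (by omega)])

theorem bubbleCup (s s' : Strand) (N : ℤ) :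
    (bubbleCup k s s' n N).IsHomogeneous n (1 - s.sgn * n + 2 * N) :=
  sum₂ fun _ _ h => ((bubble s' [] rfl _).comp (dotCup s [] _)).cast (by rw [wt_nil, ← h]; ring)

theorem capBubble (s s' : Strand) (N : ℤ) :
    (capBubble k s s' n N).IsHomogeneous n (1 - s.sgn * n + 2 * N) :=
  sum₂ fun _ _ h => ((dotCap s [] _).comp (bubble s' [] rfl _)).cast (by rw [wt_nil, ← h]; ring)

theorem capBubbleCup (s s' : Strand) (N : ℤ) :
    (capBubbleCup k s s' n N).IsHomogeneous n (2 - 2 * (s.sgn * n) + 2 * N) :=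
  sum₃ fun _ _ _ h => ((dotCap s [] _).comp ((bubble s' [] rfl _).comp (dotCup s [] _))).cast
    (by rw [wt_nil, ← h]; ring)

end IsHomogeneous

end Diag

/-! ### Morphisms given by matrices of 2-morphisms -/

section matrices

variable {k : Type u} [CommRing k] {n m : ℤ} {X Y Z : Fin 2 → Ob k n m}

local infixr:80 " ⊚ " => TwoHom.comp

/-- `IsMat φ M`: the entries of the matrix `M` are the components of the morphism `φ` between direct
sums of two objects. -/
structure IsMat (φ : (⟨Fin 2, X⟩ : U k n m) ⟶ ⟨Fin 2, Y⟩)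
    (M : HomMat k n (X 0).seq (X 1).seq (Y 0).seq (Y 1).seq) : Prop where
  a : (φ 0 0).1 = M.a
  b : (φ 1 0).1 = M.b
  c : (φ 0 1).1 = M.c
  d : (φ 1 1).1 = M.d

namespace IsMat

theorem ext {φ ψ : (⟨Fin 2, X⟩ : U k n m) ⟶ ⟨Fin 2, Y⟩}
    {M : HomMat k n (X 0).seq (X 1).seq (Y 0).seq (Y 1).seq} (h : IsMat φ M) (h' : IsMat ψ M) :
    φ = ψ := by
  refine Mat_.hom_ext _ _ fun i j => Ob.hom_ext ?_
  change Fin 2 at i j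
  match i, j with
  | 0, 0 => exact h.a.trans h'.a.symm
  | 1, 0 => exact h.b.trans h'.b.symm
  | 0, 1 => exact h.c.trans h'.c.symm
  | 1, 1 => exact h.d.trans h'.d.symm

theorem comp_entry (φ : (⟨Fin 2, X⟩ : U k n m) ⟶ ⟨Fin 2, Y⟩)
    (ψ : (⟨Fin 2, Y⟩ : U k n m) ⟶ ⟨Fin 2, Z⟩)
    (i j : Fin 2) :
    ((φ ≫ ψ) i j).1 = (φ i 0).1 ⊚ (ψ 0 j).1 + (φ i 1).1 ⊚ (ψ 1 j).1 := by
  have h : (φ ≫ ψ) i j = φ i 0 ≫ ψ 0 j + φ i 1 ≫ ψ 1 j :=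
    (Mat_.comp_apply φ ψ i j).trans (Fin.sum_univ_two _)
  rw [h]
  rfl

theorem comp {φ : (⟨Fin 2, X⟩ : U k n m) ⟶ ⟨Fin 2, Y⟩} {ψ : (⟨Fin 2, Y⟩ : U k n m) ⟶ ⟨Fin 2, Z⟩}
    {M : HomMat k n (X 0).seq (X 1).seq (Y 0).seq (Y 1).seq}
    {N : HomMat k n (Y 0).seq (Y 1).seq (Z 0).seq (Z 1).seq} (h : IsMat φ M) (h' : IsMat ψ N) :
    IsMat (φ ≫ ψ) (M.comp N) where
  a := by rw [comp_entry, h.a, h.c, h'.a, h'.b]; rfl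
  b := by rw [comp_entry, h.b, h.d, h'.a, h'.b]; rfl
  c := by rw [comp_entry, h.a, h.c, h'.c, h'.d]; rfl
  d := by rw [comp_entry, h.b, h.d, h'.c, h'.d]; rfl

theorem add {φ ψ : (⟨Fin 2, X⟩ : U k n m) ⟶ ⟨Fin 2, Y⟩}
    {M N : HomMat k n (X 0).seq (X 1).seq (Y 0).seq (Y 1).seq} (h : IsMat φ M) (h' : IsMat ψ N) :
    IsMat (φ + ψ) (M.add N) where
  a := congrArg₂ (· + ·) h.a h'.a
  b := congrArg₂ (· + ·) h.b h'.b
  c := congrArg₂ (· + ·) h.c h'.c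
  d := congrArg₂ (· + ·) h.d h'.d

theorem neg {φ : (⟨Fin 2, X⟩ : U k n m) ⟶ ⟨Fin 2, Y⟩}
    {M : HomMat k n (X 0).seq (X 1).seq (Y 0).seq (Y 1).seq} (h : IsMat φ M) :
    IsMat (-φ) M.neg where
  a := congrArg (-·) h.a
  b := congrArg (-·) h.b
  c := congrArg (-·) h.c
  d := congrArg (-·) h.d

theorem id (X : Fin 2 → Ob k n m) :
    IsMat (𝟙 (⟨Fin 2, X⟩ : U k n m)) (.one k n (X 0).seq (X 1).seq) where
  a := congrArg Subtype.val (Mat_.id_apply_self (⟨Fin 2, X⟩ : U k n m) 0)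
  b := congrArg Subtype.val (Mat_.id_apply_of_ne (⟨Fin 2, X⟩ : U k n m) 1 0
    (show (1 : Fin 2) ≠ 0 by decide))
  c := congrArg Subtype.val (Mat_.id_apply_of_ne (⟨Fin 2, X⟩ : U k n m) 0 1
    (show (0 : Fin 2) ≠ 1 by decide))
  d := congrArg Subtype.val (Mat_.id_apply_self (⟨Fin 2, X⟩ : U k n m) 1)

/-- A matrix of 2-morphisms knows the words but not the shifts. The shifts enter only here, as four
conditions on degrees, and composition and comparison of maps can then ignore them. -/
theorem exists_of_mem (M : HomMat k n (X 0).seq (X 1).seq (Y 0).seq (Y 1).seq)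
    (ha : M.a ∈ TwoHom.deg k n ((X 0).shift - (Y 0).shift) _ _)
    (hb : M.b ∈ TwoHom.deg k n ((X 1).shift - (Y 0).shift) _ _)
    (hc : M.c ∈ TwoHom.deg k n ((X 0).shift - (Y 1).shift) _ _)
    (hd : M.d ∈ TwoHom.deg k n ((X 1).shift - (Y 1).shift) _ _) :
    ∃ φ : (⟨Fin 2, X⟩ : U k n m) ⟶ ⟨Fin 2, Y⟩, IsMat φ M :=
  let f : ∀ i j : Fin 2, X i ⟶ Y j
    | 0, 0 => ⟨_, ha⟩ | 1, 0 => ⟨_, hb⟩ | 0, 1 => ⟨_, hc⟩ | 1, 1 => ⟨_, hd⟩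
  ⟨f, rfl, rfl, rfl, rfl⟩

end IsMat

end matrices

/-! ### Complexes concentrated in the degrees `-1`, `0`, `1` -/

section threeTerm

variable {k : Type u} [CommRing k] {n m : ℤ} {X Y : Kom k n m}

/-- The terms of the complex `X` in degrees other than `-1`, `0`, `1` are empty direct sums. -/
structure ThreeTerm (X : Kom k n m) : Prop where
  pos (i : ℕ) : IsEmpty (X.X (.ofNat (i + 2))).ι
  neg (i : ℕ) : IsEmpty (X.X (.negSucc (i + 1))).ι

theorem hom_eq_of_isEmpty_left {M N : U k n m} (h : IsEmpty M.ι) (f g : M ⟶ N) : f = g :=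
  Mat_.hom_ext _ _ fun i _ => h.elim i

theorem hom_eq_of_isEmpty_right {M N : U k n m} (h : IsEmpty N.ι) (f g : M ⟶ N) : f = g :=
  Mat_.hom_ext _ _ fun _ j => h.elim j

theorem ThreeTerm.hom_ext (hX : ThreeTerm X) {f g : X ⟶ Y} (h₀ : f.f (-1) = g.f (-1))
    (h₁ : f.f 0 = g.f 0) (h₂ : f.f 1 = g.f 1) : f = g := by
  ext1 i
  match i with
  | .negSucc 0 => exact h₀
  | .ofNat 0 => exact h₁
  | .ofNat 1 => exact h₂
  | .ofNat (i + 2) => exact hom_eq_of_isEmpty_left (hX.pos i) _ _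
  | .negSucc (i + 1) => exact hom_eq_of_isEmpty_left (hX.neg i) _ _

/-- The components of a chain map. -/
noncomputable def threeTermHom (f₀ : X.X (-1) ⟶ Y.X (-1)) (f₁ : X.X 0 ⟶ Y.X 0)
    (f₂ : X.X 1 ⟶ Y.X 1) : ∀ i, X.X i ⟶ Y.X i
  | .negSucc 0 => f₀
  | .ofNat 0 => f₁
  | .ofNat 1 => f₂
  | _ => 0

/-- Only two squares have content. The square from degree 1 to 2 ends in an empty sum, and every
other one starts in an empty sum. -/
theorem ThreeTerm.exists_hom (hX : ThreeTerm X) (hY : ThreeTerm Y)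
    (f₀ : X.X (-1) ⟶ Y.X (-1)) (f₁ : X.X 0 ⟶ Y.X 0) (f₂ : X.X 1 ⟶ Y.X 1)
    (h₀ : X.d (-1) 0 ≫ f₁ = f₀ ≫ Y.d (-1) 0) (h₁ : X.d 0 1 ≫ f₂ = f₁ ≫ Y.d 0 1) :
    ∃ f : X ⟶ Y, f.f (-1) = f₀ ∧ f.f 0 = f₁ ∧ f.f 1 = f₂ := by
  refine ⟨⟨threeTermHom f₀ f₁ f₂, fun i j hij => ?_⟩, rfl, rfl, rfl⟩
  simp only [ComplexShape.up_Rel] at hij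
  subst hij
  match i with
  | .negSucc 0 => exact h₀.symm
  | .ofNat 0 => exact h₁.symm
  | .ofNat 1 => exact hom_eq_of_isEmpty_right (hY.pos 0) _ _
  | .ofNat (i + 2) => exact hom_eq_of_isEmpty_left (hX.pos i) _ _
  | .negSucc (i + 1) => exact hom_eq_of_isEmpty_left (hX.neg i) _ _

/-- The components of a homotopy. -/
noncomputable def threeTermHomotopy (h₀ : X.X 0 ⟶ Y.X (-1)) (h₁ : X.X 1 ⟶ Y.X 0) :
    ∀ i j, X.X i ⟶ Y.X j
  | .ofNat 0, .negSucc 0 => h₀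
  | .ofNat 1, .ofNat 0 => h₁
  | _, _ => 0

/-- A homotopy has just two components that matter, so in the degrees -1 and 1 one of the terms `d
h`, `h d` disappears. -/
theorem ThreeTerm.exists_homotopy (hX : ThreeTerm X) {f g : X ⟶ Y} (h₀ : X.X 0 ⟶ Y.X (-1))
    (h₁ : X.X 1 ⟶ Y.X 0)
    (e₀ : f.f (-1) = X.d (-1) 0 ≫ h₀ + g.f (-1))
    (e₁ : f.f 0 = (X.d 0 1 ≫ h₁ + h₀ ≫ Y.d (-1) 0) + g.f 0)
    (e₂ : f.f 1 = h₁ ≫ Y.d 0 1 + g.f 1) :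
    ∃ H : Homotopy f g, H.hom 0 (-1) = h₀ ∧ H.hom 1 0 = h₁ := by
  refine ⟨⟨threeTermHomotopy h₀ h₁, fun i j hij => ?_, fun i => ?_⟩, rfl, rfl⟩
  · simp only [ComplexShape.up_Rel] at hij
    match i, j with
    | .ofNat 0, .negSucc 0 => exact absurd rfl hij
    | .ofNat 1, .ofNat 0 => exact absurd rfl hij
    | .ofNat 0, .negSucc (_ + 1) => rfl
    | .ofNat 0, .ofNat _ => rfl
    | .ofNat 1, .ofNat (_ + 1) => rfl
    | .ofNat 1, .negSucc _ => rfl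
    | .ofNat (i + 2), _ => exact hom_eq_of_isEmpty_left (hX.pos i) _ _
    | .negSucc 0, _ => rfl
    | .negSucc (_ + 1), _ => rfl
  · match i with
    | .ofNat (i + 2) => exact hom_eq_of_isEmpty_left (hX.pos i) _ _
    | .negSucc (i + 1) => exact hom_eq_of_isEmpty_left (hX.neg i) _ _
    | .negSucc 0 =>
      change f.f (-1) = dNext (-1) _ + prevD (-1) _ + g.f (-1)
      rw [dNext_eq _ (show (ComplexShape.up ℤ).Rel (-1) 0 from rfl),
        prevD_eq _ (show (ComplexShape.up ℤ).Rel (-2) (-1) from rfl)]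
      refine e₀.trans (congrArg (· + _) ?_)
      -- The other term runs through the component from degree -1 to -2, which is zero by
      -- definition.
      exact (add_zero _).symm.trans (congrArg (_ + ·) Limits.zero_comp.symm)
    | .ofNat 0 =>
      change f.f 0 = dNext 0 _ + prevD 0 _ + g.f 0
      rw [dNext_eq _ (show (ComplexShape.up ℤ).Rel 0 1 from rfl),
        prevD_eq _ (show (ComplexShape.up ℤ).Rel (-1) 0 from rfl)]
      exact e₁
    | .ofNat 1 =>
      change f.f 1 = dNext 1 _ + prevD 1 _ + g.f 1
      rw [dNext_eq _ (show (ComplexShape.up ℤ).Rel 1 2 from rfl),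
        prevD_eq _ (show (ComplexShape.up ℤ).Rel 0 1 from rfl)]
      refine e₂.trans (congrArg (· + _) ?_)
      exact (zero_add _).symm.trans (congrArg (· + _) Limits.comp_zero.symm)

end threeTerm

end CatSL2

namespace CatSL2

open Strand

/-! ### The formulas in terms of matrices of 2-morphisms -/

namespace HomMat

variable (k : Type u) [CommRing k] (n : ℤ) (a : Word)

/-- The map `ρ^ψ` in degree `-1`. -/
def psiNeg : HomMat k n a [] a [] := ⟨-.id a, 0, 0, .id []⟩

/-- The map `ρ^ψ` in degree `0`. -/
def psiZero : HomMat k n a a a a := ⟨0, .id a, -.id a, 0⟩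

/-- The map `ρ^ψ` in degree `1`. -/
def psiOne : HomMat k n a [] a [] := ⟨.id a, 0, 0, -.id []⟩

/-- The map `ρ^{σω}` in degree `0`. -/
def swap : HomMat k n a a a a := ⟨0, .id a, .id a, 0⟩

end HomMat

section

variable {k : Type u} [CommRing k] {n m : ℤ}

theorem TwoHom.neg_mem {d : ℤ} {a b : Word} {x : TwoHom k n a b} (h : x ∈ deg k n d a b) :
    -x ∈ deg k n d a b := Submodule.neg_mem _ h

/-- All enumerations of summands in use are the identity of `Fin 2`, so the formulas in terms of
diagrams turn into matrices of 2-morphisms. -/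
theorem hasMatrix_iff {X Y : Fin 2 → Ob k n m} {φ : (⟨Fin 2, X⟩ : U k n m) ⟶ ⟨Fin 2, Y⟩}
    {a : Diag k (X 0).seq (Y 0).seq} {b : Diag k (X 1).seq (Y 0).seq}
    {c : Diag k (X 0).seq (Y 1).seq} {d : Diag k (X 1).seq (Y 1).seq} :
    HasMatrix φ (fun i => i) (fun i => i) a b c d ↔ IsMat φ ⟨.mk a, .mk b, .mk c, .mk d⟩ :=
  ⟨fun h => ⟨h.1, h.2.1, h.2.2.1, h.2.2.2⟩, fun h => ⟨h.a, h.b, h.c, h.d⟩⟩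

end

section

variable {k : Type u} [CommRing k] {n n' : ℤ}

/-- The data contain `s.sgn * n`, that is `1 * n` or `-1 * n`, whereas the explicit formulas contain
`n` and `-n`. This lemma and the next seven remove the factor. -/
theorem casimirData_E_T :
    (casimirData k n E).T = .mk (Diag.bubbleCup k E F n (n - 1)) := by
  change TwoHom.mk (Diag.bubbleCup k E F n (1 * n - 1)) = _
  rw [one_mul]

theorem casimirData_E_S :
    (casimirData k n E).S = .mk (Diag.capBubble k E F n (n - 1)) := by
  change TwoHom.mk (Diag.capBubble k E F n (1 * n - 1)) = _
  rw [one_mul]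

theorem casimirData_E_P :
    (casimirData k n E).P = .mk (Diag.capBubbleCup k E F n (n - 2)) := by
  change TwoHom.mk (Diag.capBubbleCup k E F n (1 * n - 2)) = _
  rw [one_mul]

theorem casimirData_E_c : (casimirData k n E).c = .mk (Diag.bubble F n n []) := by
  change TwoHom.mk (Diag.bubble F n (1 * n) []) = _
  rw [one_mul]

theorem casimirData_F_T :
    (casimirData k n F).T = .mk (Diag.bubbleCup k F E n (-n - 1)) := by
  change TwoHom.mk (Diag.bubbleCup k F E n (-1 * n - 1)) = _
  rw [neg_one_mul]

theorem casimirData_F_S :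
    (casimirData k n F).S = .mk (Diag.capBubble k F E n (-n - 1)) := by
  change TwoHom.mk (Diag.capBubble k F E n (-1 * n - 1)) = _
  rw [neg_one_mul]

theorem casimirData_F_P :
    (casimirData k n F).P = .mk (Diag.capBubbleCup k F E n (-n - 2)) := by
  change TwoHom.mk (Diag.capBubbleCup k F E n (-1 * n - 2)) = _
  rw [neg_one_mul]

theorem casimirData_F_c : (casimirData k n F).c = .mk (Diag.bubble E n (-n) []) := by
  change TwoHom.mk (Diag.bubble E n (-1 * n) []) = _
  rw [neg_one_mul]

theorem isRhoPsi_iff {φ : C k n ⟶ ψC k n} : IsRhoPsi φ ↔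
    IsMat (φ.f (-1)) (.psiNeg k n [E, F]) ∧ IsMat (φ.f 0) (.psiZero k n [E, F]) ∧
      IsMat (φ.f 1) (.psiOne k n [E, F]) :=
  ⟨fun h => ⟨hasMatrix_iff.1 h.1, hasMatrix_iff.1 h.2, hasMatrix_iff.1 h.3⟩,
    fun h => ⟨hasMatrix_iff.2 h.1, hasMatrix_iff.2 h.2.1, hasMatrix_iff.2 h.2.2⟩⟩

theorem isRhoHatPsi_iff {φ : ψC k n ⟶ C k n} : IsRhoHatPsi φ ↔
    IsMat (φ.f (-1)) (.psiNeg k n [E, F]) ∧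
      IsMat (φ.f 0) ⟨0, -.id [E, F], .id [E, F], 0⟩ ∧ IsMat (φ.f 1) (.psiOne k n [E, F]) :=
  ⟨fun h => ⟨hasMatrix_iff.1 h.1, hasMatrix_iff.1 h.2, hasMatrix_iff.1 h.3⟩,
    fun h => ⟨hasMatrix_iff.2 h.1, hasMatrix_iff.2 h.2.1, hasMatrix_iff.2 h.2.2⟩⟩

theorem isRhoSigmaOmega_iff {h : n + n' = 0} {φ : C k n ⟶ σωC k n h} : IsRhoSigmaOmega h φ ↔
    IsMat (φ.f (-1)) (.one k n [E, F] []) ∧ IsMat (φ.f 0) (.swap k n [E, F]) ∧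
      IsMat (φ.f 1) ⟨-.id [E, F], 0, 0, -.id []⟩ :=
  ⟨fun h => ⟨hasMatrix_iff.1 h.1, hasMatrix_iff.1 h.2, hasMatrix_iff.1 h.3⟩,
    fun h => ⟨hasMatrix_iff.2 h.1, hasMatrix_iff.2 h.2.1, hasMatrix_iff.2 h.2.2⟩⟩

theorem isRhoHatSigmaOmega_iff {h : n + n' = 0} {φ : σωC k n h ⟶ C k n} :
    IsRhoHatSigmaOmega h φ ↔
    IsMat (φ.f (-1)) (.one k n [E, F] []) ∧ IsMat (φ.f 0) (.swap k n [E, F]) ∧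
      IsMat (φ.f 1) ⟨-.id [E, F], 0, 0, -.id []⟩ :=
  ⟨fun h => ⟨hasMatrix_iff.1 h.1, hasMatrix_iff.1 h.2, hasMatrix_iff.1 h.3⟩,
    fun h => ⟨hasMatrix_iff.2 h.1, hasMatrix_iff.2 h.2.1, hasMatrix_iff.2 h.2.2⟩⟩

theorem IsMat.congr {m : ℤ} {X Y : Fin 2 → Ob k n m} {φ : (⟨Fin 2, X⟩ : U k n m) ⟶ ⟨Fin 2, Y⟩}
    {M N : HomMat k n (X 0).seq (X 1).seq (Y 0).seq (Y 1).seq} (h : IsMat φ M) (e : M = N) :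
    IsMat φ N := e ▸ h

theorem rhoNeg_E {X : TwoHom k n [E, F] [F, E]} :
    CasimirData.rhoNeg (casimirData k n E) (casimirData k n F) X =
      ⟨X, -.mk (Diag.bubbleCup k F E n (-n - 1)), -.cap E [],
        -.mk (Diag.bubble E n (-n) [])⟩ := by
  rw [CasimirData.rhoNeg, casimirData_F_T, casimirData_F_c]
  rfl

theorem rhoOne_E {X : TwoHom k n [E, F] [F, E]} :
    CasimirData.rhoOne (casimirData k n E) (casimirData k n F) X =
      ⟨X, -.cup F [], -.mk (Diag.capBubble k E F n (n - 1)),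
        .mk (Diag.bubble F n (n) [])⟩ := by
  rw [CasimirData.rhoOne, casimirData_E_S, casimirData_E_c]
  rfl

theorem rhoNeg_F {X : TwoHom k n [F, E] [E, F]} :
    CasimirData.rhoNeg (casimirData k n F) (casimirData k n E) X =
      ⟨X, -.mk (Diag.bubbleCup k E F n (n - 1)), -.cap F [],
        -.mk (Diag.bubble F n (n) [])⟩ := by
  rw [CasimirData.rhoNeg, casimirData_E_T, casimirData_E_c]
  rfl

theorem rhoOne_F {X : TwoHom k n [F, E] [E, F]} :
    CasimirData.rhoOne (casimirData k n F) (casimirData k n E) X =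
      ⟨X, -.cup E [], -.mk (Diag.capBubble k F E n (-n - 1)),
        .mk (Diag.bubble E n (-n) [])⟩ := by
  rw [CasimirData.rhoOne, casimirData_F_S, casimirData_F_c]
  rfl

open CasimirData in
theorem isRhoSigma_iff {h : n + n' = 0} {φ : C k n ⟶ σC k n h} : IsRhoSigma h φ ↔
    IsMat (φ.f (-1)) (rhoNeg (casimirData k n E) (casimirData k n F) (signedSide k n E)) ∧
      IsMat (φ.f 0) (rhoZero (signedSide k n E)) ∧
      IsMat (φ.f 1) (rhoOne (casimirData k n E) (casimirData k n F) (signedSide k n E)) :=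
  ⟨fun h => ⟨(hasMatrix_iff.1 h.1).congr rhoNeg_E.symm, hasMatrix_iff.1 h.2,
      (hasMatrix_iff.1 h.3).congr rhoOne_E.symm⟩,
    fun h => ⟨hasMatrix_iff.2 (h.1.congr rhoNeg_E), hasMatrix_iff.2 h.2.1,
      hasMatrix_iff.2 (h.2.2.congr rhoOne_E)⟩⟩

open CasimirData in
theorem isRhoHatSigma_iff {h : n + n' = 0} {φ : σC k n h ⟶ C k n} : IsRhoHatSigma h φ ↔
    IsMat (φ.f (-1)) (rhoNeg (casimirData k n F) (casimirData k n E) (signedSide k n F)) ∧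
      IsMat (φ.f 0) (rhoZero (signedSide k n F)) ∧
      IsMat (φ.f 1) (rhoOne (casimirData k n F) (casimirData k n E) (signedSide k n F)) :=
  ⟨fun h => ⟨(hasMatrix_iff.1 h.1).congr rhoNeg_F.symm, hasMatrix_iff.1 h.2,
      (hasMatrix_iff.1 h.3).congr rhoOne_F.symm⟩,
    fun h => ⟨hasMatrix_iff.2 (h.1.congr rhoNeg_F), hasMatrix_iff.2 h.2.1,
      hasMatrix_iff.2 (h.2.2.congr rhoOne_F)⟩⟩

theorem isHomotopyC_iff {f g : C k n ⟶ C k n} {H : Homotopy f g} : IsHomotopyC H ↔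
    IsMat (H.hom 0 (-1)) (casimirData k n E).h₀ ∧ IsMat (H.hom 1 0) (casimirData k n E).h₁ := by
  rw [CasimirData.h₀, CasimirData.h₁, casimirData_E_S, casimirData_E_P, casimirData_E_T]
  exact ⟨fun h => ⟨hasMatrix_iff.1 h.1, hasMatrix_iff.1 h.2⟩,
    fun h => ⟨hasMatrix_iff.2 h.1, hasMatrix_iff.2 h.2⟩⟩

theorem isHomotopyσC_iff {h : n + n' = 0} {f g : σC k n h ⟶ σC k n h} {H : Homotopy f g} :
    IsHomotopyσC h H ↔
    IsMat (H.hom 0 (-1)) (casimirData k n F).h₀ ∧ IsMat (H.hom 1 0) (casimirData k n F).h₁ := by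
  rw [CasimirData.h₀, CasimirData.h₁, casimirData_F_S, casimirData_F_P, casimirData_F_T]
  exact ⟨fun h => ⟨hasMatrix_iff.1 h.1, hasMatrix_iff.1 h.2⟩,
    fun h => ⟨hasMatrix_iff.2 h.1, hasMatrix_iff.2 h.2⟩⟩

/-! ### The differentials -/

theorem isMat_casimir_d₀ (s : Strand) :
    IsMat ((casimir k s n).d (-1) 0) (casimirData k n s).d₀ := ⟨rfl, rfl, rfl, rfl⟩

theorem isMat_casimir_d₁ (s : Strand) :
    IsMat ((casimir k s n).d 0 1) (casimirData k n s).d₁ := ⟨rfl, rfl, rfl, rfl⟩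

/-- The reflection turns `EF` into `FE` and keeps the orientation of each dotted strand, so `σ(C
1_{-n})` has the differential of `C' 1_n`. Everything computes on diagrams. -/
theorem isMat_σC_d₀ (h : n + n' = 0) : IsMat ((σC k n h).d (-1) 0) (casimirData k n F).d₀ :=
  ⟨rfl, rfl, rfl, rfl⟩

theorem isMat_σC_d₁ (h : n + n' = 0) : IsMat ((σC k n h).d 0 1) (casimirData k n F).d₁ :=
  ⟨rfl, rfl, rfl, rfl⟩

/-- The composite `σω` restores the word `EF`, the cup and the cap, but interchanges the dots on the
two strands. -/
theorem isMat_σωC_d₀ (h : n + n' = 0) : IsMat ((σωC k n h).d (-1) 0)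
    ⟨(casimirData k n E).xF, (casimirData k n E).η, (casimirData k n E).xE,
      (casimirData k n E).η⟩ := ⟨rfl, rfl, rfl, rfl⟩

theorem isMat_σωC_d₁ (h : n + n' = 0) : IsMat ((σωC k n h).d 0 1)
    ⟨-(casimirData k n E).xE, (casimirData k n E).xF, (casimirData k n E).ε,
      -(casimirData k n E).ε⟩ := ⟨rfl, rfl, rfl, rfl⟩

/-- This is the transpose of the differential from degree 0 to 1, with caps turned into cups. The
signs of that differential are inherited. -/
theorem isMat_ψC_d₀ : IsMat ((ψC k n).d (-1) 0)
    ⟨-(casimirData k n E).xF, (casimirData k n E).η, (casimirData k n E).xE,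
      -(casimirData k n E).η⟩ := ⟨rfl, rfl, rfl, rfl⟩

theorem isMat_ψC_d₁ : IsMat ((ψC k n).d 0 1)
    ⟨(casimirData k n E).xE, (casimirData k n E).xF, (casimirData k n E).ε,
      (casimirData k n E).ε⟩ := ⟨rfl, rfl, rfl, rfl⟩

/-! ### The complexes are concentrated in the degrees `-1`, `0`, `1` -/

theorem threeTerm_casimir (s : Strand) : ThreeTerm (casimir k s n) :=
  ⟨fun _ => Fin.isEmpty, fun _ => Fin.isEmpty⟩

theorem ThreeTerm.sigma {m m' : ℤ} {X : Kom k n m} (hX : ThreeTerm X) (h : n + n' = 0)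
    (h' : m + m' = 0) : ThreeTerm ((sigma k h h').obj X) := ⟨hX.pos, hX.neg⟩

theorem ThreeTerm.omega {m m' : ℤ} {X : Kom k n m} (hX : ThreeTerm X) (h : n + n' = 0)
    (h' : m + m' = 0) : ThreeTerm ((omega k h h').obj X) := ⟨hX.pos, hX.neg⟩

theorem ThreeTerm.psi {m : ℤ} {X : Kom k n m} (hX : ThreeTerm X) :
    ThreeTerm ((psi k n m).obj (.op X)) :=
  ⟨fun i => hX.neg i, fun i => hX.pos i⟩

end

end CatSL2

namespace CatSL2

open Strand CasimirData

/-! ### Matrix identities -/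

section

variable {k : Type u} [CommRing k] {n : ℤ} {a : Word} (A : CasimirData k n a)

namespace CasimirData

/-- The image under `ψ` of the differential from degree `0` to `1`. -/
def psiD₀ : HomMat k n a [] a a := ⟨-A.xF, A.η, A.xE, -A.η⟩

/-- The image under `ψ` of the differential from degree `-1` to `0`. -/
def psiD₁ : HomMat k n a a a [] := ⟨A.xE, A.xF, A.ε, A.ε⟩

/-- The image under `σω` of the differential from degree `-1` to `0`. -/
def swapD₀ : HomMat k n a [] a a := ⟨A.xF, A.η, A.xE, A.η⟩

/-- The image under `σω` of the differential from degree `0` to `1`. -/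
def swapD₁ : HomMat k n a a a [] := ⟨-A.xE, A.xF, A.ε, -A.ε⟩

/-- The quarter turn in degree 0 exchanges the rows of the differential up to a sign, and the
diagonal signs in the degrees -1 and 1 make up for it. -/
theorem d₀_psiZero :
    A.d₀.comp (.psiZero k n a) = (HomMat.psiNeg k n a).comp A.psiD₀ := by
  ext1 <;> simp [HomMat.comp, d₀, psiD₀, HomMat.psiNeg, HomMat.psiZero]

theorem d₁_psiOne :
    A.d₁.comp (.psiOne k n a) = (HomMat.psiZero k n a).comp A.psiD₁ := by
  ext1 <;> simp [HomMat.comp, d₁, psiD₁, HomMat.psiZero, HomMat.psiOne]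

theorem psiD₀_psiZero_neg :
    A.psiD₀.comp ⟨0, -.id a, .id a, 0⟩ = (HomMat.psiNeg k n a).comp A.d₀ := by
  ext1 <;> simp [HomMat.comp, d₀, psiD₀, HomMat.psiNeg]

theorem psiD₁_psiOne :
    A.psiD₁.comp (.psiOne k n a) = HomMat.comp ⟨0, -.id a, .id a, 0⟩ A.d₁ := by
  ext1 <;> simp [HomMat.comp, d₁, psiD₁, HomMat.psiOne]

theorem d₀_swap :
    A.d₀.comp (.swap k n a) = (HomMat.one k n a []).comp A.swapD₀ := by
  ext1 <;> simp [HomMat.comp, d₀, swapD₀, HomMat.one, HomMat.swap]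

theorem d₁_neg_one :
    A.d₁.comp ⟨-.id a, 0, 0, -.id []⟩ = (HomMat.swap k n a).comp A.swapD₁ := by
  ext1 <;> simp [HomMat.comp, d₁, swapD₁, HomMat.swap]

theorem swapD₀_swap :
    A.swapD₀.comp (.swap k n a) = (HomMat.one k n a []).comp A.d₀ := by
  ext1 <;> simp [HomMat.comp, d₀, swapD₀, HomMat.one, HomMat.swap]

theorem swapD₁_neg_one :
    A.swapD₁.comp ⟨-.id a, 0, 0, -.id []⟩ = (HomMat.swap k n a).comp A.d₁ := by
  ext1 <;> simp [HomMat.comp, d₁, swapD₁, HomMat.swap]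

end CasimirData

end

/-! ### Existence of the chain maps -/

section

variable {k : Type u} [CommRing k] {n n' : ℤ}

/-! ### Degrees of the entries of the matrices -/

theorem TwoHom.id_mem_deg {d : ℤ} (a : Word) (hd : d = 0) :
    (TwoHom.id a : TwoHom k n a a) ∈ deg k n d a a := hd ▸ mk_mem (.id a)

variable {d : ℤ} (s : Strand)

theorem casimirData_T_mem (hd : d = s.sgn * n - 1) : (casimirData k n s).T ∈ TwoHom.deg k n d _ _ :=
  TwoHom.mk_mem ((Diag.IsHomogeneous.bubbleCup _ _ _).cast (by rw [hd]; ring))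

theorem casimirData_S_mem (hd : d = s.sgn * n - 1) : (casimirData k n s).S ∈ TwoHom.deg k n d _ _ :=
  TwoHom.mk_mem ((Diag.IsHomogeneous.capBubble _ _ _).cast (by rw [hd]; ring))

theorem casimirData_P_mem (hd : d = -2) : (casimirData k n s).P ∈ TwoHom.deg k n d _ _ :=
  TwoHom.mk_mem ((Diag.IsHomogeneous.capBubbleCup _ _ _).cast (by rw [hd]; ring))

theorem casimirData_c_mem (hd : d = 2 * (s.sgn * n)) :
    (casimirData k n s).c ∈ TwoHom.deg k n d _ _ :=
  TwoHom.mk_mem ((Diag.IsHomogeneous.bubble _ _ rfl _).cast (by rw [hd]))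

theorem casimirData_η_mem (hd : d = 1 - s.sgn * n) : (casimirData k n s).η ∈ TwoHom.deg k n d _ _ :=
  TwoHom.mk_mem ((Diag.IsHomogeneous.cup _ _).cast (by rw [hd]; rfl))

theorem casimirData_ε_mem (hd : d = 1 - s.sgn * n) : (casimirData k n s).ε ∈ TwoHom.deg k n d _ _ :=
  TwoHom.mk_mem ((Diag.IsHomogeneous.cap _ _).cast (by rw [hd]; rfl))

theorem signedSide_mem (hd : d = 0) : signedSide k n s ∈ TwoHom.deg k n d _ _ := by
  cases s
  · exact TwoHom.mk_mem ((Diag.IsHomogeneous.side E _).cast hd.symm)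
  · exact TwoHom.neg_mem (TwoHom.mk_mem ((Diag.IsHomogeneous.side F _).cast hd.symm))

end

/-! ### Construction of the six families of chain maps -/

section

variable {k : Type u} [CommRing k] {n n' : ℤ}

theorem exists_isRhoSigma (h : n + n' = 0) : ∃ φ : C k n ⟶ σC k n h, IsRhoSigma h φ := by
  obtain rfl : n' = -n := by omega
  have h₀ : ∃ f : (C k n).X (-1) ⟶ (σC k n h).X (-1),
      IsMat f (rhoNeg (casimirData k n E) (casimirData k n F) (signedSide k n E)) :=
    IsMat.exists_of_mem _ (signedSide_mem E rfl)
      -- In each such equation the left side is the shift of the source minus the shift of the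
      -- target, the right side the degree of the entry. Here the map is from `1_n {1 - n}` to `FE
      -- {2}`.
      (TwoHom.neg_mem (casimirData_T_mem F (show (1 - 1 * n) - 2 = -1 * n - 1 by ring)))
      (TwoHom.neg_mem (casimirData_ε_mem E (show 2 - (1 - 1 * -n) = 1 - 1 * n by ring)))
      (TwoHom.neg_mem (casimirData_c_mem F
        (show (1 - 1 * n) - (1 - 1 * -n) = 2 * (-1 * n) by ring)))
  have h₁ : ∃ f : (C k n).X 0 ⟶ (σC k n h).X 0, IsMat f (rhoZero (signedSide k n E)) :=
    IsMat.exists_of_mem _ (signedSide_mem E rfl) (Submodule.zero_mem _) (Submodule.zero_mem _)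
      (signedSide_mem E rfl)
  have h₂ : ∃ f : (C k n).X 1 ⟶ (σC k n h).X 1,
      IsMat f (rhoOne (casimirData k n E) (casimirData k n F) (signedSide k n E)) :=
    IsMat.exists_of_mem _ (signedSide_mem E rfl)
      (TwoHom.neg_mem (casimirData_η_mem F (show (1 * n - 1) - -2 = 1 - -1 * n by ring)))
      (TwoHom.neg_mem (casimirData_S_mem E (show -2 - (1 * -n - 1) = 1 * n - 1 by ring)))
      (casimirData_c_mem E (show (1 * n - 1) - (1 * -n - 1) = 2 * (1 * n) by ring))
  obtain ⟨f₀, h₀⟩ := h₀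
  obtain ⟨f₁, h₁⟩ := h₁
  obtain ⟨f₂, h₂⟩ := h₂
  obtain ⟨φ, e₀, e₁, e₂⟩ := (threeTerm_casimir (k := k) (n := n) E).exists_hom
    ((threeTerm_casimir E).sigma (neg_symm h) (neg_symm h)) f₀ f₁ f₂
    (((isMat_casimir_d₀ E).comp h₁).ext ((h₀.comp (isMat_σC_d₀ h)).congr
      (casimirData_outer_E.d₀_rhoZero (casimirData_inner F)).symm))
    (((isMat_casimir_d₁ E).comp h₂).ext ((h₁.comp (isMat_σC_d₁ h)).congr
      (casimirData_outer_E.d₁_rhoOne (casimirData_inner E)).symm))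
  refine ⟨φ, isRhoSigma_iff.2 ?_⟩
  rw [e₀, e₁, e₂]
  exact ⟨h₀, h₁, h₂⟩

theorem exists_isRhoHatSigma (h : n + n' = 0) : ∃ φ : σC k n h ⟶ C k n, IsRhoHatSigma h φ := by
  obtain rfl : n' = -n := by omega
  have h₀ : ∃ f : (σC k n h).X (-1) ⟶ (C k n).X (-1),
      IsMat f (rhoNeg (casimirData k n F) (casimirData k n E) (signedSide k n F)) :=
    IsMat.exists_of_mem _ (signedSide_mem F rfl)
      (TwoHom.neg_mem (casimirData_T_mem E (show (1 - 1 * -n) - 2 = 1 * n - 1 by ring)))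
      (TwoHom.neg_mem (casimirData_ε_mem F (show 2 - (1 - 1 * n) = 1 - -1 * n by ring)))
      (TwoHom.neg_mem (casimirData_c_mem E
        (show (1 - 1 * -n) - (1 - 1 * n) = 2 * (1 * n) by ring)))
  have h₁ : ∃ f : (σC k n h).X 0 ⟶ (C k n).X 0, IsMat f (rhoZero (signedSide k n F)) :=
    IsMat.exists_of_mem _ (signedSide_mem F rfl) (Submodule.zero_mem _) (Submodule.zero_mem _)
      (signedSide_mem F rfl)
  have h₂ : ∃ f : (σC k n h).X 1 ⟶ (C k n).X 1,
      IsMat f (rhoOne (casimirData k n F) (casimirData k n E) (signedSide k n F)) :=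
    IsMat.exists_of_mem _ (signedSide_mem F rfl)
      (TwoHom.neg_mem (casimirData_η_mem E (show (1 * -n - 1) - -2 = 1 - 1 * n by ring)))
      (TwoHom.neg_mem (casimirData_S_mem F (show -2 - (1 * n - 1) = -1 * n - 1 by ring)))
      (casimirData_c_mem F (show (1 * -n - 1) - (1 * n - 1) = 2 * (-1 * n) by ring))
  obtain ⟨f₀, h₀⟩ := h₀
  obtain ⟨f₁, h₁⟩ := h₁
  obtain ⟨f₂, h₂⟩ := h₂
  obtain ⟨φ, e₀, e₁, e₂⟩ := ((threeTerm_casimir E).sigma (neg_symm h) (neg_symm h)).exists_hom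
    (threeTerm_casimir (k := k) (n := n) E) f₀ f₁ f₂
    (((isMat_σC_d₀ h).comp h₁).ext ((h₀.comp (isMat_casimir_d₀ E)).congr
      (casimirData_outer_F.d₀_rhoZero (casimirData_inner E)).symm))
    (((isMat_σC_d₁ h).comp h₂).ext ((h₁.comp (isMat_casimir_d₁ E)).congr
      (casimirData_outer_F.d₁_rhoOne (casimirData_inner F)).symm))
  refine ⟨φ, isRhoHatSigma_iff.2 ?_⟩
  rw [e₀, e₁, e₂]
  exact ⟨h₀, h₁, h₂⟩

theorem exists_isRhoPsi (n : ℤ) : ∃ φ : C k n ⟶ ψC k n, IsRhoPsi φ := by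
  have h₀ : ∃ f : (C k n).X (-1) ⟶ (ψC k n).X (-1), IsMat f (.psiNeg k n [E, F]) :=
    IsMat.exists_of_mem _ (TwoHom.neg_mem (TwoHom.id_mem_deg _ rfl)) (Submodule.zero_mem _)
      (Submodule.zero_mem _)
      (TwoHom.id_mem_deg _ (show (1 - 1 * n) - -(1 * n - 1) = 0 by ring))
  have h₁ : ∃ f : (C k n).X 0 ⟶ (ψC k n).X 0, IsMat f (.psiZero k n [E, F]) :=
    IsMat.exists_of_mem _ (Submodule.zero_mem _) (TwoHom.id_mem_deg _ rfl)
      (TwoHom.neg_mem (TwoHom.id_mem_deg _ rfl)) (Submodule.zero_mem _)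
  have h₂ : ∃ f : (C k n).X 1 ⟶ (ψC k n).X 1, IsMat f (.psiOne k n [E, F]) :=
    IsMat.exists_of_mem _ (TwoHom.id_mem_deg _ rfl) (Submodule.zero_mem _)
      (Submodule.zero_mem _)
      (TwoHom.neg_mem (TwoHom.id_mem_deg _ (show (1 * n - 1) - -(1 - 1 * n) = 0 by ring)))
  obtain ⟨f₀, h₀⟩ := h₀
  obtain ⟨f₁, h₁⟩ := h₁
  obtain ⟨f₂, h₂⟩ := h₂
  obtain ⟨φ, e₀, e₁, e₂⟩ := (threeTerm_casimir (k := k) (n := n) E).exists_hom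
    (threeTerm_casimir E).psi f₀ f₁ f₂
    (((isMat_casimir_d₀ E).comp h₁).ext ((h₀.comp isMat_ψC_d₀).congr
      (d₀_psiZero (casimirData k n E)).symm))
    (((isMat_casimir_d₁ E).comp h₂).ext ((h₁.comp isMat_ψC_d₁).congr
      (d₁_psiOne (casimirData k n E)).symm))
  refine ⟨φ, isRhoPsi_iff.2 ?_⟩
  rw [e₀, e₁, e₂]
  exact ⟨h₀, h₁, h₂⟩

theorem exists_isRhoHatPsi (n : ℤ) : ∃ φ : ψC k n ⟶ C k n, IsRhoHatPsi φ := by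
  have h₀ : ∃ f : (ψC k n).X (-1) ⟶ (C k n).X (-1), IsMat f (.psiNeg k n [E, F]) :=
    IsMat.exists_of_mem _ (TwoHom.neg_mem (TwoHom.id_mem_deg _ rfl)) (Submodule.zero_mem _)
      (Submodule.zero_mem _)
      (TwoHom.id_mem_deg _ (show -(1 * n - 1) - (1 - 1 * n) = 0 by ring))
  have h₁ : ∃ f : (ψC k n).X 0 ⟶ (C k n).X 0, IsMat f ⟨0, -.id [E, F], .id [E, F], 0⟩ :=
    IsMat.exists_of_mem _ (Submodule.zero_mem _)
      (TwoHom.neg_mem (TwoHom.id_mem_deg _ rfl)) (TwoHom.id_mem_deg _ rfl) (Submodule.zero_mem _)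
  have h₂ : ∃ f : (ψC k n).X 1 ⟶ (C k n).X 1, IsMat f (.psiOne k n [E, F]) :=
    IsMat.exists_of_mem _ (TwoHom.id_mem_deg _ rfl) (Submodule.zero_mem _)
      (Submodule.zero_mem _)
      (TwoHom.neg_mem (TwoHom.id_mem_deg _ (show -(1 - 1 * n) - (1 * n - 1) = 0 by ring)))
  obtain ⟨f₀, h₀⟩ := h₀
  obtain ⟨f₁, h₁⟩ := h₁
  obtain ⟨f₂, h₂⟩ := h₂
  obtain ⟨φ, e₀, e₁, e₂⟩ := (threeTerm_casimir (k := k) (n := n) E).psi.exists_hom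
    (threeTerm_casimir E) f₀ f₁ f₂
    ((isMat_ψC_d₀.comp h₁).ext ((h₀.comp (isMat_casimir_d₀ E)).congr
      (psiD₀_psiZero_neg (casimirData k n E)).symm))
    ((isMat_ψC_d₁.comp h₂).ext ((h₁.comp (isMat_casimir_d₁ E)).congr
      (psiD₁_psiOne (casimirData k n E)).symm))
  refine ⟨φ, isRhoHatPsi_iff.2 ?_⟩
  rw [e₀, e₁, e₂]
  exact ⟨h₀, h₁, h₂⟩

theorem exists_isRhoSigmaOmega (h : n + n' = 0) :
    ∃ φ : C k n ⟶ σωC k n h, IsRhoSigmaOmega h φ := by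
  have h₀ : ∃ f : (C k n).X (-1) ⟶ (σωC k n h).X (-1), IsMat f (.one k n [E, F] []) :=
    IsMat.exists_of_mem _ (TwoHom.id_mem_deg _ rfl) (Submodule.zero_mem _)
      (Submodule.zero_mem _) (TwoHom.id_mem_deg _ (sub_self _))
  have h₁ : ∃ f : (C k n).X 0 ⟶ (σωC k n h).X 0, IsMat f (.swap k n [E, F]) :=
    IsMat.exists_of_mem _ (Submodule.zero_mem _) (TwoHom.id_mem_deg _ rfl)
      (TwoHom.id_mem_deg _ rfl) (Submodule.zero_mem _)
  have h₂ : ∃ f : (C k n).X 1 ⟶ (σωC k n h).X 1, IsMat f ⟨-.id [E, F], 0, 0, -.id []⟩ :=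
    IsMat.exists_of_mem _ (TwoHom.neg_mem (TwoHom.id_mem_deg _ rfl)) (Submodule.zero_mem _)
      (Submodule.zero_mem _) (TwoHom.neg_mem (TwoHom.id_mem_deg _ (sub_self _)))
  obtain ⟨f₀, h₀⟩ := h₀
  obtain ⟨f₁, h₁⟩ := h₁
  obtain ⟨f₂, h₂⟩ := h₂
  obtain ⟨φ, e₀, e₁, e₂⟩ := (threeTerm_casimir (k := k) (n := n) E).exists_hom
    (((threeTerm_casimir E).omega h h).sigma (neg_symm h) (neg_symm h)) f₀ f₁ f₂
    (((isMat_casimir_d₀ E).comp h₁).ext ((h₀.comp (isMat_σωC_d₀ h)).congr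
      (d₀_swap (casimirData k n E)).symm))
    (((isMat_casimir_d₁ E).comp h₂).ext ((h₁.comp (isMat_σωC_d₁ h)).congr
      (d₁_neg_one (casimirData k n E)).symm))
  refine ⟨φ, isRhoSigmaOmega_iff.2 ?_⟩
  rw [e₀, e₁, e₂]
  exact ⟨h₀, h₁, h₂⟩

theorem exists_isRhoHatSigmaOmega (h : n + n' = 0) :
    ∃ φ : σωC k n h ⟶ C k n, IsRhoHatSigmaOmega h φ := by
  have h₀ : ∃ f : (σωC k n h).X (-1) ⟶ (C k n).X (-1), IsMat f (.one k n [E, F] []) :=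
    IsMat.exists_of_mem _ (TwoHom.id_mem_deg _ rfl) (Submodule.zero_mem _)
      (Submodule.zero_mem _) (TwoHom.id_mem_deg _ (sub_self _))
  have h₁ : ∃ f : (σωC k n h).X 0 ⟶ (C k n).X 0, IsMat f (.swap k n [E, F]) :=
    IsMat.exists_of_mem _ (Submodule.zero_mem _) (TwoHom.id_mem_deg _ rfl)
      (TwoHom.id_mem_deg _ rfl) (Submodule.zero_mem _)
  have h₂ : ∃ f : (σωC k n h).X 1 ⟶ (C k n).X 1, IsMat f ⟨-.id [E, F], 0, 0, -.id []⟩ :=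
    IsMat.exists_of_mem _ (TwoHom.neg_mem (TwoHom.id_mem_deg _ rfl)) (Submodule.zero_mem _)
      (Submodule.zero_mem _) (TwoHom.neg_mem (TwoHom.id_mem_deg _ (sub_self _)))
  obtain ⟨f₀, h₀⟩ := h₀
  obtain ⟨f₁, h₁⟩ := h₁
  obtain ⟨f₂, h₂⟩ := h₂
  obtain ⟨φ, e₀, e₁, e₂⟩ :=
    (((threeTerm_casimir E).omega h h).sigma (neg_symm h) (neg_symm h)).exists_hom
    (threeTerm_casimir (k := k) (n := n) E) f₀ f₁ f₂
    (((isMat_σωC_d₀ h).comp h₁).ext ((h₀.comp (isMat_casimir_d₀ E)).congr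
      (swapD₀_swap (casimirData k n E)).symm))
    (((isMat_σωC_d₁ h).comp h₂).ext ((h₁.comp (isMat_casimir_d₁ E)).congr
      (swapD₁_neg_one (casimirData k n E)).symm))
  refine ⟨φ, isRhoHatSigmaOmega_iff.2 ?_⟩
  rw [e₀, e₁, e₂]
  exact ⟨h₀, h₁, h₂⟩

variable (k) in
-- The choice is harmless, because the formulas determine the maps in the only degrees where the
-- complexes have nonempty terms.
theorem exists_isExplicit : ∃ r : Maps k, r.IsExplicit := by
  choose ρψ hρψ using exists_isRhoPsi (k := k)
  choose ρψ' hρψ' using exists_isRhoHatPsi (k := k)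
  choose ρσω hρσω using fun {n n' : ℤ} (h : n + n' = 0) => exists_isRhoSigmaOmega (k := k) h
  choose ρσω' hρσω' using fun {n n' : ℤ} (h : n + n' = 0) => exists_isRhoHatSigmaOmega (k := k) h
  choose ρσ hρσ using fun {n n' : ℤ} (h : n + n' = 0) => exists_isRhoSigma (k := k) h
  choose ρσ' hρσ' using fun {n n' : ℤ} (h : n + n' = 0) => exists_isRhoHatSigma (k := k) h
  exact ⟨⟨ρψ, ρψ', ρσω, ρσω', ρσ, ρσ'⟩, ⟨hρψ, hρψ', hρσω, hρσω', hρσ, hρσ'⟩⟩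

end

end CatSL2

namespace CatSL2

open Strand CasimirData

/-! ### The symmetries on the data of the Casimir complexes -/

section

variable {k : Type u} [CommRing k] {n n' : ℤ}

theorem Diag.omega_bubbleCup (s s' : Strand) (w N : ℤ) :
    omega (bubbleCup k s s' w N) = bubbleCup k s.flip s'.flip (-w) N := by
  rw [bubbleCup, omega_sum₂]
  refine congrArg (sum₂ N) (funext fun i => funext fun j => ?_)
  exact congrArg₂ Diag.comp (omega_bubble s' w j []) (omega_dotCup s i [])

theorem Diag.omega_capBubble (s s' : Strand) (w N : ℤ) :
    omega (capBubble k s s' w N) = capBubble k s.flip s'.flip (-w) N := by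
  rw [capBubble, omega_sum₂]
  refine congrArg (sum₂ N) (funext fun i => funext fun j => ?_)
  exact congrArg₂ Diag.comp (omega_dotCap s i []) (omega_bubble s' w j [])

/-- Since `ψ` reverses compositions, it fixes dotted strands and fake bubbles only modulo the
relations. The statement is therefore one about 2-morphisms, whereas for `ω` the diagrams themselves
agree. -/
theorem Diag.psi_bubbleCup (s s' : Strand) (w N : ℤ) :
    (TwoHom.mk (psi (bubbleCup k s s' w N)) : TwoHom k n _ _) =
      TwoHom.mk (capBubble k s s' w N) := by
  rw [bubbleCup, capBubble, sum₂, sum₂, psi_sumRange, TwoHom.mk_sumRange, TwoHom.mk_sumRange]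
  exact Finset.sum_congr rfl fun i _ => congrArg₂ (fun x y => TwoHom.comp x y)
    (psi_dotCup s [] i) (psi_bubble s' w _ [])

theorem Diag.psi_capBubble (s s' : Strand) (w N : ℤ) :
    (TwoHom.mk (psi (capBubble k s s' w N)) : TwoHom k n _ _) =
      TwoHom.mk (bubbleCup k s s' w N) := by
  rw [bubbleCup, capBubble, sum₂, sum₂, psi_sumRange, TwoHom.mk_sumRange, TwoHom.mk_sumRange]
  exact Finset.sum_congr rfl fun i _ => congrArg₂ (fun x y => TwoHom.comp x y)
    (psi_bubble s' w _ []) (psi_dotCap s [] i)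

theorem psi_casimirData_T (s : Strand) :
    TwoHom.psi (casimirData k n s).T = (casimirData k n s).S := Diag.psi_bubbleCup _ _ _ _

theorem psi_casimirData_S (s : Strand) :
    TwoHom.psi (casimirData k n s).S = (casimirData k n s).T := Diag.psi_capBubble _ _ _ _

theorem psi_casimirData_c (s : Strand) :
    TwoHom.psi (casimirData k n s).c = (casimirData k n s).c := Diag.psi_bubble _ _ _ _

/-- The reflected crossing is the other rotation `side'` of the upward crossing, which equals `side`
by cyclicity. The minus sign of the crossing back survives, and it makes the squares containing
`ϱ^σ` anticommute. -/
theorem psi_signedSide_F : TwoHom.psi (signedSide k n F) = -signedSide k n E :=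
  (map_neg TwoHom.psi _).trans
    (congrArg (-·) ((Diag.psi_side F []).trans (TwoHom.side'_eq_side E [])))

variable (h : n + n' = 0)

/-- The rescaling of crossings by -1 under `ω` is exactly the sign by which `signedSide` treats the
two letters differently. -/
theorem omega_signedSide_E : TwoHom.omega h (signedSide k n E) = signedSide k n' F :=
  (Diag.side_omega E []).trans (neg_one_smul k _)

theorem omega_signedSide_F : TwoHom.omega h (signedSide k n F) = signedSide k n' E :=
  (map_neg (TwoHom.omega h) _).trans ((congrArg (-·)
    ((Diag.side_omega F []).trans (neg_one_smul k _))).trans (neg_neg _))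

theorem omega_casimirData_T_E :
    TwoHom.omega h (casimirData k n E).T = (casimirData k n' F).T := by
  obtain rfl : n = -n' := by omega
  rw [casimirData_E_T, casimirData_F_T]
  exact congrArg TwoHom.mk ((Diag.omega_bubbleCup _ _ _ _).trans (by rw [neg_neg]))

theorem omega_casimirData_T_F :
    TwoHom.omega h (casimirData k n F).T = (casimirData k n' E).T := by
  obtain rfl : n = -n' := by omega
  rw [casimirData_E_T, casimirData_F_T]
  exact congrArg TwoHom.mk ((Diag.omega_bubbleCup _ _ _ _).trans (by rw [neg_neg]))

theorem omega_casimirData_S_E :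
    TwoHom.omega h (casimirData k n E).S = (casimirData k n' F).S := by
  obtain rfl : n = -n' := by omega
  rw [casimirData_E_S, casimirData_F_S]
  exact congrArg TwoHom.mk ((Diag.omega_capBubble _ _ _ _).trans (by rw [neg_neg]))

theorem omega_casimirData_S_F :
    TwoHom.omega h (casimirData k n F).S = (casimirData k n' E).S := by
  obtain rfl : n = -n' := by omega
  rw [casimirData_E_S, casimirData_F_S]
  exact congrArg TwoHom.mk ((Diag.omega_capBubble _ _ _ _).trans (by rw [neg_neg]))

theorem omega_casimirData_c_E :
    TwoHom.omega h (casimirData k n E).c = (casimirData k n' F).c := by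
  obtain rfl : n = -n' := by omega
  rw [casimirData_E_c, casimirData_F_c]
  exact congrArg TwoHom.mk ((Diag.omega_bubble _ _ _ _).trans (by rw [neg_neg]; rfl))

theorem omega_casimirData_c_F :
    TwoHom.omega h (casimirData k n F).c = (casimirData k n' E).c := by
  obtain rfl : n = -n' := by omega
  rw [casimirData_E_c, casimirData_F_c]
  exact congrArg TwoHom.mk ((Diag.omega_bubble _ _ _ _).trans (by rw [neg_neg]; rfl))

end

/-! ### The symmetries on matrices -/

section

variable {k : Type u} [CommRing k] {n n' m m' : ℤ}

namespace HomMat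

variable {a₀ a₁ b₀ b₁ : Word}

/-- The image of a matrix under `ω`. -/
def omega (h : n + n' = 0) (M : HomMat k n a₀ a₁ b₀ b₁) :
    HomMat k n' (a₀.map flip) (a₁.map flip) (b₀.map flip) (b₁.map flip) :=
  ⟨TwoHom.omega h M.a, TwoHom.omega h M.b, TwoHom.omega h M.c, TwoHom.omega h M.d⟩

/-- The image of a matrix under `σ`. -/
def sigma (h₀ : wt n a₀ + n' = 0) (h₁ : wt n a₁ + n' = 0) (M : HomMat k n a₀ a₁ b₀ b₁) :
    HomMat k n' a₀.reverse a₁.reverse b₀.reverse b₁.reverse :=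
  ⟨TwoHom.sigma h₀ M.a, TwoHom.sigma h₁ M.b, TwoHom.sigma h₀ M.c, TwoHom.sigma h₁ M.d⟩

/-- The image of a matrix under `ψ`. -/
def psi (M : HomMat k n a₀ a₁ b₀ b₁) : HomMat k n b₀ b₁ a₀ a₁ :=
  ⟨TwoHom.psi M.a, TwoHom.psi M.c, TwoHom.psi M.b, TwoHom.psi M.d⟩

theorem psi_comp {c₀ c₁ : Word} (M : HomMat k n a₀ a₁ b₀ b₁) (N : HomMat k n b₀ b₁ c₀ c₁) :
    (M.comp N).psi = N.psi.comp M.psi := by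
  ext1 <;> simp only [comp, psi, map_add, TwoHom.psi_comp]

end HomMat

namespace IsMat

variable {X Y W Z : Fin 2 → Ob k n m} {φ : (⟨Fin 2, X⟩ : U k n m) ⟶ ⟨Fin 2, Y⟩}
  {M : HomMat k n (X 0).seq (X 1).seq (Y 0).seq (Y 1).seq}

theorem omega (hφ : IsMat φ M) (h : n + n' = 0) (h' : m + m' = 0) :
    IsMat ((omegaOb k h h').mapMat_.map φ) (M.omega h) :=
  ⟨congrArg _ hφ.a, congrArg _ hφ.b, congrArg _ hφ.c, congrArg _ hφ.d⟩

theorem sigma (hφ : IsMat φ M) (h : n + n' = 0) (h' : m + m' = 0) :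
    IsMat ((sigmaOb k h h').mapMat_.map φ)
      (M.sigma (by rw [(X 0).wt_seq, h']) (by rw [(X 1).wt_seq, h'])) :=
  ⟨congrArg _ hφ.a, congrArg _ hφ.b, congrArg _ hφ.c, congrArg _ hφ.d⟩

theorem psi (hφ : IsMat φ M) : IsMat ((psiMat k n m).map φ.op) M.psi :=
  ⟨congrArg _ hφ.a, congrArg _ hφ.c, congrArg _ hφ.b, congrArg _ hφ.d⟩

/-- The identifications between images under symmetries do not change the entries of a matrix. The
hypotheses are heterogeneous because the words of `Y` and `Z` are only propositionally equal. For
the concrete words of the cube they compute, and `HEq.rfl` suffices. -/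
theorem comp_eqToHom (hφ : IsMat φ M) (e : (⟨Fin 2, Y⟩ : U k n m) = ⟨Fin 2, Z⟩)
    {N : HomMat k n (X 0).seq (X 1).seq (Z 0).seq (Z 1).seq}
    (ha : HEq M.a N.a) (hb : HEq M.b N.b) (hc : HEq M.c N.c) (hd : HEq M.d N.d) :
    IsMat (φ ≫ eqToHom e) N := by
  obtain rfl : Y = Z := by simpa using e
  rw [eqToHom_refl, Category.comp_id]
  exact ⟨hφ.a.trans (eq_of_heq ha), hφ.b.trans (eq_of_heq hb), hφ.c.trans (eq_of_heq hc),
    hφ.d.trans (eq_of_heq hd)⟩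

theorem eqToHom_comp (hφ : IsMat φ M) (e : (⟨Fin 2, W⟩ : U k n m) = ⟨Fin 2, X⟩)
    {N : HomMat k n (W 0).seq (W 1).seq (Y 0).seq (Y 1).seq}
    (ha : HEq M.a N.a) (hb : HEq M.b N.b) (hc : HEq M.c N.c) (hd : HEq M.d N.d) :
    IsMat (eqToHom e ≫ φ) N := by
  obtain rfl : W = X := by simpa using e
  rw [eqToHom_refl, Category.id_comp]
  exact ⟨hφ.a.trans (eq_of_heq ha), hφ.b.trans (eq_of_heq hb), hφ.c.trans (eq_of_heq hc),
    hφ.d.trans (eq_of_heq hd)⟩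

theorem eqToHom_comp_eqToHom (hφ : IsMat φ M) (e : (⟨Fin 2, W⟩ : U k n m) = ⟨Fin 2, X⟩)
    (e' : (⟨Fin 2, Y⟩ : U k n m) = ⟨Fin 2, Z⟩)
    {N : HomMat k n (W 0).seq (W 1).seq (Z 0).seq (Z 1).seq}
    (ha : HEq M.a N.a) (hb : HEq M.b N.b) (hc : HEq M.c N.c) (hd : HEq M.d N.d) :
    IsMat (eqToHom e ≫ φ ≫ eqToHom e') N := by
  obtain rfl : W = X := by simpa using e
  obtain rfl : Y = Z := by simpa using e'
  rw [eqToHom_refl, eqToHom_refl, Category.comp_id, Category.id_comp]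
  exact ⟨hφ.a.trans (eq_of_heq ha), hφ.b.trans (eq_of_heq hb), hφ.c.trans (eq_of_heq hc),
    hφ.d.trans (eq_of_heq hd)⟩

theorem of_eq {ψ : (⟨Fin 2, X⟩ : U k n m) ⟶ ⟨Fin 2, Y⟩} (hφ : IsMat φ M) (e : ψ = φ) :
    IsMat ψ M := e ▸ hφ

end IsMat

theorem comp_eqToHom_f {X Y Z : Kom k n m} (f : X ⟶ Y) (e : Y = Z) (i : ℤ) :
    (f ≫ eqToHom e).f i = f.f i ≫ eqToHom (congrArg (fun W : Kom k n m => W.X i) e) := by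
  subst e; rfl

theorem eqToHom_comp_f {X Y Z : Kom k n m} (e : X = Y) (f : Y ⟶ Z) (i : ℤ) :
    (eqToHom e ≫ f).f i = eqToHom (congrArg (fun W : Kom k n m => W.X i) e) ≫ f.f i := by
  subst e; rfl

theorem eqToHom_comp_eqToHom_f {W X Y Z : Kom k n m} (e : W = X) (f : X ⟶ Y) (e' : Y = Z) (i : ℤ) :
    (eqToHom e ≫ f ≫ eqToHom e').f i = eqToHom (congrArg (fun W : Kom k n m => W.X i) e) ≫ f.f i ≫
      eqToHom (congrArg (fun W : Kom k n m => W.X i) e') := by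
  subst e e'; rfl

end

/-! ### Products of the matrices -/

namespace CasimirData

variable {k : Type u} [CommRing k] {n : ℤ} {a b : Word} (A : CasimirData k n a)
  (B : CasimirData k n b) (X : TwoHom k n a b)

/-- The map `ψ(ρ̂^σ)` in degree `-1`. -/
def psiRhoNeg : HomMat k n a [] b [] := ⟨-X, -B.T, -A.ε, B.c⟩

/-- The map `ψ(ρ̂^σ)` in degree `0`. -/
def psiRhoZero : HomMat k n a a b b := ⟨-X, 0, 0, -X⟩

/-- The map `ψ(ρ̂^σ)` in degree `1`. -/
def psiRhoOne : HomMat k n a [] b [] := ⟨-X, -B.η, -A.S, -A.c⟩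

end CasimirData

namespace HomMat

variable (k : Type u) [CommRing k] (n : ℤ) (a : Word)

/-- The map `ρ^{σω}` in degree `1`. -/
def negOne : HomMat k n a [] a [] := ⟨-.id a, 0, 0, -.id []⟩

end HomMat

section

open HomMat

variable {k : Type u} [CommRing k] {n : ℤ} {a b a₀ a₁ b₀ b₁ : Word}

theorem HomMat.comp_one (M : HomMat k n a₀ a₁ b₀ b₁) :
    M.comp (one k n b₀ b₁) = M := by
  ext1 <;> simp [comp, one]

theorem HomMat.one_comp (M : HomMat k n a₀ a₁ b₀ b₁) :
    (one k n a₀ a₁).comp M = M := by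
  ext1 <;> simp [comp, one]

theorem HomMat.psiNeg_comp_psiNeg :
    (psiNeg k n a).comp (psiNeg k n a) = one k n a [] := by
  ext1 <;> simp [comp, one, psiNeg]

theorem HomMat.psiOne_comp_psiOne :
    (psiOne k n a).comp (psiOne k n a) = one k n a [] := by
  ext1 <;> simp [comp, one, psiOne]

theorem HomMat.psiZero_comp_neg :
    (psiZero k n a).comp ⟨0, -.id a, .id a, 0⟩ = one k n a a := by
  ext1 <;> simp [comp, one, psiZero]

theorem HomMat.neg_comp_psiZero :
    comp ⟨0, -.id a, .id a, 0⟩ (psiZero k n a) = one k n a a := by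
  ext1 <;> simp [comp, one, psiZero]

theorem HomMat.swap_comp_swap :
    (swap k n a).comp (swap k n a) = one k n a a := by
  ext1 <;> simp [comp, one, swap]

theorem HomMat.negOne_comp_negOne :
    (negOne k n a).comp (negOne k n a) = one k n a [] := by
  ext1 <;> simp [comp, one, negOne]

theorem HomMat.rhoZero_comp_swap (X : TwoHom k n a b) :
    (rhoZero X).comp (swap k n b) = (swap k n a).comp (rhoZero X) := by
  ext1 <;> simp [comp, swap, rhoZero]

theorem HomMat.psiRhoZero_comp_swap (X : TwoHom k n a b) :
    (psiRhoZero X).comp (swap k n b) = (swap k n a).comp (psiRhoZero X) := by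
  ext1 <;> simp [comp, swap, psiRhoZero]

/-- The matrix `negOne` is the scalar -1, hence central. -/
theorem HomMat.comp_negOne (M : HomMat k n a [] b []) :
    M.comp (negOne k n b) = (negOne k n a).comp M := by
  ext1 <;> simp [comp, negOne]

/-- In degree -1 the sign of the square comes from `ϱ̂^{σω}` being -1 in degree 1, the degree that
`ψ` carries to -1. -/
theorem HomMat.psiNeg_comp_negOne :
    (psiNeg k n a).comp (negOne k n a) = (psiNeg k n a).neg := by
  ext1 <;> simp [comp, HomMat.neg, psiNeg, negOne]

/-- A quarter turn and a reflection of the plane anticommute. -/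
theorem HomMat.psiZero_comp_swap :
    (psiZero k n a).comp (swap k n a) = ((swap k n a).comp (psiZero k n a)).neg := by
  ext1 <;> simp [comp, HomMat.neg, psiZero, swap]

theorem HomMat.negOne_comp_psiOne :
    ((negOne k n a).comp (psiOne k n a)).neg = psiOne k n a := by
  ext1 <;> simp [comp, HomMat.neg, psiOne, negOne]

/-- Conjugation by the diagonal matrix with entries -1 and 1 changes the sign of the off-diagonal
entries of `rhoNeg`. The matrix `psiRhoNeg` is the negative of the result. -/
theorem HomMat.psiNeg_comp_psiRhoNeg (A : CasimirData k n a) (B : CasimirData k n b)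
    (X : TwoHom k n a b) :
    (psiNeg k n a).comp (psiRhoNeg A B X) = ((rhoNeg A B X).comp (psiNeg k n b)).neg := by
  ext1 <;> simp [comp, HomMat.neg, psiNeg, rhoNeg, psiRhoNeg]

theorem HomMat.psiZero_comp_psiRhoZero (X : TwoHom k n a b) :
    (psiZero k n a).comp (psiRhoZero X) = ((rhoZero X).comp (psiZero k n b)).neg := by
  ext1 <;> simp [comp, HomMat.neg, psiZero, rhoZero, psiRhoZero]

theorem HomMat.psiOne_comp_psiRhoOne (A : CasimirData k n a) (B : CasimirData k n b)
    (X : TwoHom k n a b) :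
    (psiOne k n a).comp (psiRhoOne A B X) = ((rhoOne A B X).comp (psiOne k n b)).neg := by
  ext1 <;> simp [comp, HomMat.neg, psiOne, rhoOne, psiRhoOne]

theorem HomMat.neg_neg' (M : HomMat k n a₀ a₁ b₀ b₁) :
    M.neg.neg = M := by
  ext1 <;> simp [HomMat.neg]

end

end CatSL2

namespace CatSL2

open Strand CasimirData

/-! ### The images of the matrices of `ϱ^σ` and `ϱ̂^σ` under `ω` and `ψ` -/

section

variable {k : Type u} [CommRing k] {n n' : ℤ}

/-- Since `ω` exchanges the data of the two letters and negates the weight, it carries the matrices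
of `ϱ^σ` to those of `ϱ̂^σ` and back, degree by degree. -/
theorem omega_rhoNeg_E (h : n + n' = 0) :
    (rhoNeg (casimirData k n E) (casimirData k n F) (signedSide k n E)).omega h =
      rhoNeg (casimirData k n' F) (casimirData k n' E) (signedSide k n' F) :=
  HomMat.ext (omega_signedSide_E h)
    ((map_neg _ _).trans (congrArg (-·) (omega_casimirData_T_F h))) rfl
    ((map_neg _ _).trans (congrArg (-·) (omega_casimirData_c_F h)))

theorem omega_rhoZero_E (h : n + n' = 0) :
    (rhoZero (signedSide k n E)).omega h = rhoZero (signedSide k n' F) :=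
  HomMat.ext (omega_signedSide_E h) rfl rfl (omega_signedSide_E h)

theorem omega_rhoOne_E (h : n + n' = 0) :
    (rhoOne (casimirData k n E) (casimirData k n F) (signedSide k n E)).omega h =
      rhoOne (casimirData k n' F) (casimirData k n' E) (signedSide k n' F) :=
  HomMat.ext (omega_signedSide_E h) rfl
    ((map_neg _ _).trans (congrArg (-·) (omega_casimirData_S_E h)))
    (omega_casimirData_c_E h)

theorem omega_rhoNeg_F (h : n + n' = 0) :
    (rhoNeg (casimirData k n F) (casimirData k n E) (signedSide k n F)).omega h =
      rhoNeg (casimirData k n' E) (casimirData k n' F) (signedSide k n' E) :=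
  HomMat.ext (omega_signedSide_F h)
    ((map_neg _ _).trans (congrArg (-·) (omega_casimirData_T_E h))) rfl
    ((map_neg _ _).trans (congrArg (-·) (omega_casimirData_c_E h)))

theorem omega_rhoZero_F (h : n + n' = 0) :
    (rhoZero (signedSide k n F)).omega h = rhoZero (signedSide k n' E) :=
  HomMat.ext (omega_signedSide_F h) rfl rfl (omega_signedSide_F h)

theorem omega_rhoOne_F (h : n + n' = 0) :
    (rhoOne (casimirData k n F) (casimirData k n E) (signedSide k n F)).omega h =
      rhoOne (casimirData k n' E) (casimirData k n' F) (signedSide k n' E) :=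
  HomMat.ext (omega_signedSide_F h) rfl
    ((map_neg _ _).trans (congrArg (-·) (omega_casimirData_S_F h)))
    (omega_casimirData_c_F h)

/-- Degree 1 is carried to degree -1. The matrix is transposed, the cup becomes a cap, and the sum
`S` becomes `T`. -/
theorem psi_rhoOne_F :
    (rhoOne (casimirData k n F) (casimirData k n E) (signedSide k n F)).psi =
      psiRhoNeg (casimirData k n E) (casimirData k n F) (signedSide k n E) :=
  HomMat.ext psi_signedSide_F ((map_neg _ _).trans (congrArg (-·) (psi_casimirData_S F))) rfl
    (psi_casimirData_c F)

theorem psi_rhoZero_F : (rhoZero (signedSide k n F)).psi = psiRhoZero (signedSide k n E) :=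
  HomMat.ext psi_signedSide_F rfl rfl psi_signedSide_F

theorem psi_rhoNeg_F :
    (rhoNeg (casimirData k n F) (casimirData k n E) (signedSide k n F)).psi =
      psiRhoOne (casimirData k n E) (casimirData k n F) (signedSide k n E) :=
  HomMat.ext psi_signedSide_F rfl ((map_neg _ _).trans (congrArg (-·) (psi_casimirData_T E)))
    ((map_neg _ _).trans (congrArg (-·) (psi_casimirData_c E)))

end

/-! ### The matrices of the edges of the cube -/

namespace Maps.IsExplicit

variable {k : Type u} [CommRing k] {r : Maps k} {n n' : ℤ}

theorem isMat_σ_ρσω (hr : r.IsExplicit) (h : n + n' = 0) :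
    IsMat ((r.σ_ρσω h).f (-1)) (.one k n [F, E] []) ∧
    IsMat ((r.σ_ρσω h).f 0) (.swap k n [F, E]) ∧
    IsMat ((r.σ_ρσω h).f 1) (.negOne k n [F, E]) := by
  have h₀ := isRhoSigmaOmega_iff.1 (hr.ρσω (neg_symm h))
  exact ⟨((h₀.1.sigma (neg_symm h) (neg_symm h)).comp_eqToHom _
      HEq.rfl HEq.rfl HEq.rfl HEq.rfl).of_eq (comp_eqToHom_f _ _ _),
    ((h₀.2.1.sigma (neg_symm h) (neg_symm h)).comp_eqToHom _
      HEq.rfl HEq.rfl HEq.rfl HEq.rfl).of_eq (comp_eqToHom_f _ _ _),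
    ((h₀.2.2.sigma (neg_symm h) (neg_symm h)).comp_eqToHom _
      HEq.rfl HEq.rfl HEq.rfl HEq.rfl).of_eq (comp_eqToHom_f _ _ _)⟩

theorem isMat_σ_ρσω_hat (hr : r.IsExplicit) (h : n + n' = 0) :
    IsMat ((r.σ_ρσω_hat h).f (-1)) (.one k n [F, E] []) ∧
    IsMat ((r.σ_ρσω_hat h).f 0) (.swap k n [F, E]) ∧
    IsMat ((r.σ_ρσω_hat h).f 1) (.negOne k n [F, E]) := by
  have h₀ := isRhoHatSigmaOmega_iff.1 (hr.ρσω_hat (neg_symm h))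
  exact ⟨((h₀.1.sigma (neg_symm h) (neg_symm h)).eqToHom_comp _
      HEq.rfl HEq.rfl HEq.rfl HEq.rfl).of_eq (eqToHom_comp_f _ _ _),
    ((h₀.2.1.sigma (neg_symm h) (neg_symm h)).eqToHom_comp _
      HEq.rfl HEq.rfl HEq.rfl HEq.rfl).of_eq (eqToHom_comp_f _ _ _),
    ((h₀.2.2.sigma (neg_symm h) (neg_symm h)).eqToHom_comp _
      HEq.rfl HEq.rfl HEq.rfl HEq.rfl).of_eq (eqToHom_comp_f _ _ _)⟩

/-- The matrices are those of `ϱ^σ` itself, which reduces the triangle for `ϱ^ω` to commutation with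
the matrices of `ϱ^{σω}`. -/
theorem isMat_ω_ρσ_hat (hr : r.IsExplicit) (h : n + n' = 0) :
    IsMat ((r.ω_ρσ_hat h).f (-1))
      (rhoNeg (casimirData k n E) (casimirData k n F) (signedSide k n E)) ∧
    IsMat ((r.ω_ρσ_hat h).f 0) (rhoZero (signedSide k n E)) ∧
    IsMat ((r.ω_ρσ_hat h).f 1)
      (rhoOne (casimirData k n E) (casimirData k n F) (signedSide k n E)) := by
  have h₀ := isRhoHatSigma_iff.1 (hr.ρσ_hat (neg_symm h))
  exact ⟨(((h₀.1.omega (neg_symm h) (neg_symm h)).congr (omega_rhoNeg_F _)).eqToHom_comp _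
      HEq.rfl HEq.rfl HEq.rfl HEq.rfl).of_eq (eqToHom_comp_f _ _ _),
    (((h₀.2.1.omega (neg_symm h) (neg_symm h)).congr (omega_rhoZero_F _)).eqToHom_comp _
      HEq.rfl HEq.rfl HEq.rfl HEq.rfl).of_eq (eqToHom_comp_f _ _ _),
    (((h₀.2.2.omega (neg_symm h) (neg_symm h)).congr (omega_rhoOne_F _)).eqToHom_comp _
      HEq.rfl HEq.rfl HEq.rfl HEq.rfl).of_eq (eqToHom_comp_f _ _ _)⟩

theorem isMat_ω_ρψ (hr : r.IsExplicit) (h : n + n' = 0) :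
    IsMat ((r.ω_ρψ h).f (-1)) (.psiNeg k n [F, E]) ∧
    IsMat ((r.ω_ρψ h).f 0) (.psiZero k n [F, E]) ∧
    IsMat ((r.ω_ρψ h).f 1) (.psiOne k n [F, E]) := by
  have h₀ := isRhoPsi_iff.1 (hr.ρψ n')
  exact ⟨h₀.1.omega (neg_symm h) (neg_symm h),
    h₀.2.1.omega (neg_symm h) (neg_symm h),
    h₀.2.2.omega (neg_symm h) (neg_symm h)⟩

theorem isMat_σ_ρψ (hr : r.IsExplicit) (h : n + n' = 0) :
    IsMat ((r.σ_ρψ h).f (-1)) (.psiNeg k n [F, E]) ∧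
    IsMat ((r.σ_ρψ h).f 0) (.psiZero k n [F, E]) ∧
    IsMat ((r.σ_ρψ h).f 1) (.psiOne k n [F, E]) := by
  have h₀ := isRhoPsi_iff.1 (hr.ρψ n')
  exact ⟨h₀.1.sigma (neg_symm h) (neg_symm h),
    h₀.2.1.sigma (neg_symm h) (neg_symm h),
    h₀.2.2.sigma (neg_symm h) (neg_symm h)⟩

theorem isMat_σω_ρψ (hr : r.IsExplicit) (h : n + n' = 0) :
    IsMat ((r.σω_ρψ h).f (-1)) (.psiNeg k n [E, F]) ∧
    IsMat ((r.σω_ρψ h).f 0) (.psiZero k n [E, F]) ∧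
    IsMat ((r.σω_ρψ h).f 1) (.psiOne k n [E, F]) := by
  have h₀ := isRhoPsi_iff.1 (hr.ρψ n)
  exact ⟨(h₀.1.omega h h).sigma (neg_symm h) (neg_symm h),
    (h₀.2.1.omega h h).sigma (neg_symm h) (neg_symm h),
    (h₀.2.2.omega h h).sigma (neg_symm h) (neg_symm h)⟩

theorem isMat_ψ_ρσω_hat (hr : r.IsExplicit) (h : n + n' = 0) :
    IsMat ((r.ψ_ρσω_hat h).f (-1)) (.negOne k n [E, F]) ∧
    IsMat ((r.ψ_ρσω_hat h).f 0) (.swap k n [E, F]) ∧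
    IsMat ((r.ψ_ρσω_hat h).f 1) (.one k n [E, F] []) := by
  have h₀ := isRhoHatSigmaOmega_iff.1 (hr.ρσω_hat h)
  exact ⟨(h₀.2.2.psi.comp_eqToHom _
      HEq.rfl HEq.rfl HEq.rfl HEq.rfl).of_eq (comp_eqToHom_f _ _ _),
    (h₀.2.1.psi.comp_eqToHom _
      HEq.rfl HEq.rfl HEq.rfl HEq.rfl).of_eq (comp_eqToHom_f _ _ _),
    (h₀.1.psi.comp_eqToHom _
      HEq.rfl HEq.rfl HEq.rfl HEq.rfl).of_eq (comp_eqToHom_f _ _ _)⟩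

theorem isMat_ψ_ρσ_hat (hr : r.IsExplicit) (h : n + n' = 0) :
    IsMat ((r.ψ_ρσ_hat h).f (-1))
      (psiRhoNeg (casimirData k n E) (casimirData k n F) (signedSide k n E)) ∧
    IsMat ((r.ψ_ρσ_hat h).f 0) (psiRhoZero (signedSide k n E)) ∧
    IsMat ((r.ψ_ρσ_hat h).f 1)
      (psiRhoOne (casimirData k n E) (casimirData k n F) (signedSide k n E)) := by
  have h₀ := isRhoHatSigma_iff.1 (hr.ρσ_hat h)
  exact ⟨((h₀.2.2.psi.congr psi_rhoOne_F).comp_eqToHom _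
      HEq.rfl HEq.rfl HEq.rfl HEq.rfl).of_eq (comp_eqToHom_f _ _ _),
    ((h₀.2.1.psi.congr psi_rhoZero_F).comp_eqToHom _
      HEq.rfl HEq.rfl HEq.rfl HEq.rfl).of_eq (comp_eqToHom_f _ _ _),
    ((h₀.1.psi.congr psi_rhoNeg_F).comp_eqToHom _
      HEq.rfl HEq.rfl HEq.rfl HEq.rfl).of_eq (comp_eqToHom_f _ _ _)⟩

theorem isMat_ρω_hat (hr : r.IsExplicit) (h : n + n' = 0) :
    IsMat ((r.ρω_hat h).f (-1))
      ((HomMat.one k n [F, E] []).comp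
        (rhoNeg (casimirData k n F) (casimirData k n E) (signedSide k n F))) ∧
    IsMat ((r.ρω_hat h).f 0)
      ((HomMat.swap k n [F, E]).comp (rhoZero (signedSide k n F))) ∧
    IsMat ((r.ρω_hat h).f 1)
      ((HomMat.negOne k n [F, E]).comp
        (rhoOne (casimirData k n F) (casimirData k n E) (signedSide k n F))) := by
  have h₀ := isMat_σ_ρσω_hat hr h
  have h₁ := isRhoHatSigma_iff.1 (hr.ρσ_hat h)
  exact ⟨h₀.1.comp h₁.1,
    h₀.2.1.comp h₁.2.1,
    h₀.2.2.comp h₁.2.2⟩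

theorem isMat_ψ_ρω_hat (hr : r.IsExplicit) (h : n + n' = 0) :
    IsMat ((r.ψ_ρω_hat h).f (-1))
      ((psiRhoNeg (casimirData k n E) (casimirData k n F) (signedSide k n E)).comp
        (.negOne k n [F, E])) ∧
    IsMat ((r.ψ_ρω_hat h).f 0) ((psiRhoZero (signedSide k n E)).comp
        (.swap k n [F, E])) ∧
    IsMat ((r.ψ_ρω_hat h).f 1)
      ((psiRhoOne (casimirData k n E) (casimirData k n F) (signedSide k n E)).comp
        (.one k n [F, E] [])) := by
  have h₀ := isMat_ρω_hat hr h
  exact ⟨((h₀.2.2.psi.congr ((HomMat.psi_comp _ _).trans (congrArg₂ HomMat.comp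
      psi_rhoOne_F rfl))).comp_eqToHom _
      HEq.rfl HEq.rfl HEq.rfl HEq.rfl).of_eq (comp_eqToHom_f _ _ _),
    ((h₀.2.1.psi.congr ((HomMat.psi_comp _ _).trans (congrArg₂ HomMat.comp
      psi_rhoZero_F rfl))).comp_eqToHom _
      HEq.rfl HEq.rfl HEq.rfl HEq.rfl).of_eq (comp_eqToHom_f _ _ _),
    ((h₀.1.psi.congr ((HomMat.psi_comp _ _).trans (congrArg₂ HomMat.comp
      psi_rhoNeg_F rfl))).comp_eqToHom _
      HEq.rfl HEq.rfl HEq.rfl HEq.rfl).of_eq (comp_eqToHom_f _ _ _)⟩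

theorem isMat_ψσ_ρσω_hat (hr : r.IsExplicit) (h : n + n' = 0) :
    IsMat ((r.ψσ_ρσω_hat h).f (-1)) (.negOne k n [F, E]) ∧
    IsMat ((r.ψσ_ρσω_hat h).f 0) (.swap k n [F, E]) ∧
    IsMat ((r.ψσ_ρσω_hat h).f 1) (.one k n [F, E] []) := by
  have h₀ := isRhoHatSigmaOmega_iff.1 (hr.ρσω_hat (neg_symm h))
  exact ⟨((h₀.2.2.sigma (neg_symm h) (neg_symm h)).psi.eqToHom_comp_eqToHom _ _
      HEq.rfl HEq.rfl HEq.rfl HEq.rfl).of_eq (eqToHom_comp_eqToHom_f _ _ _ _),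
    ((h₀.2.1.sigma (neg_symm h) (neg_symm h)).psi.eqToHom_comp_eqToHom _ _
      HEq.rfl HEq.rfl HEq.rfl HEq.rfl).of_eq (eqToHom_comp_eqToHom_f _ _ _ _),
    ((h₀.1.sigma (neg_symm h) (neg_symm h)).psi.eqToHom_comp_eqToHom _ _
      HEq.rfl HEq.rfl HEq.rfl HEq.rfl).of_eq (eqToHom_comp_eqToHom_f _ _ _ _)⟩

/-- The symmetry `ω` brings `ϱ^σ` into the shape of `ϱ̂^σ`, so the matrices are the same as those of
`ψ(ϱ̂^σ)`. -/
theorem isMat_ψω_ρσ (hr : r.IsExplicit) (h : n + n' = 0) :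
    IsMat ((r.ψω_ρσ h).f (-1))
      (psiRhoNeg (casimirData k n E) (casimirData k n F) (signedSide k n E)) ∧
    IsMat ((r.ψω_ρσ h).f 0) (psiRhoZero (signedSide k n E)) ∧
    IsMat ((r.ψω_ρσ h).f 1)
      (psiRhoOne (casimirData k n E) (casimirData k n F) (signedSide k n E)) := by
  have h₀ := isRhoSigma_iff.1 (hr.ρσ (neg_symm h))
  exact ⟨((((h₀.2.2.omega (neg_symm h) (neg_symm h)).congr
      (omega_rhoOne_E _)).psi.congr psi_rhoOne_F).eqToHom_comp_eqToHom _ _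
      HEq.rfl HEq.rfl HEq.rfl HEq.rfl).of_eq (eqToHom_comp_eqToHom_f _ _ _ _),
    ((((h₀.2.1.omega (neg_symm h) (neg_symm h)).congr
      (omega_rhoZero_E _)).psi.congr psi_rhoZero_F).eqToHom_comp_eqToHom _ _
      HEq.rfl HEq.rfl HEq.rfl HEq.rfl).of_eq (eqToHom_comp_eqToHom_f _ _ _ _),
    ((((h₀.1.omega (neg_symm h) (neg_symm h)).congr
      (omega_rhoNeg_E _)).psi.congr psi_rhoNeg_F).eqToHom_comp_eqToHom _ _
      HEq.rfl HEq.rfl HEq.rfl HEq.rfl).of_eq (eqToHom_comp_eqToHom_f _ _ _ _)⟩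

end Maps.IsExplicit

end CatSL2

namespace CatSL2

open Strand CasimirData

/-! ### Homotopy equivalences -/

namespace IsHomotopyEquiv

variable {k : Type u} [CommRing k] {n m n' m' : ℤ} {X Y Z : Kom k n m}

theorem of_isIso (f : X ⟶ Y) [IsIso f] : IsHomotopyEquiv f := ⟨.ofIso (asIso f), rfl⟩

theorem comp {f : X ⟶ Y} {g : Y ⟶ Z} (hf : IsHomotopyEquiv f) (hg : IsHomotopyEquiv g) :
    IsHomotopyEquiv (f ≫ g) := by
  obtain ⟨e, rfl⟩ := hf
  obtain ⟨e', rfl⟩ := hg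
  exact ⟨e.trans e', rfl⟩

theorem omega {f : X ⟶ Y} (hf : IsHomotopyEquiv f) (h : n + n' = 0) (h' : m + m' = 0) :
    IsHomotopyEquiv ((omega k h h').map f) := by
  obtain ⟨e, rfl⟩ := hf
  exact ⟨(omegaOb k h h').mapMat_.mapHomotopyEquiv e, rfl⟩

theorem nonempty {f : X ⟶ Y} (hf : IsHomotopyEquiv f) : Nonempty (HomotopyEquiv X Y) := by
  obtain ⟨e, -⟩ := hf
  exact ⟨e⟩

/-- The components of the image of a homotopy under `ψ`. -/
noncomputable def psiHom (H : ∀ i j, X.X i ⟶ Y.X j) (i j : ℤ) :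
    ((CatSL2.psi k n m).obj (.op Y)).X i ⟶ ((CatSL2.psi k n m).obj (.op X)).X j :=
  (psiMat k n m).map (H (-j) (-i)).op

/-- The image of a homotopy under `ψ`. -/
noncomputable def psiHomotopy {f g : X ⟶ Y} (H : Homotopy f g) :
    Homotopy ((CatSL2.psi k n m).map f.op) ((CatSL2.psi k n m).map g.op) where
  hom := psiHom H.hom
  zero i j hij := by
    rw [psiHom, H.zero _ _ fun h' => hij ?_]
    · exact (psiMat k n m).map_zero _ _
    · simp only [ComplexShape.up_Rel] at h' ⊢
      omega
  comm i := by
    have h₁ : (ComplexShape.up ℤ).Rel (-i) (-(i - 1)) := by simp only [ComplexShape.up_Rel]; ring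
    have h₂ : (ComplexShape.up ℤ).Rel (-(i + 1)) (-i) := by simp only [ComplexShape.up_Rel]; ring
    have h := H.comm (-i)
    -- Because `ψ` reverses compositions and negates degrees, each of the two terms of the homotopy
    -- relation in degree -i becomes the other one in degree i.
    rw [dNext_eq _ h₁, prevD_eq _ h₂, add_comm (X.d _ _ ≫ _)] at h
    rw [dNext_eq (psiHom H.hom) (show (ComplexShape.up ℤ).Rel i (i + 1) from rfl),
      prevD_eq (psiHom H.hom) (show (ComplexShape.up ℤ).Rel (i - 1) i from sub_add_cancel i 1)]
    refine (congrArg (fun x => (psiMat k n m).map (Quiver.Hom.op x)) h).trans ?_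
    rw [op_add, op_add, Functor.map_add, Functor.map_add, op_comp, op_comp, Functor.map_comp,
      Functor.map_comp]
    rfl

theorem psi {f : X ⟶ Y} (hf : IsHomotopyEquiv f) :
    IsHomotopyEquiv ((CatSL2.psi k n m).map f.op) := by
  obtain ⟨e, rfl⟩ := hf
  refine ⟨⟨(CatSL2.psi k n m).map e.hom.op, (CatSL2.psi k n m).map e.inv.op, ?_, ?_⟩, rfl⟩
  -- By contravariance the two homotopies of `e` change places.
  · refine ((Homotopy.ofEq ?_).trans (psiHomotopy e.homotopyInvHomId)).trans (Homotopy.ofEq ?_)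
    · rw [op_comp, Functor.map_comp]
    · exact (CatSL2.psi k n m).map_id _
  · refine ((Homotopy.ofEq ?_).trans (psiHomotopy e.homotopyHomInvId)).trans (Homotopy.ofEq ?_)
    · rw [op_comp, Functor.map_comp]
    · exact (CatSL2.psi k n m).map_id _

end IsHomotopyEquiv

/-! ### The properties of the explicit maps -/

namespace Maps.IsExplicit

variable {k : Type u} [CommRing k] {r : Maps k} {n n' : ℤ}

theorem ρψ_inv (hr : r.IsExplicit) (n : ℤ) :
    r.ρψ n ≫ r.ρψ_hat n = 𝟙 _ ∧ r.ρψ_hat n ≫ r.ρψ n = 𝟙 _ := by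
  have h₁ := isRhoPsi_iff.1 (hr.ρψ n)
  have h₂ := isRhoHatPsi_iff.1 (hr.ρψ_hat n)
  exact ⟨(threeTerm_casimir E).hom_ext
      (((h₁.1.comp h₂.1).congr HomMat.psiNeg_comp_psiNeg).ext (.id _))
      (((h₁.2.1.comp h₂.2.1).congr HomMat.psiZero_comp_neg).ext (.id _))
      (((h₁.2.2.comp h₂.2.2).congr HomMat.psiOne_comp_psiOne).ext (.id _)),
    (threeTerm_casimir E).psi.hom_ext
      (((h₂.1.comp h₁.1).congr HomMat.psiNeg_comp_psiNeg).ext (.id _))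
      (((h₂.2.1.comp h₁.2.1).congr HomMat.neg_comp_psiZero).ext (.id _))
      (((h₂.2.2.comp h₁.2.2).congr HomMat.psiOne_comp_psiOne).ext (.id _))⟩

theorem ρσω_inv (hr : r.IsExplicit) (h : n + n' = 0) :
    r.ρσω h ≫ r.ρσω_hat h = 𝟙 _ ∧ r.ρσω_hat h ≫ r.ρσω h = 𝟙 _ := by
  have h₁ := isRhoSigmaOmega_iff.1 (hr.ρσω h)
  have h₂ := isRhoHatSigmaOmega_iff.1 (hr.ρσω_hat h)
  exact ⟨(threeTerm_casimir E).hom_ext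
      (((h₁.1.comp h₂.1).congr (HomMat.one_comp _)).ext (.id _))
      (((h₁.2.1.comp h₂.2.1).congr HomMat.swap_comp_swap).ext (.id _))
      (((h₁.2.2.comp h₂.2.2).congr HomMat.negOne_comp_negOne).ext (.id _)),
    (((threeTerm_casimir E).omega h h).sigma (neg_symm h) (neg_symm h)).hom_ext
      (((h₂.1.comp h₁.1).congr (HomMat.one_comp _)).ext (.id _))
      (((h₂.2.1.comp h₁.2.1).congr HomMat.swap_comp_swap).ext (.id _))
      (((h₂.2.2.comp h₁.2.2).congr HomMat.negOne_comp_negOne).ext (.id _))⟩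

theorem exists_homotopyC (hr : r.IsExplicit) (h : n + n' = 0) :
    ∃ H : Homotopy (r.ρσ h ≫ r.ρσ_hat h) (𝟙 _), IsHomotopyC H := by
  have h₁ := isRhoSigma_iff.1 (hr.ρσ h)
  have h₂ := isRhoHatSigma_iff.1 (hr.ρσ_hat h)
  have h₃ : ∃ f : (C k n).X 0 ⟶ (C k n).X (-1), IsMat f (casimirData k n E).h₀ :=
    IsMat.exists_of_mem _ (TwoHom.neg_mem (casimirData_P_mem E rfl)) (Submodule.zero_mem _)
      (TwoHom.neg_mem (casimirData_S_mem E (show 0 - (1 - 1 * n) = 1 * n - 1 by ring)))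
      (Submodule.zero_mem _)
  have h₄ : ∃ f : (C k n).X 1 ⟶ (C k n).X 0, IsMat f (casimirData k n E).h₁ :=
    IsMat.exists_of_mem _ (Submodule.zero_mem _) (Submodule.zero_mem _)
      (TwoHom.neg_mem (casimirData_P_mem E rfl))
      (casimirData_T_mem E (show (1 * n - 1) - 0 = 1 * n - 1 by ring))
  obtain ⟨f₃, h₃⟩ := h₃
  obtain ⟨f₄, h₄⟩ := h₄
  have hA := casimirData_inner (k := k) (n := n) E
  obtain ⟨H, e₀, e₁⟩ := (threeTerm_casimir E).exists_homotopy
    (f := r.ρσ h ≫ r.ρσ_hat h) (g := 𝟙 (C k n)) f₃ f₄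
    (((h₁.1.comp h₂.1).congr (casimirData_outer_E.rhoNeg_rhoNeg casimirData_outer_F hA)).ext
      (((isMat_casimir_d₀ E).comp h₃).add (.id _)))
    (((h₁.2.1.comp h₂.2.1).congr (casimirData_outer_E.rhoZero_rhoZero hA)).ext
      ((((isMat_casimir_d₁ E).comp h₄).add (h₃.comp (isMat_casimir_d₀ E))).add (.id _)))
    (((h₁.2.2.comp h₂.2.2).congr (casimirData_outer_E.rhoOne_rhoOne casimirData_outer_F hA)).ext
      ((h₄.comp (isMat_casimir_d₁ E)).add (.id _)))
  refine ⟨H, isHomotopyC_iff.2 ?_⟩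
  rw [e₀, e₁]
  exact ⟨h₃, h₄⟩

/-- The differential of `σ(C 1_{-n})` is built from the data of `F`, so this is the same computation
as for `C 1_n` with the two letters exchanged. -/
theorem exists_homotopyσC (hr : r.IsExplicit) (h : n + n' = 0) :
    ∃ H : Homotopy (r.ρσ_hat h ≫ r.ρσ h) (𝟙 _), IsHomotopyσC h H := by
  obtain rfl : n' = -n := by omega
  have h₁ := isRhoSigma_iff.1 (hr.ρσ h)
  have h₂ := isRhoHatSigma_iff.1 (hr.ρσ_hat h)
  have h₃ : ∃ f : (σC k n h).X 0 ⟶ (σC k n h).X (-1), IsMat f (casimirData k n F).h₀ :=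
    IsMat.exists_of_mem _ (TwoHom.neg_mem (casimirData_P_mem F rfl)) (Submodule.zero_mem _)
      (TwoHom.neg_mem (casimirData_S_mem F (show 0 - (1 - 1 * -n) = -1 * n - 1 by ring)))
      (Submodule.zero_mem _)
  have h₄ : ∃ f : (σC k n h).X 1 ⟶ (σC k n h).X 0, IsMat f (casimirData k n F).h₁ :=
    IsMat.exists_of_mem _ (Submodule.zero_mem _) (Submodule.zero_mem _)
      (TwoHom.neg_mem (casimirData_P_mem F rfl))
      (casimirData_T_mem F (show (1 * -n - 1) - 0 = -1 * n - 1 by ring))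
  obtain ⟨f₃, h₃⟩ := h₃
  obtain ⟨f₄, h₄⟩ := h₄
  have hA := casimirData_inner (k := k) (n := n) F
  obtain ⟨H, e₀, e₁⟩ := ((threeTerm_casimir E).sigma (neg_symm h) (neg_symm h)).exists_homotopy
    (f := r.ρσ_hat h ≫ r.ρσ h) (g := 𝟙 (σC k n h)) f₃ f₄
    (((h₂.1.comp h₁.1).congr (casimirData_outer_F.rhoNeg_rhoNeg casimirData_outer_E hA)).ext
      (((isMat_σC_d₀ h).comp h₃).add (.id _)))
    (((h₂.2.1.comp h₁.2.1).congr (casimirData_outer_F.rhoZero_rhoZero hA)).ext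
      ((((isMat_σC_d₁ h).comp h₄).add (h₃.comp (isMat_σC_d₀ h))).add (.id _)))
    (((h₂.2.2.comp h₁.2.2).congr (casimirData_outer_F.rhoOne_rhoOne casimirData_outer_E hA)).ext
      ((h₄.comp (isMat_σC_d₁ h)).add (.id _)))
  refine ⟨H, isHomotopyσC_iff.2 ?_⟩
  rw [e₀, e₁]
  exact ⟨h₃, h₄⟩

/-! The triangles and squares of the cube. -/

/-- Both composites consist of the matrices of `ϱ^σ` and those of `ϱ^{σω}`, in the two possible
orders, and these commute in each degree. -/
theorem triangle_left (hr : r.IsExplicit) (h : n + n' = 0) :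
    r.ρω h = r.ρσω h ≫ r.ω_ρσ_hat h := by
  have h₁ := isRhoSigma_iff.1 (hr.ρσ h)
  have h₂ := hr.isMat_σ_ρσω h
  have h₃ := isRhoSigmaOmega_iff.1 (hr.ρσω h)
  have h₄ := hr.isMat_ω_ρσ_hat h
  exact (threeTerm_casimir E).hom_ext
    (((h₁.1.comp h₂.1).congr (HomMat.comp_one _)).ext
      ((h₃.1.comp h₄.1).congr (HomMat.one_comp _)))
    (((h₁.2.1.comp h₂.2.1).congr (HomMat.rhoZero_comp_swap _)).ext (h₃.2.1.comp h₄.2.1))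
    (((h₁.2.2.comp h₂.2.2).congr (HomMat.comp_negOne _)).ext (h₃.2.2.comp h₄.2.2))

theorem triangle_right_front (hr : r.IsExplicit) (h : n + n' = 0) :
    r.ψ_ρω_hat h = r.ψ_ρσ_hat h ≫ r.ψσ_ρσω_hat h := by
  have h₁ := hr.isMat_ψ_ρω_hat h
  have h₂ := hr.isMat_ψ_ρσ_hat h
  have h₃ := hr.isMat_ψσ_ρσω_hat h
  exact (threeTerm_casimir E).psi.hom_ext (h₁.1.ext (h₂.1.comp h₃.1))
    (h₁.2.1.ext (h₂.2.1.comp h₃.2.1)) (h₁.2.2.ext (h₂.2.2.comp h₃.2.2))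

theorem triangle_right_back (hr : r.IsExplicit) (h : n + n' = 0) :
    r.ψ_ρω_hat h = r.ψ_ρσω_hat h ≫ r.ψω_ρσ h := by
  have h₁ := hr.isMat_ψ_ρω_hat h
  have h₂ := hr.isMat_ψ_ρσω_hat h
  have h₃ := hr.isMat_ψω_ρσ h
  exact (threeTerm_casimir E).psi.hom_ext
    ((h₁.1.congr (HomMat.comp_negOne _)).ext (h₂.1.comp h₃.1))
    ((h₁.2.1.congr (HomMat.psiRhoZero_comp_swap _)).ext (h₂.2.1.comp h₃.2.1))
    ((h₁.2.2.congr (HomMat.comp_one _)).ext ((h₂.2.2.comp h₃.2.2).congr (HomMat.one_comp _)))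

/-- The sign has a different origin in each degree: in degree -1 the map `ψ(ϱ̂^{σω})` is -1, in
degree 0 the quarter turn anticommutes with the swap, and in degree 1 the map `ϱ^{σω}` is -1. -/
theorem square_front (hr : r.IsExplicit) (h : n + n' = 0) :
    r.ρψ n ≫ r.ψ_ρσω_hat h = -(r.ρσω h ≫ r.σω_ρψ h) := by
  have h₁ := isRhoPsi_iff.1 (hr.ρψ n)
  have h₂ := hr.isMat_ψ_ρσω_hat h
  have h₃ := isRhoSigmaOmega_iff.1 (hr.ρσω h)
  have h₄ := hr.isMat_σω_ρψ h
  exact (threeTerm_casimir E).hom_ext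
    (((h₁.1.comp h₂.1).congr HomMat.psiNeg_comp_negOne).ext
      ((h₃.1.comp h₄.1).congr (HomMat.one_comp _)).neg)
    (((h₁.2.1.comp h₂.2.1).congr HomMat.psiZero_comp_swap).ext (h₃.2.1.comp h₄.2.1).neg)
    (((h₁.2.2.comp h₂.2.2).congr (HomMat.comp_one _)).ext
      ((h₃.2.2.comp h₄.2.2).neg.congr HomMat.negOne_comp_psiOne))

theorem square_top (hr : r.IsExplicit) (h : n + n' = 0) :
    r.ρσ h ≫ r.σ_ρψ h = -(r.ρψ n ≫ r.ψ_ρσ_hat h) := by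
  have h₁ := isRhoSigma_iff.1 (hr.ρσ h)
  have h₂ := hr.isMat_σ_ρψ h
  have h₃ := isRhoPsi_iff.1 (hr.ρψ n)
  have h₄ := hr.isMat_ψ_ρσ_hat h
  exact (threeTerm_casimir E).hom_ext
    ((h₁.1.comp h₂.1).ext (((h₃.1.comp h₄.1).congr (HomMat.psiNeg_comp_psiRhoNeg _ _ _)).neg.congr
      (HomMat.neg_neg' _)))
    ((h₁.2.1.comp h₂.2.1).ext (((h₃.2.1.comp h₄.2.1).congr
      (HomMat.psiZero_comp_psiRhoZero _)).neg.congr (HomMat.neg_neg' _)))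
    ((h₁.2.2.comp h₂.2.2).ext (((h₃.2.2.comp h₄.2.2).congr
      (HomMat.psiOne_comp_psiRhoOne _ _ _)).neg.congr (HomMat.neg_neg' _)))

theorem square_back (hr : r.IsExplicit) (h : n + n' = 0) :
    r.σ_ρψ h ≫ r.ψσ_ρσω_hat h = -(r.σ_ρσω h ≫ r.ω_ρψ h) := by
  have h₁ := hr.isMat_σ_ρψ h
  have h₂ := hr.isMat_ψσ_ρσω_hat h
  have h₃ := hr.isMat_σ_ρσω h
  have h₄ := hr.isMat_ω_ρψ h
  exact ((threeTerm_casimir E).sigma (neg_symm h) (neg_symm h)).hom_ext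
    (((h₁.1.comp h₂.1).congr HomMat.psiNeg_comp_negOne).ext
      ((h₃.1.comp h₄.1).congr (HomMat.one_comp _)).neg)
    (((h₁.2.1.comp h₂.2.1).congr HomMat.psiZero_comp_swap).ext (h₃.2.1.comp h₄.2.1).neg)
    (((h₁.2.2.comp h₂.2.2).congr (HomMat.comp_one _)).ext
      ((h₃.2.2.comp h₄.2.2).neg.congr HomMat.negOne_comp_psiOne))

theorem square_bottom (hr : r.IsExplicit) (h : n + n' = 0) :
    r.σω_ρψ h ≫ r.ψω_ρσ h = -(r.ω_ρσ_hat h ≫ r.ω_ρψ h) := by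
  have h₁ := hr.isMat_σω_ρψ h
  have h₂ := hr.isMat_ψω_ρσ h
  have h₃ := hr.isMat_ω_ρσ_hat h
  have h₄ := hr.isMat_ω_ρψ h
  exact (((threeTerm_casimir E).omega h h).sigma (neg_symm h) (neg_symm h)).hom_ext
    (((h₁.1.comp h₂.1).congr (HomMat.psiNeg_comp_psiRhoNeg _ _ _)).ext (h₃.1.comp h₄.1).neg)
    (((h₁.2.1.comp h₂.2.1).congr (HomMat.psiZero_comp_psiRhoZero _)).ext
      (h₃.2.1.comp h₄.2.1).neg)
    (((h₁.2.2.comp h₂.2.2).congr (HomMat.psiOne_comp_psiRhoOne _ _ _)).ext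
      (h₃.2.2.comp h₄.2.2).neg)

/-! The edges of the cube are isomorphisms or homotopy equivalences. -/

theorem isIso_ρψ (hr : r.IsExplicit) (n : ℤ) : IsIso (r.ρψ n) := ⟨_, hr.ρψ_inv n⟩

theorem isIso_ρσω (hr : r.IsExplicit) (h : n + n' = 0) : IsIso (r.ρσω h) := ⟨_, hr.ρσω_inv h⟩

theorem isIso_ρσω_hat (hr : r.IsExplicit) (h : n + n' = 0) : IsIso (r.ρσω_hat h) :=
  ⟨_, (hr.ρσω_inv h).symm⟩

theorem isIso_edges (hr : r.IsExplicit) (h : n + n' = 0) :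
    IsIso (r.ρψ n) ∧ IsIso (r.ρσω h) ∧ IsIso (r.σ_ρσω h) ∧ IsIso (r.ψ_ρσω_hat h) ∧
      IsIso (r.ω_ρψ h) ∧ IsIso (r.σ_ρψ h) ∧ IsIso (r.σω_ρψ h) ∧ IsIso (r.ψσ_ρσω_hat h) := by
  have h₁ := hr.isIso_ρψ n
  have h₂ := hr.isIso_ρψ n'
  have h₃ := hr.isIso_ρσω h
  have h₄ := hr.isIso_ρσω (neg_symm h)
  have h₅ := hr.isIso_ρσω_hat h
  have h₆ := hr.isIso_ρσω_hat (neg_symm h)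
  refine ⟨h₁, h₃, ?_, ?_, ?_, ?_, ?_, ?_⟩
  · unfold Maps.σ_ρσω; infer_instance
  · unfold Maps.ψ_ρσω_hat; infer_instance
  · unfold Maps.ω_ρψ; infer_instance
  · unfold Maps.σ_ρψ; infer_instance
  · unfold Maps.σω_ρψ; infer_instance
  · unfold Maps.ψσ_ρσω_hat; infer_instance

theorem exists_homotopyEquiv_ρσ (hr : r.IsExplicit) (h : n + n' = 0) :
    ∃ e : HomotopyEquiv (C k n) (σC k n h), e.hom = r.ρσ h ∧ e.inv = r.ρσ_hat h := by
  obtain ⟨H, -⟩ := hr.exists_homotopyC h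
  obtain ⟨H', -⟩ := hr.exists_homotopyσC h
  exact ⟨⟨r.ρσ h, r.ρσ_hat h, H, H'⟩, rfl, rfl⟩

theorem σ_ρσω_inv (hr : r.IsExplicit) (h : n + n' = 0) :
    r.σ_ρσω h ≫ r.σ_ρσω_hat h = 𝟙 _ ∧ r.σ_ρσω_hat h ≫ r.σ_ρσω h = 𝟙 _ := by
  obtain ⟨h₁, h₂⟩ := hr.ρσω_inv (neg_symm h)
  constructor
  · simp only [Maps.σ_ρσω, Maps.σ_ρσω_hat, Category.assoc, eqToHom_trans_assoc, eqToHom_refl,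
      Category.id_comp]
    rw [← Functor.map_comp, h₁, CategoryTheory.Functor.map_id]
  · simp only [Maps.σ_ρσω, Maps.σ_ρσω_hat, Category.assoc]
    rw [← Functor.map_comp_assoc, h₂, CategoryTheory.Functor.map_id, Category.id_comp,
      eqToHom_trans, eqToHom_refl]

theorem exists_homotopyEquiv_ρω (hr : r.IsExplicit) (h : n + n' = 0) :
    ∃ e : HomotopyEquiv (C k n) (ωC k n h), e.hom = r.ρω h ∧ e.inv = r.ρω_hat h := by
  obtain ⟨e, h₁, h₂⟩ := hr.exists_homotopyEquiv_ρσ h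
  obtain ⟨h₃, h₄⟩ := hr.σ_ρσω_inv h
  exact ⟨e.trans (.ofIso ⟨r.σ_ρσω h, r.σ_ρσω_hat h, h₃, h₄⟩),
    congrArg (· ≫ r.σ_ρσω h) h₁, congrArg (r.σ_ρσω_hat h ≫ ·) h₂⟩

/-- The maps `ϱ̂^σ` and `ϱ̂^ω` are equivalences as homotopy inverses. The remaining edges are images
of equivalences under `ω` and `ψ`, composed with identifications of complexes. -/
theorem isHomotopyEquiv_edges (hr : r.IsExplicit) (h : n + n' = 0) :
    IsHomotopyEquiv (r.ρσ h) ∧ IsHomotopyEquiv (r.ρω h) ∧ IsHomotopyEquiv (r.ω_ρσ_hat h) ∧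
      IsHomotopyEquiv (r.ψ_ρω_hat h) ∧ IsHomotopyEquiv (r.ψ_ρσ_hat h) ∧
      IsHomotopyEquiv (r.ψω_ρσ h) := by
  obtain ⟨e, h₁, h₂⟩ := hr.exists_homotopyEquiv_ρσ h
  obtain ⟨e', h₁', h₂'⟩ := hr.exists_homotopyEquiv_ρσ (neg_symm h)
  obtain ⟨e'', h₁'', h₂''⟩ := hr.exists_homotopyEquiv_ρω h
  have a : IsHomotopyEquiv (r.ρσ_hat h) := ⟨e.symm, h₂⟩
  have a' : IsHomotopyEquiv (r.ρσ_hat (neg_symm h)) := ⟨e'.symm, h₂'⟩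
  have b' : IsHomotopyEquiv (r.ρσ (neg_symm h)) := ⟨e', h₁'⟩
  have a'' : IsHomotopyEquiv (r.ρω_hat h) := ⟨e''.symm, h₂''⟩
  exact ⟨⟨e, h₁⟩, ⟨e'', h₁''⟩, (IsHomotopyEquiv.of_isIso _).comp (a'.omega _ _),
    a''.psi.comp (IsHomotopyEquiv.of_isIso _), a.psi.comp (IsHomotopyEquiv.of_isIso _),
    (IsHomotopyEquiv.of_isIso _).comp ((b'.omega _ _).psi.comp (IsHomotopyEquiv.of_isIso _))⟩

end Maps.IsExplicit

/-! ### The two Casimir complexes -/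

section

variable {k : Type u} [CommRing k] {n n' : ℤ}

/-- The two complexes have the same words and differentials, but shifts such as `1 - 1 * -n` and `1
- -1 * n` agree only after a computation. Identity matrices give an isomorphism in place of an
equality. -/
theorem exists_isIso_σC_C' (h : n + n' = 0) : ∃ φ : σC k n h ⟶ C' k n, IsIso φ := by
  obtain rfl : n' = -n := by omega
  have h₀ : ∃ f : (σC k n h).X (-1) ⟶ (C' k n).X (-1), IsMat f (.one k n [F, E] []) :=
    IsMat.exists_of_mem _ (TwoHom.id_mem_deg _ rfl) (Submodule.zero_mem _) (Submodule.zero_mem _)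
      (TwoHom.id_mem_deg _ (show (1 - 1 * -n) - (1 - -1 * n) = 0 by ring))
  have h₁ : ∃ f : (σC k n h).X 0 ⟶ (C' k n).X 0, IsMat f (.one k n [F, E] [F, E]) :=
    IsMat.exists_of_mem _ (TwoHom.id_mem_deg _ rfl) (Submodule.zero_mem _) (Submodule.zero_mem _)
      (TwoHom.id_mem_deg _ rfl)
  have h₂ : ∃ f : (σC k n h).X 1 ⟶ (C' k n).X 1, IsMat f (.one k n [F, E] []) :=
    IsMat.exists_of_mem _ (TwoHom.id_mem_deg _ rfl) (Submodule.zero_mem _) (Submodule.zero_mem _)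
      (TwoHom.id_mem_deg _ (show (1 * -n - 1) - (-1 * n - 1) = 0 by ring))
  have h₀' : ∃ f : (C' k n).X (-1) ⟶ (σC k n h).X (-1), IsMat f (.one k n [F, E] []) :=
    IsMat.exists_of_mem _ (TwoHom.id_mem_deg _ rfl) (Submodule.zero_mem _) (Submodule.zero_mem _)
      (TwoHom.id_mem_deg _ (show (1 - -1 * n) - (1 - 1 * -n) = 0 by ring))
  have h₁' : ∃ f : (C' k n).X 0 ⟶ (σC k n h).X 0, IsMat f (.one k n [F, E] [F, E]) :=
    IsMat.exists_of_mem _ (TwoHom.id_mem_deg _ rfl) (Submodule.zero_mem _) (Submodule.zero_mem _)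
      (TwoHom.id_mem_deg _ rfl)
  have h₂' : ∃ f : (C' k n).X 1 ⟶ (σC k n h).X 1, IsMat f (.one k n [F, E] []) :=
    IsMat.exists_of_mem _ (TwoHom.id_mem_deg _ rfl) (Submodule.zero_mem _) (Submodule.zero_mem _)
      (TwoHom.id_mem_deg _ (show (-1 * n - 1) - (1 * -n - 1) = 0 by ring))
  obtain ⟨f₀, h₀⟩ := h₀
  obtain ⟨f₁, h₁⟩ := h₁
  obtain ⟨f₂, h₂⟩ := h₂
  obtain ⟨f₀', h₀'⟩ := h₀'
  obtain ⟨f₁', h₁'⟩ := h₁'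
  obtain ⟨f₂', h₂'⟩ := h₂'
  have hσC := (threeTerm_casimir (k := k) (n := -n) E).sigma (neg_symm h) (neg_symm h)
  have hC' := threeTerm_casimir (k := k) (n := n) F
  obtain ⟨φ, e₀, e₁, e₂⟩ := hσC.exists_hom hC' f₀ f₁ f₂
    ((((isMat_σC_d₀ h).comp h₁).congr (HomMat.comp_one _)).ext
      ((h₀.comp (isMat_casimir_d₀ F)).congr (HomMat.one_comp _)))
    ((((isMat_σC_d₁ h).comp h₂).congr (HomMat.comp_one _)).ext
      ((h₁.comp (isMat_casimir_d₁ F)).congr (HomMat.one_comp _)))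
  obtain ⟨ψ, e₀', e₁', e₂'⟩ := hC'.exists_hom hσC f₀' f₁' f₂'
    ((((isMat_casimir_d₀ F).comp h₁').congr (HomMat.comp_one _)).ext
      ((h₀'.comp (isMat_σC_d₀ h)).congr (HomMat.one_comp _)))
    ((((isMat_casimir_d₁ F).comp h₂').congr (HomMat.comp_one _)).ext
      ((h₁'.comp (isMat_σC_d₁ h)).congr (HomMat.one_comp _)))
  refine ⟨φ, ψ, hσC.hom_ext ?_ ?_ ?_, hC'.hom_ext ?_ ?_ ?_⟩ <;>
    rw [HomologicalComplex.comp_f] <;> simp only [e₀, e₁, e₂, e₀', e₁', e₂']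
  · exact ((h₀.comp h₀').congr (HomMat.one_comp _)).ext (.id _)
  · exact ((h₁.comp h₁').congr (HomMat.one_comp _)).ext (.id _)
  · exact ((h₂.comp h₂').congr (HomMat.one_comp _)).ext (.id _)
  · exact ((h₀'.comp h₀).congr (HomMat.one_comp _)).ext (.id _)
  · exact ((h₁'.comp h₁).congr (HomMat.one_comp _)).ext (.id _)
  · exact ((h₂'.comp h₂).congr (HomMat.one_comp _)).ext (.id _)

theorem Maps.IsExplicit.homotopyEquiv_C_C' {r : Maps k} (hr : r.IsExplicit) (n : ℤ) :
    Nonempty (HomotopyEquiv (C k n) (C' k n)) := by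
  obtain ⟨e, -⟩ := hr.exists_homotopyEquiv_ρσ (add_neg_cancel n)
  obtain ⟨φ, hφ⟩ := exists_isIso_σC_C' (k := k) (add_neg_cancel n)
  exact ⟨e.trans (.ofIso (asIso φ))⟩

end

end CatSL2

/-! ### The proposition -/

theorem mainTheorem2 (k : Type u) [Field k] :
    ∃ r : CatSL2.Maps k, r.IsExplicit ∧
      -- the explicit chain isomorphisms
      (∀ n : ℤ, r.ρψ n ≫ r.ρψ_hat n = 𝟙 _ ∧ r.ρψ_hat n ≫ r.ρψ n = 𝟙 _) ∧
      (∀ (n n' : ℤ) (h : n + n' = 0),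
        r.ρσω h ≫ r.ρσω_hat h = 𝟙 _ ∧ r.ρσω_hat h ≫ r.ρσω h = 𝟙 _) ∧
      -- the explicit homotopies
      (∀ (n n' : ℤ) (h : n + n' = 0),
        (∃ H : Homotopy (r.ρσ h ≫ r.ρσ_hat h) (𝟙 _), CatSL2.IsHomotopyC H) ∧
        (∃ H : Homotopy (r.ρσ_hat h ≫ r.ρσ h) (𝟙 _), CatSL2.IsHomotopyσC h H)) ∧
      (∀ (n n' : ℤ) (h : n + n' = 0),
        -- the solid edges of the cube are chain isomorphisms
        (IsIso (r.ρψ n) ∧ IsIso (r.ρσω h) ∧ IsIso (r.σ_ρσω h) ∧ IsIso (r.ψ_ρσω_hat h) ∧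
          IsIso (r.ω_ρψ h) ∧ IsIso (r.σ_ρψ h) ∧ IsIso (r.σω_ρψ h) ∧ IsIso (r.ψσ_ρσω_hat h)) ∧
        -- the dotted edges of the cube are homotopy equivalences
        (CatSL2.IsHomotopyEquiv (r.ρσ h) ∧ CatSL2.IsHomotopyEquiv (r.ρω h) ∧
          CatSL2.IsHomotopyEquiv (r.ω_ρσ_hat h) ∧ CatSL2.IsHomotopyEquiv (r.ψ_ρω_hat h) ∧
          CatSL2.IsHomotopyEquiv (r.ψ_ρσ_hat h) ∧ CatSL2.IsHomotopyEquiv (r.ψω_ρσ h)) ∧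
        (∃ e : HomotopyEquiv (CatSL2.C k n) (CatSL2.ωC k n h),
          e.hom = r.ρω h ∧ e.inv = r.ρω_hat h) ∧
        -- the triangles on the left commute
        (r.ρω h = r.ρσ h ≫ r.σ_ρσω h ∧ r.ρω h = r.ρσω h ≫ r.ω_ρσ_hat h) ∧
        -- the triangles on the right commute
        (r.ψ_ρω_hat h = r.ψ_ρσ_hat h ≫ r.ψσ_ρσω_hat h ∧
          r.ψ_ρω_hat h = r.ψ_ρσω_hat h ≫ r.ψω_ρσ h) ∧
        -- the front, top, back and bottom squares anticommute
        r.ρψ n ≫ r.ψ_ρσω_hat h = -(r.ρσω h ≫ r.σω_ρψ h) ∧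
        r.ρσ h ≫ r.σ_ρψ h = -(r.ρψ n ≫ r.ψ_ρσ_hat h) ∧
        r.σ_ρψ h ≫ r.ψσ_ρσω_hat h = -(r.σ_ρσω h ≫ r.ω_ρψ h) ∧
        r.σω_ρψ h ≫ r.ψω_ρσ h = -(r.ω_ρσ_hat h ≫ r.ω_ρψ h) ∧
        -- the complex is isomorphic to its images under the symmetries that preserve the weight
        (Nonempty (CatSL2.C k n ≅ CatSL2.ψC k n) ∧ Nonempty (CatSL2.C k n ≅ CatSL2.σωC k n h) ∧
          Nonempty (CatSL2.C k n ≅ CatSL2.σωψC k n h)) ∧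
        -- and homotopy equivalent to the images under the other ones
        (Nonempty (HomotopyEquiv (CatSL2.C k n) (CatSL2.σC k n h)) ∧
          Nonempty (HomotopyEquiv (CatSL2.C k n) (CatSL2.ωC k n h)) ∧
          Nonempty (HomotopyEquiv (CatSL2.C k n) (CatSL2.σψC k n h)) ∧
          Nonempty (HomotopyEquiv (CatSL2.C k n) (CatSL2.ωψC k n h)))) ∧
      -- the two Casimir complexes are homotopy equivalent
      (∀ n : ℤ, Nonempty (HomotopyEquiv (CatSL2.C k n) (CatSL2.C' k n))) := by
  obtain ⟨r, hr⟩ := CatSL2.exists_isExplicit k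
  refine ⟨r, hr, hr.ρψ_inv, fun _ _ => hr.ρσω_inv,
    fun _ _ h => ⟨hr.exists_homotopyC h, hr.exists_homotopyσC h⟩, fun n n' h => ?_,
    hr.homotopyEquiv_C_C'⟩
  have h₁ := hr.isIso_edges h
  have h₂ := hr.isHomotopyEquiv_edges h
  -- These instances are consumed below: `σωψ(C 1_n)` is reached through `ψ(C 1_n)`, and `σψ(C
  -- 1_{-n})` and `ωψ(C 1_{-n})` by an equivalence followed by an isomorphism.
  obtain ⟨i₁, i₂, -, i₃, i₄, i₅, -, -⟩ := h₁
  exact ⟨hr.isIso_edges h, h₂, hr.exists_homotopyEquiv_ρω h, ⟨rfl, hr.triangle_left h⟩,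
    ⟨hr.triangle_right_front h, hr.triangle_right_back h⟩, hr.square_front h, hr.square_top h,
    hr.square_back h, hr.square_bottom h,
    ⟨⟨asIso (r.ρψ n)⟩, ⟨asIso (r.ρσω h)⟩, ⟨asIso (r.ρψ n ≫ r.ψ_ρσω_hat h)⟩⟩,
    h₂.1.nonempty, h₂.2.1.nonempty, (h₂.1.comp (.of_isIso (r.σ_ρψ h))).nonempty,
    (h₂.2.1.comp (.of_isIso (r.ω_ρψ h))).nonempty⟩
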